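/- **Setting.** Let $d\ge 1$, $N^*\ge 1$, $Y\ge 2$ be integers; let $0<\beta<\delta<\min(\zeta,1)$, $m^*\ge 1$, $E^*>0$, $I^*=[0,E^*]$ and $E<E^*$. Euclidean spaces carry the max-norm $|\cdot|$. Let $U^{(2)}:[0,\infty)\to[0,\infty)$ be measurable with $0\le U^{(2)}(r)\le C_U e^{-r^\zeta}$ for all $r\ge0$. Let $\varphi_a\ge 0$ ($a\in\mathbb Z^d$) be measurable functions on $\mathbb R^d$ with supports of diameter at most $r_1<\infty$ and $\sum_{a}\varphi_a(x-a)=C_\varphi>0$ for a.e. $x$, and let $c_V>0$. For a realization $v=(v_a)_{a\in\mathbb Z^d}$ of the scatterers' amplitudes, $v_a\in[0,c_V]$, set $V(x)=\sum_a v_a\varphi_a(x-a)$. For $u\in(\mathbb Z^d)^n$ and an integer $L\ge 0$ let $\Lambda^{(n)}_L(u)=\{x\in(\mathbb R^d)^n: |x-u|<L+\frac12\}$, let $\Lambda^{\rm out}_L(u)$ be the set of its points at distance less than $1$ from its boundary, and let $\chi_u$ be the indicator function of $\{x:|x-u|\le\frac12\}$. Let $H_{\Lambda}$ be the operator $$H_\Lambda=-\tfrac12\Delta+\sum_{i<j}U^{(2)}(|x_i-x_j|)+\sum_{i}V(x_i)$$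 in $L^2(\Lambda)$, $\Lambda=\Lambda^{(n)}_L(u)$, with Dirichlet boundary conditions, $\Sigma(H_\Lambda)$ its spectrum, and $G_\Lambda(E)=(H_\Lambda-E)^{-1}$. Fix constants $C_n>0$ ($n\ge1$); $C_n$ plays the role of the constant of the geometric resolvent inequality for $n$ particles. The cube $\Lambda=\Lambda^{(n)}_L(u)$ is called * $(E,\beta)$-*nonresonant* if $|\mu-E|\ge e^{-L^\beta}$ for all $\mu\in\Sigma(H_\Lambda)$; * $(E,\delta,m)$-*non-singular* if $E\notin\Sigma(H_\Lambda)$ and $C_n(3L)^{nd}\,\|\mathbf 1_{\Lambda^{\rm out}_L(u)}G_\Lambda(E)\chi_u\|\le e^{-mL^\delta}$; * *weakly interactive* if $\max_{i\ne j}|u_i-u_j|\ge 3nL$. For an integer $L_0$ put $L_k=L_0Y^k$ and $m_n=m^*\,(1+4L_0^{-\delta+\beta})^{N^*-n}$, $1\le n\le N^*$. **Lemma B.1.** There is an integer $L_{\min}$ such that the following holds for all $L_0\ge L_{\min}$, all $k\ge0$, $1\le N\le N^*$, $u\in(\mathbb Z^d)^N$ and all $v\in[0,c_V]^{\mathbb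 Z^d}$. Let $\Lambda=\Lambda^{(N)}_{L_k}(u)$ be weakly interactive and $(E,\beta)$-nonresonant. Let $\Lambda=\Lambda'\times\Lambda''$ be the decomposition into cubes $\Lambda'=\Lambda^{(N')}_{L_k}(u')$, $\Lambda''=\Lambda^{(N'')}_{L_k}(u'')$ given by a partition of the particles into two non-empty groups, of $N'$ and $N''$ particles, such that any position of a particle of the first group and any position of a particle of the second group have mutual distance bounded below by a number larger than $L_k$. Suppose that * $\Lambda''$ is $(E-\lambda',\delta,m_{N'})$-non-singular for every $\lambda'\in\Sigma(H_{\Lambda'})\cap I^*$, and * $\Lambda'$ is $(E-\lambda'',\delta,m_{N''})$-non-singular for every $\lambda''\in\Sigma(H_{\Lambda''})\cap I^*$. Then $\Lambda$ is $(E,\delta,m_N)$-non-singular. -/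

import Mathlib

open MeasureTheory Filter Topology Set
open scoped ContDiff ENNReal

noncomputable section

namespace MPAnderson

/-! ### Configurations, cubes, cells -/

/-- Configurations in `ℝ^d` of the particles labelled by the finite set `ι`
(for `ι = Fin N` this is `(ℝ^d)^N`). The norm is the max-norm, the measure is Lebesgue measure. -/
abbrev Config (d : ℕ) (ι : Type) : Type := ι → Fin d → ℝ

/-- Lattice configurations in `ℤ^d` of the particles labelled by `ι`. -/
abbrev LatConfig (d : ℕ) (ι : Type) : Type := ι → Fin d → ℤ

/-- A lattice site regarded as a point of `ℝ^d`. -/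
def siteEmb {d : ℕ} (a : Fin d → ℤ) : Fin d → ℝ := fun j => (a j : ℝ)

/-- A lattice configuration regarded as a configuration in `ℝ^d`. -/
def latEmb {d : ℕ} {ι : Type} (u : LatConfig d ι) : Config d ι := fun i => siteEmb (u i)

variable {d : ℕ} {ι : Type} [Fintype ι]

/-- The open cube of edge length `2L+1` centered at `u`. -/
def cube (u : LatConfig d ι) (L : ℕ) : Set (Config d ι) :=
  {x | ‖x - latEmb u‖ < (L : ℝ) + 1 / 2}

/-- The cell (closed cube of diameter `1`) centered at `u`. -/
def cell (u : LatConfig d ι) : Set (Config d ι) := {x | ‖x - latEmb u‖ ≤ 1 / 2}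

/-- The internal `1`-neighborhood of the boundary of the cube. -/
def cubeOut (u : LatConfig d ι) (L : ℕ) : Set (Config d ι) :=
  cube u L ∩ Metric.thickening 1 (frontier (cube u L))

/-- The set of all positions in `ℝ^d` of single particles from configurations in `A`. -/
def proj (A : Set (Config d ι)) : Set (Fin d → ℝ) := {y | ∃ x ∈ A, ∃ i, y = x i}

lemma isOpen_cube (u : LatConfig d ι) (L : ℕ) : IsOpen (cube u L) :=
  isOpen_lt (by fun_prop) continuous_const

lemma measurableSet_cell (u : LatConfig d ι) : MeasurableSet (cell u) :=
  (isClosed_le (by fun_prop) continuous_const).measurableSet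

lemma measurableSet_cubeOut (u : LatConfig d ι) (L : ℕ) : MeasurableSet (cubeOut u L) :=
  ((isOpen_cube u L).inter Metric.isOpen_thickening).measurableSet

/-! ### Schroedinger operators with Dirichlet boundary conditions -/

/-- The Hilbert space `L²(Λ)`. -/
abbrev L2 (Λ : Set (Config d ι)) : Type := Lp ℂ 2 ((volume : Measure (Config d ι)).restrict Λ)

section Indicator

variable {X : Type} [MeasurableSpace X] (μ : Measure X) (S : Set X) (hS : MeasurableSet S)

/-- The product of `f ∈ L²` with the indicator function of `S`. -/
def indicatorFun (f : Lp ℂ 2 μ) : Lp ℂ 2 μ :=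
  ((Lp.memLp f).indicator hS).toLp (S.indicator ⇑f)

lemma coeFn_indicatorFun (f : Lp ℂ 2 μ) : indicatorFun μ S hS f =ᵐ[μ] S.indicator ⇑f :=
  MemLp.coeFn_toLp _

lemma indicatorFun_add (f g : Lp ℂ 2 μ) :
    indicatorFun μ S hS (f + g) = indicatorFun μ S hS f + indicatorFun μ S hS g := by
  refine Lp.ext ?_
  filter_upwards [coeFn_indicatorFun μ S hS (f + g), coeFn_indicatorFun μ S hS f,
    coeFn_indicatorFun μ S hS g, Lp.coeFn_add f g,
    Lp.coeFn_add (indicatorFun μ S hS f) (indicatorFun μ S hS g)] with x h1 h2 h3 h4 h5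
  rw [h1, h5, Pi.add_apply, h2, h3]
  by_cases hx : x ∈ S
  · rw [indicator_of_mem hx, indicator_of_mem hx, indicator_of_mem hx, h4, Pi.add_apply]
  · rw [indicator_of_notMem hx, indicator_of_notMem hx, indicator_of_notMem hx, add_zero]

lemma indicatorFun_smul (c : ℂ) (f : Lp ℂ 2 μ) :
    indicatorFun μ S hS (c • f) = c • indicatorFun μ S hS f := by
  refine Lp.ext ?_
  filter_upwards [coeFn_indicatorFun μ S hS (c • f), coeFn_indicatorFun μ S hS f,
    Lp.coeFn_smul c f, Lp.coeFn_smul c (indicatorFun μ S hS f)] with x h1 h2 h3 h4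
  rw [h1, h4, Pi.smul_apply, h2]
  by_cases hx : x ∈ S
  · rw [indicator_of_mem hx, indicator_of_mem hx, h3, Pi.smul_apply]
  · rw [indicator_of_notMem hx, indicator_of_notMem hx, smul_zero]

lemma norm_indicatorFun_le (f : Lp ℂ 2 μ) : ‖indicatorFun μ S hS f‖ ≤ 1 * ‖f‖ := by
  rw [one_mul]
  refine Lp.norm_le_norm_of_ae_le ?_
  filter_upwards [coeFn_indicatorFun μ S hS f] with x h1
  rw [h1]
  exact norm_indicator_le_norm_self _ _

/-- Multiplication by the indicator function of `S`, as a bounded operator on `L²`. -/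
def indicatorOp : Lp ℂ 2 μ →L[ℂ] Lp ℂ 2 μ :=
  LinearMap.mkContinuous
    { toFun := indicatorFun μ S hS
      map_add' := indicatorFun_add μ S hS
      map_smul' := indicatorFun_smul μ S hS }
    1 (norm_indicatorFun_le μ S hS)

end Indicator

/-- Smooth functions with compact support inside `Λ`. -/
def IsTestFun (Λ : Set (Config d ι)) (φ : Config d ι → ℂ) : Prop :=
  ContDiff ℝ ∞ φ ∧ HasCompactSupport φ ∧ tsupport φ ⊆ Λ

variable [LinearOrder ι]

/-- Partial derivative in the `j`-th coordinate of the `i`-th particle. -/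
def pderiv (i : ι) (j : Fin d) (φ : Config d ι → ℂ) (x : Config d ι) : ℂ :=
  fderiv ℝ φ x (Pi.single i (Pi.single j 1))

/-- `ψ` lies in the Sobolev space `H¹₀(Λ)`, the `H¹`-closure of the test functions,
and `g` is its weak gradient. -/
def HasH10Grad (Λ : Set (Config d ι)) (ψ : L2 Λ) (g : ι → Fin d → L2 Λ) : Prop :=
  ∃ φ : ℕ → Config d ι → ℂ, (∀ n, IsTestFun Λ (φ n)) ∧
    Tendsto (fun n => eLpNorm (φ n - ⇑ψ) 2 (volume.restrict Λ)) atTop (𝓝 0) ∧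
    ∀ i j, Tendsto (fun n => eLpNorm (pderiv i j (φ n) - ⇑(g i j)) 2 (volume.restrict Λ))
      atTop (𝓝 0)

/-- The graph of the Dirichlet realization `H` of `-½Δ + W` on `L²(Λ)`
(the operator of the closed quadratic form on `H¹₀(Λ)`, for bounded `W`):
`ψ` belongs to the domain of `H`, and `H ψ = η`. -/
def HamGraph (Λ : Set (Config d ι)) (W : Config d ι → ℝ) (ψ η : L2 Λ) : Prop :=
  ∃ g : ι → Fin d → L2 Λ, HasH10Grad Λ ψ g ∧ ∀ φ, IsTestFun Λ φ →
    ∫ x in Λ, ((1 / 2 : ℂ) * ∑ i, ∑ j, g i j x * pderiv i j φ x + (W x : ℂ) * ψ x * φ x)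
      = ∫ x in Λ, η x * φ x

/-- `G = (H - E)⁻¹`: the operator `H - E` is a bijection of the domain of `H` onto `L²(Λ)`, with the
bounded inverse `G`. -/
def IsResolvent (Λ : Set (Config d ι)) (W : Config d ι → ℝ) (E : ℝ) (G : L2 Λ →L[ℂ] L2 Λ) :
    Prop :=
  ∀ ψ η : L2 Λ, HamGraph Λ W ψ (η + (E : ℂ) • ψ) ↔ ψ = G η

/-- The spectrum of `H` (a subset of `ℝ`, as `H` is self-adjoint). -/
def hamSpectrum (Λ : Set (Config d ι)) (W : Config d ι → ℝ) : Set ℝ :=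
  {E | ¬ ∃ G : L2 Λ →L[ℂ] L2 Λ, IsResolvent Λ W E G}

/-! ### The potential -/

/-- The two-body potential is non-negative and decays (sub-)exponentially:
`0 ≤ U₂(r) ≤ C_U exp(-r^ζ)` for `r ≥ 0`. -/
structure IsTwoBody (ζ CU : ℝ) (U₂ : ℝ → ℝ) : Prop where
  measurable : Measurable U₂
  nonneg : ∀ r, 0 ≤ r → 0 ≤ U₂ r
  decay : ∀ r, 0 ≤ r → U₂ r ≤ CU * Real.exp (-r ^ ζ)

/-- The interaction energy `∑_{i<j} U₂(|x_i - x_j|)`. -/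
def interaction (U₂ : ℝ → ℝ) (x : Config d ι) : ℝ :=
  ∑ i, ∑ j with i < j, U₂ ‖x i - x j‖

/-- Flat tiling scatterers: non-negative, with supports of uniformly bounded diameter, the shifted
scatterers adding up to a positive constant (almost everywhere). -/
structure IsFlatTiling (r₁ Cφ : ℝ) (φ : (Fin d → ℤ) → (Fin d → ℝ) → ℝ) : Prop where
  measurable : ∀ a, Measurable (φ a)
  nonneg : ∀ a x, 0 ≤ φ a x
  diam_supp : ∀ a x y, φ a x ≠ 0 → φ a y ≠ 0 → dist x y ≤ r₁
  pos : 0 < Cφ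
  tiling : ∀ᵐ x : Fin d → ℝ, HasSum (fun a => φ a (x - siteEmb a)) Cφ

/-- The one-particle alloy potential with scatterers `φ` and amplitudes `v`. -/
def alloy (φ : (Fin d → ℤ) → (Fin d → ℝ) → ℝ) (v : (Fin d → ℤ) → ℝ) (x : Fin d → ℝ) : ℝ :=
  ∑' a, v a * φ a (x - siteEmb a)

/-- The total potential energy `U(x) + V(x_1) + ⋯ + V(x_N)`. -/
def potential (U₂ : ℝ → ℝ) (φ : (Fin d → ℤ) → (Fin d → ℝ) → ℝ) (v : (Fin d → ℤ) → ℝ)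
    (x : Config d ι) : ℝ :=
  interaction U₂ x + ∑ i, alloy φ v (x i)

/-! ### Non-resonance, non-singularity, weakly interactive cubes -/

/-- `(E,β)`-non-resonance of the cube of radius `L` at `u`, for `H = -½Δ + W`:
the distance from `E` to the spectrum is at least `exp(-L^β)`. -/
def IsNR (W : Config d ι → ℝ) (u : LatConfig d ι) (L : ℕ) (E β : ℝ) : Prop :=
  ∀ μ ∈ hamSpectrum (cube u L) W, Real.exp (-(L : ℝ) ^ β) ≤ |μ - E|

/-- `(E,δ,m)`-non-singularity of the cube of radius `L` at `u`, for `H = -½Δ + W`: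
`E` is outside of the spectrum, and
`C (3L)^{nd} ‖1_{out} (H - E)⁻¹ χ_u‖ ≤ exp(-m L^δ)`, where `n` is the number of particles. -/
def IsNS (C : ℝ) (W : Config d ι → ℝ) (u : LatConfig d ι) (L : ℕ) (E δ m : ℝ) : Prop :=
  ∃ G : L2 (cube u L) →L[ℂ] L2 (cube u L), IsResolvent (cube u L) W E G ∧
    C * (3 * (L : ℝ)) ^ (Fintype.card ι * d) *
      ‖(indicatorOp (volume.restrict (cube u L)) (cubeOut u L) (measurableSet_cubeOut u L)).comp
        (G.comp (indicatorOp (volume.restrict (cube u L)) (cell u) (measurableSet_cell u)))‖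
      ≤ Real.exp (-m * (L : ℝ) ^ δ)

/-- The cube of radius `L` at `u` is weakly interactive: `max_{i≠j} |u_i - u_j| ≥ 3NL`. -/
def IsWI {N : ℕ} (u : LatConfig d (Fin N)) (L : ℕ) : Prop :=
  ∃ i j, i ≠ j ∧ 3 * (N : ℝ) * L ≤ ‖latEmb u i - latEmb u j‖

/-- The part of the configuration `u` consisting of the particles from `J`. -/
def subConfig {N : ℕ} (u : LatConfig d (Fin N)) (J : Finset (Fin N)) : LatConfig d J :=
  fun i => u i

/-- The partition of the particles into `J` and its complement, both non-empty, yields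
a decomposition of the cube into two factor cubes with `dist(ΠΛ', ΠΛ'') > L`. -/
def IsDecomp {N : ℕ} (u : LatConfig d (Fin N)) (L : ℕ) (J : Finset (Fin N)) : Prop :=
  J.Nonempty ∧ Jᶜ.Nonempty ∧
    (L : ℝ≥0∞) < ⨅ x ∈ proj (cube (subConfig u J) L),
      ⨅ y ∈ proj (cube (subConfig u Jᶜ) L), edist x y

/-- The masses `m_n = m* (1 + 4 L₀^{-δ+β})^{N* - n}`, for `n ≤ N*`. -/
def mass (mstar β δ : ℝ) (Nstar L₀ n : ℕ) : ℝ :=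
  mstar * (1 + 4 * (L₀ : ℝ) ^ (-δ + β)) ^ (Nstar - n)

end MPAnderson

end

open MeasureTheory Filter Topology Set
open scoped ContDiff ENNReal

noncomputable section

namespace MPAnderson

section

/-! ### Multiplication operators -/

section Multiplication

variable {X : Type} [MeasurableSpace X] {μ : Measure X}

/-! Let `L` be the side parameter of the cube. If the interaction between the two groups of
particles is dropped, the Hamiltonian becomes `H₀ = H' ⊗ 1 + 1 ⊗ H''`. In the max-norm the boundary
layer of the product cube lies in the union of the preimages of the boundary layers of the two
factors, while the cell at the centre is the product of the cells. For the layer of the second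
factor, expand a solution `f` of `(H₀ - E) f = χ η` in an eigenbasis of `H'`: the component `f_k`
solves `(H'' - (E - λ_k)) f_k = χ'' η_k`. If `λ_k ≤ E*`, non-singularity of the second cube at `E -
λ_k` makes `f_k` small near the boundary. If `λ_k > E*`, then `E - λ_k` lies below `-(E* - E) < 0`,
whereas `H'' ≥ 0`, and a Combes–Thomas estimate gives decay at rate `√(E* - E)`. Both bounds are
uniform in `k`, so Parseval's identity sums them without any counting of eigenvalues
(`norm_indicatorOp_snd_le`). The other layer is treated with the groups exchanged.

The dropped interaction is `O(exp(-L^ζ))`, because the groups are farther apart than `L`.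
Non-resonance bounds the full resolvent by `exp(L^β)`, and `β < ζ`, so a Neumann series
(`exists_perturbed_solution`) turns `G χ η` into a solution for `H₀` with error `O(exp(2 L^β -
L^ζ))`. Finally, fewer particles have a larger mass: `m_n L^δ ≥ m_N L^δ + 4 L^β` for `n < N`
(`mass_mul_rpow_add_le`). The surplus `exp(-4 L^β)` absorbs the polynomial prefactor and the
constants, and the other two errors are negligible because `δ < 1` and `δ < ζ`.

The Hamiltonians are given only through their weak form, so their spectral theory is built first.
With a form-norm isometry, `(H + 1)⁻¹` becomes `B* P B` for an orthogonal projection `P`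
(`exists_resolvent_neg_one`). It is compact, because grid averages approximate `H¹₀` functions in
`L²` (`exists_finiteRank_approx`). The spectral theorem then yields `exists_hamDiag`: membership in
the graph of `H` is a condition on coordinates in an eigenbasis, which reduces both the resolvent
bound and the separation of variables to coefficients. -/

lemma inner_L2_eq (f g : Lp ℂ 2 μ) :
    inner ℂ f g = ∫ x, g x * (starRingEnd ℂ) (f x) ∂μ := by
  rw [L2.inner_def]; rfl

/-- Multiplication by an essentially bounded function, as a bounded operator on `L²`. -/
def mulOp {w : X → ℂ} (hw : MemLp w ∞ μ) : Lp ℂ 2 μ →L[ℂ] Lp ℂ 2 μ :=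
  (ContinuousLinearMap.mul ℂ ℂ).holderL μ ∞ 2 2 (hw.toLp w)

lemma coeFn_mulOp {w : X → ℂ} (hw : MemLp w ∞ μ) (f : Lp ℂ 2 μ) :
    mulOp hw f =ᵐ[μ] fun x => w x * f x := by
  filter_upwards [(ContinuousLinearMap.mul ℂ ℂ).coeFn_holder (r := 2) (hw.toLp w) f,
    hw.coeFn_toLp] with x h1 h2
  rw [← h2]
  exact h1

lemma norm_mulOp_apply_le {w : X → ℂ} (hw : MemLp w ∞ μ) {c : ℝ}
    (hc : ∀ᵐ x ∂μ, ‖w x‖ ≤ c) (f : Lp ℂ 2 μ) : ‖mulOp hw f‖ ≤ c * ‖f‖ := by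
  refine Lp.norm_le_mul_norm_of_ae_le_mul ?_
  filter_upwards [coeFn_mulOp hw f, hc] with x h1 h2
  rw [h1, norm_mul]
  exact mul_le_mul_of_nonneg_right h2 (norm_nonneg _)

lemma mulOp_mulOp_of_mul_eq_one {w w' : X → ℂ} (hw : MemLp w ∞ μ) (hw' : MemLp w' ∞ μ)
    (h : ∀ᵐ x ∂μ, w x * w' x = 1) (f : Lp ℂ 2 μ) : mulOp hw (mulOp hw' f) = f := by
  refine Lp.ext ?_
  filter_upwards [coeFn_mulOp hw (mulOp hw' f), coeFn_mulOp hw' f, h] with x h1 h2 h3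
  rw [h1, h2, ← mul_assoc, h3, one_mul]

lemma inner_mulOp_left {w : X → ℂ} (hw : MemLp w ∞ μ)
    (hreal : ∀ᵐ x ∂μ, (starRingEnd ℂ) (w x) = w x) (f g : Lp ℂ 2 μ) :
    inner ℂ (mulOp hw f) g = inner ℂ f (mulOp hw g) := by
  rw [inner_L2_eq, inner_L2_eq]
  refine integral_congr_ae ?_
  filter_upwards [coeFn_mulOp hw f, coeFn_mulOp hw g, hreal] with x h1 h2 h3
  rw [h1, h2, map_mul, h3]
  ring

lemma memLp_top_ofReal {w : X → ℝ} (hw : AEMeasurable w μ) {c : ℝ}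
    (hc : ∀ᵐ x ∂μ, |w x| ≤ c) : MemLp (fun x => (w x : ℂ)) ∞ μ := by
  refine memLp_top_of_bound (Complex.measurable_ofReal.comp_aemeasurable hw).aestronglyMeasurable c
    ?_
  filter_upwards [hc] with x hx
  rw [Complex.norm_real]
  exact hx

end Multiplication

/-! ### Test functions -/

variable {d : ℕ} {ι : Type} [Fintype ι]

namespace IsTestFun

variable {Λ : Set (Config d ι)} {φ χ : Config d ι → ℂ}

lemma memLp (hφ : IsTestFun Λ φ) : MemLp φ 2 (volume.restrict Λ) :=
  (hφ.1.continuous.memLp_of_hasCompactSupport hφ.2.1).restrict Λ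

/-- A test function as an element of `L²`. -/
def toL2 (hφ : IsTestFun Λ φ) : L2 Λ := hφ.memLp.toLp φ

lemma coeFn_toL2 (hφ : IsTestFun Λ φ) : hφ.toL2 =ᵐ[volume.restrict Λ] φ := hφ.memLp.coeFn_toLp

lemma conj (hφ : IsTestFun Λ φ) : IsTestFun Λ (fun x => (starRingEnd ℂ) (φ x)) :=
  ⟨Complex.conjCLE.contDiff.comp hφ.1, hφ.2.1.comp_left (map_zero _),
    (closure_mono (fun x hx => by
      simp only [Function.mem_support, ne_eq, map_eq_zero] at hx ⊢; exact hx)).trans hφ.2.2⟩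

lemma add (hφ : IsTestFun Λ φ) (hχ : IsTestFun Λ χ) : IsTestFun Λ (φ + χ) :=
  ⟨hφ.1.add hχ.1, hφ.2.1.add hχ.2.1,
    (tsupport_add φ χ).trans (union_subset hφ.2.2 hχ.2.2)⟩

lemma smul (c : ℂ) (hφ : IsTestFun Λ φ) : IsTestFun Λ (c • φ) :=
  ⟨contDiff_const.smul hφ.1, hφ.2.1.smul_left (f := fun _ => c),
    (tsupport_smul_subset_right (fun _ => c) φ).trans hφ.2.2⟩

lemma mul_left {w : Config d ι → ℂ} (hw : ContDiff ℝ ∞ w) (hφ : IsTestFun Λ φ) :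
    IsTestFun Λ (fun x => w x * φ x) :=
  ⟨hw.mul hφ.1, hφ.2.1.mul_left, (tsupport_mul_subset_right (f := w)).trans hφ.2.2⟩

lemma zero : IsTestFun Λ (0 : Config d ι → ℂ) :=
  ⟨contDiff_const, HasCompactSupport.zero, by simp⟩

lemma toL2_add (hφ : IsTestFun Λ φ) (hχ : IsTestFun Λ χ) :
    (hφ.add hχ).toL2 = hφ.toL2 + hχ.toL2 := MemLp.toLp_add _ _

lemma toL2_congr (hφ : IsTestFun Λ φ) (hχ : IsTestFun Λ χ) (h : φ = χ) :
    hφ.toL2 = hχ.toL2 := by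
  subst h; rfl

lemma toL2_smul (c : ℂ) (hφ : IsTestFun Λ φ) : (hφ.smul c).toL2 = c • hφ.toL2 :=
  MemLp.toLp_const_smul c _

lemma toL2_zero : (zero (Λ := Λ)).toL2 = 0 := by
  rw [toL2_congr zero (zero.smul (0 : ℂ)) (smul_zero _).symm, toL2_smul 0 zero, zero_smul]

end IsTestFun

variable {Λ : Set (Config d ι)}

lemma integral_mul_eq_inner {f : L2 Λ} {φ : Config d ι → ℂ} (hφ : IsTestFun Λ φ) :
    ∫ x in Λ, f x * (starRingEnd ℂ) (φ x) = inner ℂ hφ.toL2 f := by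
  rw [inner_L2_eq]
  refine integral_congr_ae ?_
  filter_upwards [hφ.coeFn_toL2] with x hx
  rw [hx]

lemma integrable_mul_conj (f : L2 Λ) {φ : Config d ι → ℂ} (hφ : IsTestFun Λ φ) :
    Integrable (fun x => f x * (starRingEnd ℂ) (φ x)) (volume.restrict Λ) :=
  (Lp.memLp f).integrable_mul hφ.conj.memLp

/-- The Hilbert space of functions together with candidates for their gradients. -/
abbrev JetSpace (Λ : Set (Config d ι)) : Type := PiLp 2 (fun _ : Option (ι × Fin d) => L2 Λ)

/-- A function and a gradient field, as an element of `JetSpace Λ`. -/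
def mkJet (ψ : L2 Λ) (g : ι → Fin d → L2 Λ) : JetSpace Λ :=
  WithLp.toLp 2 (fun o => o.elim ψ (fun p => g p.1 p.2))

@[simp] lemma mkJet_none (ψ : L2 Λ) (g : ι → Fin d → L2 Λ) : mkJet ψ g none = ψ := rfl

@[simp] lemma mkJet_some (ψ : L2 Λ) (g : ι → Fin d → L2 Λ) (p : ι × Fin d) :
    mkJet ψ g (some p) = g p.1 p.2 := rfl

lemma jet_ext {x y : JetSpace Λ} (h : x none = y none)
    (h' : ∀ i j, x (some (i, j)) = y (some (i, j))) : x = y := by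
  ext1 o
  rcases o with _ | ⟨i, j⟩
  · exact h
  · exact h' i j

lemma inner_jet (x y : JetSpace Λ) :
    inner ℂ x y = inner ℂ (x none) (y none)
      + ∑ i, ∑ j, inner ℂ (x (some (i, j))) (y (some (i, j))) := by
  rw [PiLp.inner_apply, Fintype.sum_option, Fintype.sum_prod_type]

lemma tendsto_jet_iff {z : ℕ → JetSpace Λ} {y : JetSpace Λ} :
    Tendsto z atTop (𝓝 y) ↔ ∀ o, Tendsto (fun n => z n o) atTop (𝓝 (y o)) := by
  rw [← tendsto_pi_nhds (f := fun n => WithLp.ofLp (z n)) (g := WithLp.ofLp y)]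
  exact ⟨fun h => ((PiLp.continuous_ofLp 2 _).tendsto y).comp h,
    fun h => ((PiLp.continuous_toLp 2 _).tendsto (WithLp.ofLp y)).comp h⟩

variable [LinearOrder ι]

lemma contDiff_pderiv {φ : Config d ι → ℂ} (hφ : ContDiff ℝ ∞ φ) (i : ι) (j : Fin d) :
    ContDiff ℝ ∞ (pderiv i j φ) :=
  (hφ.fderiv_right (m := ∞) le_rfl).clm_apply contDiff_const

lemma IsTestFun.pderiv {Λ : Set (Config d ι)} {φ : Config d ι → ℂ} (hφ : IsTestFun Λ φ)
    (i : ι) (j : Fin d) : IsTestFun Λ (pderiv i j φ) :=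
  ⟨contDiff_pderiv hφ.1 i j, hφ.2.1.fderiv_apply ℝ _,
    (tsupport_fderiv_apply_subset ℝ _).trans hφ.2.2⟩

lemma pderiv_conj {φ : Config d ι → ℂ} (hφ : ContDiff ℝ ∞ φ) (i : ι) (j : Fin d) :
    pderiv i j (fun x => (starRingEnd ℂ) (φ x)) = fun x => (starRingEnd ℂ) (pderiv i j φ x) := by
  funext x
  have h := (Complex.conjCLE.toContinuousLinearMap.hasFDerivAt (x := φ x)).comp x
    (hφ.differentiable (by simp) x).hasFDerivAt
  exact congrArg (fun L => L (Pi.single i (Pi.single j 1))) h.fderiv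

lemma pderiv_add {φ χ : Config d ι → ℂ} (hφ : ContDiff ℝ ∞ φ) (hχ : ContDiff ℝ ∞ χ)
    (i : ι) (j : Fin d) : pderiv i j (φ + χ) = pderiv i j φ + pderiv i j χ := by
  funext x
  exact congrArg (fun L => L (Pi.single i (Pi.single j 1)))
    (fderiv_add (hφ.differentiable (by simp) x) (hχ.differentiable (by simp) x))

lemma pderiv_smul {φ : Config d ι → ℂ} (c : ℂ) (hφ : ContDiff ℝ ∞ φ) (i : ι) (j : Fin d) :
    pderiv i j (c • φ) = c • pderiv i j φ := by
  funext x
  exact congrArg (fun L => L (Pi.single i (Pi.single j 1)))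
    (fderiv_const_smul (hφ.differentiable (by simp) x) c)

lemma pderiv_mul {w φ : Config d ι → ℂ} (hw : ContDiff ℝ ∞ w) (hφ : ContDiff ℝ ∞ φ)
    (i : ι) (j : Fin d) :
    pderiv i j (fun x => w x * φ x) = fun x => w x * pderiv i j φ x + pderiv i j w x * φ x := by
  funext x
  refine (congrArg (fun L => L (Pi.single i (Pi.single j 1)))
    (fderiv_mul (hw.differentiable (by simp) x) (hφ.differentiable (by simp) x))).trans ?_
  simp [pderiv, mul_comm]

/-! ### The Sobolev space `H¹₀` -/

/-- Moves the convergence from seminorms of representatives to the norm of `L²`, where continuity of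
operators can be used. -/
lemma hasH10Grad_iff_seq {ψ : L2 Λ} {g : ι → Fin d → L2 Λ} :
    HasH10Grad Λ ψ g ↔ ∃ (φ : ℕ → Config d ι → ℂ) (hφ : ∀ n, IsTestFun Λ (φ n)),
      Tendsto (fun n => (hφ n).toL2) atTop (𝓝 ψ) ∧
      ∀ i j, Tendsto (fun n => ((hφ n).pderiv i j).toL2) atTop (𝓝 (g i j)) := by
  have key : ∀ (φ : ℕ → Config d ι → ℂ) (hφ : ∀ n, IsTestFun Λ (φ n)) (f : L2 Λ),
      Tendsto (fun n => (hφ n).toL2) atTop (𝓝 f) ↔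
        Tendsto (fun n => eLpNorm (φ n - ⇑f) 2 (volume.restrict Λ)) atTop (𝓝 0) := by
    intro φ hφ f
    rw [Lp.tendsto_Lp_iff_tendsto_eLpNorm']
    refine tendsto_congr fun n => eLpNorm_congr_ae ?_
    filter_upwards [(hφ n).coeFn_toL2] with x hx
    rw [Pi.sub_apply, Pi.sub_apply, hx]
  constructor
  · rintro ⟨φ, hφ, h0, h1⟩
    exact ⟨φ, hφ, (key φ hφ ψ).2 h0,
      fun i j => (key _ (fun n => (hφ n).pderiv i j) _).2 (h1 i j)⟩
  · rintro ⟨φ, hφ, h0, h1⟩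
    exact ⟨φ, hφ, (key φ hφ ψ).1 h0,
      fun i j => (key _ (fun n => (hφ n).pderiv i j) _).1 (h1 i j)⟩

/-- The jets of test functions. -/
def testJets (Λ : Set (Config d ι)) : Submodule ℂ (JetSpace Λ) where
  carrier := {z | ∃ (φ : Config d ι → ℂ) (hφ : IsTestFun Λ φ),
    z = mkJet hφ.toL2 (fun i j => (hφ.pderiv i j).toL2)}
  zero_mem' := by
    refine ⟨0, IsTestFun.zero, jet_ext ?_ fun i j => ?_⟩
    · rw [PiLp.zero_apply, mkJet_none, IsTestFun.toL2_zero]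
    · rw [PiLp.zero_apply, mkJet_some,
        IsTestFun.toL2_congr _ IsTestFun.zero (by funext x; simp [pderiv]), IsTestFun.toL2_zero]
  add_mem' := by
    rintro _ _ ⟨φ, hφ, rfl⟩ ⟨χ, hχ, rfl⟩
    refine ⟨φ + χ, hφ.add hχ, jet_ext ?_ fun i j => ?_⟩
    · rw [PiLp.add_apply, mkJet_none, mkJet_none, mkJet_none, IsTestFun.toL2_add]
    · rw [PiLp.add_apply, mkJet_some, mkJet_some, mkJet_some, ← IsTestFun.toL2_add]
      exact IsTestFun.toL2_congr _ _ (pderiv_add hφ.1 hχ.1 i j).symm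
  smul_mem' := by
    rintro c _ ⟨φ, hφ, rfl⟩
    refine ⟨c • φ, hφ.smul c, jet_ext ?_ fun i j => ?_⟩
    · rw [PiLp.smul_apply, mkJet_none, mkJet_none, IsTestFun.toL2_smul]
    · rw [PiLp.smul_apply, mkJet_some, mkJet_some, ← IsTestFun.toL2_smul]
      exact IsTestFun.toL2_congr _ _ (pderiv_smul c hφ.1 i j).symm

/-- The Sobolev space `H¹₀(Λ)`, as the space of the jets of its elements. -/
def H10 (Λ : Set (Config d ι)) : Submodule ℂ (JetSpace Λ) := (testJets Λ).topologicalClosure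

/-- Identifies weak gradients with the points of a closed subspace of a Hilbert space, which makes
orthogonal projection available. -/
lemma hasH10Grad_iff_mem {ψ : L2 Λ} {g : ι → Fin d → L2 Λ} :
    HasH10Grad Λ ψ g ↔ mkJet ψ g ∈ H10 Λ := by
  rw [hasH10Grad_iff_seq, H10, ← SetLike.mem_coe, Submodule.topologicalClosure_coe,
    mem_closure_iff_seq_limit]
  constructor
  · rintro ⟨φ, hφ, h0, h1⟩
    refine ⟨fun n => mkJet (hφ n).toL2 (fun i j => ((hφ n).pderiv i j).toL2),
      fun n => ⟨φ n, hφ n, rfl⟩, tendsto_jet_iff.2 ?_⟩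
    rintro (_ | ⟨i, j⟩)
    · exact h0
    · exact h1 i j
  · rintro ⟨z, hz, hlim⟩
    choose φ hφ h using hz
    rw [tendsto_jet_iff] at hlim
    refine ⟨φ, hφ, ?_, fun i j => ?_⟩
    · exact (hlim none).congr fun n => by rw [h n]; rfl
    · exact (hlim (some (i, j))).congr fun n => by rw [h n]; rfl

/-! ### The Hamiltonian in terms of inner products -/

/-- The defining weak form is bilinear. Test functions are stable under conjugation, so testing with
the conjugate of `φ` gives the sesquilinear form. -/
lemma hamGraph_iff_inner {W : Config d ι → ℝ}
    (hW : MemLp (fun x => (W x : ℂ)) ∞ (volume.restrict Λ)) {ψ η : L2 Λ} :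
    HamGraph Λ W ψ η ↔ ∃ g : ι → Fin d → L2 Λ, HasH10Grad Λ ψ g ∧
      ∀ φ (hφ : IsTestFun Λ φ), (1 / 2 : ℂ) * ∑ i, ∑ j, inner ℂ (hφ.pderiv i j).toL2 (g i j)
        + inner ℂ hφ.toL2 (mulOp hW ψ) = inner ℂ hφ.toL2 η := by
  have key : ∀ (g : ι → Fin d → L2 Λ) φ (hφ : IsTestFun Λ φ),
      ∫ x in Λ, ((1 / 2 : ℂ) * ∑ i, ∑ j, g i j x * pderiv i j (fun x => (starRingEnd ℂ) (φ x)) x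
        + (W x : ℂ) * ψ x * (starRingEnd ℂ) (φ x)) =
      (1 / 2 : ℂ) * ∑ i, ∑ j, inner ℂ (hφ.pderiv i j).toL2 (g i j)
        + inner ℂ hφ.toL2 (mulOp hW ψ) := by
    intro g φ hφ
    simp only [pderiv_conj hφ.1]
    have hint : ∀ i j, Integrable (fun x => g i j x * (starRingEnd ℂ) (pderiv i j φ x))
        (volume.restrict Λ) := fun i j => integrable_mul_conj _ (hφ.pderiv i j)
    have hWint : (fun x => mulOp hW ψ x * (starRingEnd ℂ) (φ x)) =ᵐ[volume.restrict Λ]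
        fun x => (W x : ℂ) * ψ x * (starRingEnd ℂ) (φ x) := by
      filter_upwards [coeFn_mulOp hW ψ] with x hx
      rw [hx]
    rw [integral_add, integral_const_mul, integral_finsetSum]
    · congr 1
      · congr 1
        refine Finset.sum_congr rfl fun i _ => ?_
        rw [integral_finsetSum _ fun j _ => hint i j]
        exact Finset.sum_congr rfl fun j _ => integral_mul_eq_inner (hφ.pderiv i j)
      · rw [← integral_mul_eq_inner hφ]
        exact (integral_congr_ae hWint).symm
    · exact fun i _ => integrable_finsetSum _ fun j _ => hint i j
    · exact (integrable_finsetSum _ fun i _ => integrable_finsetSum _ fun j _ => hint i j).const_mul _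
    · exact (integrable_mul_conj _ hφ).congr hWint
  refine exists_congr fun g => and_congr_right fun _ => ⟨fun h φ hφ => ?_, fun h φ hφ => ?_⟩
  · rw [← key, ← integral_mul_eq_inner hφ]
    exact h _ hφ.conj
  · have := h _ hφ.conj
    rw [← key, ← integral_mul_eq_inner hφ.conj] at this
    simpa using this

end

section

/-! ### The resolvent at `-1` -/

variable {d : ℕ} {ι : Type} [Fintype ι] {Λ : Set (Config d ι)}

/-- An element of `L²(Λ)` orthogonal to all test functions vanishes. -/
lemma eq_zero_of_inner_testFun (hΛ : IsOpen Λ) {f : L2 Λ}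
    (h : ∀ φ (hφ : IsTestFun Λ φ), inner ℂ hφ.toL2 f = 0) : f = 0 := by
  have hloc : LocallyIntegrable (Λ.indicator f) volume :=
    ((memLp_indicator_iff_restrict hΛ.measurableSet).2 (Lp.memLp f)).locallyIntegrable (by norm_num)
  have h2 := hΛ.ae_eq_zero_of_integral_contDiff_smul_eq_zero (hloc.locallyIntegrableOn _)
    (fun g hg hgs hgt => by
      have hφ : IsTestFun Λ (fun x => (g x : ℂ)) :=
        ⟨Complex.ofRealCLM.contDiff.comp hg, hgs.comp_left Complex.ofReal_zero,
          (closure_mono fun x hx => by simpa using hx).trans hgt⟩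
      have h3 := h _ hφ
      rw [← integral_mul_eq_inner, ← integral_indicator hΛ.measurableSet] at h3
      rw [← h3]
      refine integral_congr_ae (Eventually.of_forall fun x => ?_)
      by_cases hx : x ∈ Λ
      · simp [hx, mul_comm]
      · simp [hx])
  refine Lp.ext ?_
  rw [← ae_restrict_iff' hΛ.measurableSet] at h2
  filter_upwards [h2, Lp.coeFn_zero ℂ 2 (volume.restrict Λ),
    ae_restrict_mem hΛ.measurableSet] with x h1 h3 h4
  rw [h3, Pi.zero_apply, ← h1, indicator_of_mem h4]

/-- The diagonal operator on jets which multiplies the function by `w` and the gradient by `c`. -/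
def diagJet {w : Config d ι → ℂ} (hw : MemLp w ∞ (volume.restrict Λ)) (c : ℂ) :
    JetSpace Λ →L[ℂ] JetSpace Λ :=
  (PiLp.continuousLinearEquiv 2 ℂ _).symm.toContinuousLinearMap.comp
    ((ContinuousLinearMap.pi fun o : Option (ι × Fin d) =>
      o.elim ((mulOp hw).comp (ContinuousLinearMap.proj none))
        fun p => c • ContinuousLinearMap.proj (some p)).comp
    (PiLp.continuousLinearEquiv 2 ℂ _).toContinuousLinearMap)

@[simp] lemma diagJet_none {w : Config d ι → ℂ} (hw : MemLp w ∞ (volume.restrict Λ)) (c : ℂ)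
    (z : JetSpace Λ) : diagJet hw c z none = mulOp hw (z none) := rfl

@[simp] lemma diagJet_some {w : Config d ι → ℂ} (hw : MemLp w ∞ (volume.restrict Λ)) (c : ℂ)
    (z : JetSpace Λ) (p : ι × Fin d) : diagJet hw c z (some p) = c • z (some p) := rfl

/-- The embedding of functions into jets with gradient zero, multiplying by `w`. -/
def embJet {w : Config d ι → ℂ} (hw : MemLp w ∞ (volume.restrict Λ)) :
    L2 Λ →L[ℂ] JetSpace Λ :=
  (PiLp.continuousLinearEquiv 2 ℂ _).symm.toContinuousLinearMap.comp
    (ContinuousLinearMap.pi fun o : Option (ι × Fin d) => o.elim (mulOp hw) fun _ => 0)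

@[simp] lemma embJet_none {w : Config d ι → ℂ} (hw : MemLp w ∞ (volume.restrict Λ))
    (f : L2 Λ) : embJet hw f none = mulOp hw f := rfl

@[simp] lemma embJet_some {w : Config d ι → ℂ} (hw : MemLp w ∞ (volume.restrict Λ))
    (f : L2 Λ) (p : ι × Fin d) : embJet hw f (some p) = 0 := rfl

lemma norm_sq_jet (z : JetSpace Λ) : ‖z‖ ^ 2 = ‖z none‖ ^ 2 + ∑ p, ‖z (some p)‖ ^ 2 := by
  rw [PiLp.norm_sq_eq_of_L2, Fintype.sum_option]

/-- A bounded non-negative potential. -/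
structure IsBddPot (Λ : Set (Config d ι)) (W : Config d ι → ℝ) : Prop where
  aemeasurable : AEMeasurable W (volume.restrict Λ)
  nonneg : ∀ᵐ x ∂volume.restrict Λ, 0 ≤ W x
  bdd : ∃ c, ∀ᵐ x ∂volume.restrict Λ, W x ≤ c

lemma IsBddPot.memLp {W : Config d ι → ℝ} (hW : IsBddPot Λ W) :
    MemLp (fun x => (W x : ℂ)) ∞ (volume.restrict Λ) := by
  obtain ⟨c, hc⟩ := hW.bdd
  refine memLp_top_ofReal hW.aemeasurable (c := c) ?_
  filter_upwards [hW.nonneg, hc] with x h1 h2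
  rwa [abs_of_nonneg h1]

/-- Multiplication by `w = (1 + W)^{1/2}` and by `w' = (1 + W)^{-1/2}`. -/
lemma IsBddPot.exists_sqrt {W : Config d ι → ℝ} (hW : IsBddPot Λ W) :
    ∃ (w w' : Config d ι → ℂ) (hw : MemLp w ∞ (volume.restrict Λ))
      (hw' : MemLp w' ∞ (volume.restrict Λ)),
      (∀ f, mulOp hw (mulOp hw' f) = f) ∧ (∀ f, mulOp hw' (mulOp hw f) = f) ∧
      (∀ f, mulOp hw (mulOp hw f) = f + mulOp hW.memLp f) ∧
      (∀ f g, inner ℂ (mulOp hw f) g = inner ℂ f (mulOp hw g)) ∧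
      (∀ f g, inner ℂ (mulOp hw' f) g = inner ℂ f (mulOp hw' g)) ∧
      ∀ f, ‖mulOp hw' f‖ ≤ ‖f‖ := by
  obtain ⟨c, hc⟩ := hW.bdd
  have hpos : ∀ᵐ x ∂volume.restrict Λ, 0 < Real.sqrt (1 + W x) := by
    filter_upwards [hW.nonneg] with x hx
    positivity
  have hw : MemLp (fun x => (Real.sqrt (1 + W x) : ℂ)) ∞ (volume.restrict Λ) := by
    refine memLp_top_ofReal (hW.aemeasurable.const_add 1).sqrt (c := Real.sqrt (1 + c)) ?_
    filter_upwards [hc] with x hx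
    rw [abs_of_nonneg (Real.sqrt_nonneg _)]
    exact Real.sqrt_le_sqrt (by linarith)
  have hb : ∀ᵐ x ∂volume.restrict Λ, |(Real.sqrt (1 + W x))⁻¹| ≤ 1 := by
    filter_upwards [hW.nonneg] with x hx
    rw [abs_of_nonneg (by positivity)]
    exact inv_le_one_of_one_le₀ (Real.one_le_sqrt.2 (by linarith))
  have hw' : MemLp (fun x => (((Real.sqrt (1 + W x))⁻¹ : ℝ) : ℂ)) ∞ (volume.restrict Λ) :=
    memLp_top_ofReal (hW.aemeasurable.const_add 1).sqrt.inv hb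
  refine ⟨_, _, hw, hw', mulOp_mulOp_of_mul_eq_one _ _ ?_, mulOp_mulOp_of_mul_eq_one _ _ ?_,
    fun f => Lp.ext ?_,
    inner_mulOp_left hw (Eventually.of_forall fun x => Complex.conj_ofReal _),
    inner_mulOp_left hw' (Eventually.of_forall fun x => Complex.conj_ofReal _), fun f => ?_⟩
  · filter_upwards [hpos] with x hx
    rw [← Complex.ofReal_mul, mul_inv_cancel₀ hx.ne', Complex.ofReal_one]
  · filter_upwards [hpos] with x hx
    rw [← Complex.ofReal_mul, inv_mul_cancel₀ hx.ne', Complex.ofReal_one]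
  · filter_upwards [coeFn_mulOp hw (mulOp hw f), coeFn_mulOp hw f, coeFn_mulOp hW.memLp f,
      Lp.coeFn_add f (mulOp hW.memLp f), hW.nonneg] with x h1 h2 h3 h4 h5
    rw [h1, h2, h4, Pi.add_apply, h3, ← mul_assoc, ← Complex.ofReal_mul,
      Real.mul_self_sqrt (by linarith)]
    push_cast; ring
  · simpa using norm_mulOp_apply_le hw' (c := 1)
      (by filter_upwards [hb] with x hx; rwa [Complex.norm_real]) f

variable [LinearOrder ι]

/-- The operator `(H + 1)⁻¹`, for `H = -½Δ + W` with Dirichlet boundary conditions and a bounded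
potential `W ≥ 0`. -/
theorem exists_resolvent_neg_one (hΛ : IsOpen Λ) {W : Config d ι → ℝ} (hW : IsBddPot Λ W) :
    ∃ R : L2 Λ →L[ℂ] L2 Λ, R.IsSymmetric ∧ (∀ η, R η = 0 → η = 0) ∧ (∀ η, ‖R η‖ ≤ ‖η‖) ∧
      (∀ η, 0 ≤ (inner ℂ (R η) η).re) ∧
      (∀ ψ η, HamGraph Λ W ψ η ↔ ψ = R (η + ψ)) ∧
      ∀ η, ∃ g, HasH10Grad Λ (R η) g ∧ ∀ i j, ‖g i j‖ ≤ 2 * ‖η‖ := by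
  obtain ⟨w, w', hw, hw', hww', hw'w, hwW, hsymm, hsymm', hnorm'⟩ := hW.exists_sqrt
  -- Here `a = 1/√2`, so that `a * a` is the factor `1/2` of the kinetic energy, and `b = √2` is its
  -- inverse.
  obtain ⟨a, b, hba, hab, haa, haconj, hbnorm⟩ : ∃ a b : ℂ, b * a = 1 ∧ a * b = 1 ∧
      a * a = 1 / 2 ∧ (starRingEnd ℂ) a = a ∧ ‖b‖ ≤ 2 := by
    refine ⟨((Real.sqrt 2)⁻¹ : ℝ), (Real.sqrt 2 : ℝ), ?_, ?_, ?_, Complex.conj_ofReal _, ?_⟩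
    · rw [← Complex.ofReal_mul, mul_inv_cancel₀ (by positivity), Complex.ofReal_one]
    · rw [← Complex.ofReal_mul, inv_mul_cancel₀ (by positivity), Complex.ofReal_one]
    · rw [← Complex.ofReal_mul, ← mul_inv, Real.mul_self_sqrt (by norm_num)]
      norm_num
    · rw [Complex.norm_real, Real.norm_of_nonneg (by positivity)]
      exact Real.sqrt_le_iff.2 (by norm_num)
  -- `D` sends a jet to `((1 + W)^{1/2} ψ, 2^{-1/2} ∇ψ)`. Its squared norm is the form of `H + 1`,
  -- so solving `(H + 1) ψ = η` becomes an orthogonality problem.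
  set D := diagJet hw a with hD
  set D' := diagJet hw' b with hD'
  set B := embJet hw' with hB
  have hDD' : ∀ z, D (D' z) = z := fun z => jet_ext (by simp [hD, hD', hww'])
    fun i j => by simp [hD, hD', smul_smul, hab]
  have hD'D : ∀ z, D' (D z) = z := fun z => jet_ext (by simp [hD, hD', hw'w])
    fun i j => by simp [hD, hD', smul_smul, hba]
  -- Since `D'` inverts `D`, this is the image of `H¹₀` under `D`; written as a preimage it is
  -- visibly closed.
  set V : Submodule ℂ (JetSpace Λ) := (H10 Λ).comap D'.toLinearMap with hV
  have hVclosed : IsClosed (V : Set (JetSpace Λ)) :=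
    (Submodule.isClosed_topologicalClosure _).preimage D'.continuous
  have : CompleteSpace V := hVclosed.completeSpace_coe
  set P : JetSpace Λ →L[ℂ] JetSpace Λ := V.starProjection with hP
  set N : JetSpace Λ →L[ℂ] L2 Λ := (mulOp hw').comp (PiLp.proj 2 _ none) with hN
  have hBadj : ∀ f z, inner ℂ (B f) z = inner ℂ f (N z) := fun f z => by
    rw [inner_jet]
    simp [hB, hN, hsymm']
  have hBadj' : ∀ f z, inner ℂ (N z) f = inner ℂ z (B f) := fun f z => by
    rw [← inner_conj_symm, ← hBadj, inner_conj_symm]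
  have hBnorm : ∀ f, ‖B f‖ ≤ ‖f‖ := fun f => by
    refine le_of_sq_le_sq ?_ (norm_nonneg _)
    rw [norm_sq_jet]
    simpa [hB] using pow_le_pow_left₀ (norm_nonneg _) (hnorm' f) 2
  have hPB : ∀ f, ‖P (B f)‖ ≤ ‖f‖ := fun f =>
    (Submodule.norm_starProjection_apply_le V _).trans (hBnorm f)
  have hcomp : ∀ (z : JetSpace Λ) o, ‖z o‖ ≤ ‖z‖ := fun z o => PiLp.norm_apply_le z o
  have hPsymm : ∀ y z, inner ℂ (P y) z = inner ℂ y (P z) := fun y z =>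
    Submodule.inner_starProjection_left_eq_right V y z
  have hPP : ∀ y, P (P y) = P y := fun y =>
    Submodule.starProjection_eq_self_iff.2 (Submodule.starProjection_apply_mem V y)
  -- `‖P B η‖² = ⟨P B η, B η⟩ = ⟨N P B η, η⟩`, since `N` is the adjoint of `B`.
  have hform : ∀ (η : L2 Λ), N (P (B η)) = 0 → P (B η) = 0 := fun η h => by
    have : inner ℂ (P (B η)) (P (B η)) = 0 := by
      rw [← hPsymm, hPP, ← hBadj', h, inner_zero_left]
    exact inner_self_eq_zero.1 this
  -- The projection onto `V` is characterized by testing against images of test jets, which are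
  -- dense in `V`; this is the weak formulation.
  have htest : ∀ (y z : JetSpace Λ), z ∈ V →
      (P y = z ↔ ∀ φ (hφ : IsTestFun Λ φ),
        inner ℂ (D (mkJet hφ.toL2 fun i j => (hφ.pderiv i j).toL2)) (y - z) = 0) := by
    intro y z hz
    constructor
    · rintro rfl φ hφ
      refine Submodule.inner_right_of_mem_orthogonal (K := V) ?_
        (Submodule.sub_starProjection_mem_orthogonal y)
      rw [hV, Submodule.mem_comap, ContinuousLinearMap.coe_coe, hD'D]
      exact Submodule.le_topologicalClosure _ ⟨φ, hφ, rfl⟩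
    · intro h
      refine (Submodule.eq_starProjection_of_mem_of_inner_eq_zero hz fun x hx => ?_)
      have h0 : ∀ x ∈ H10 Λ, inner ℂ (D x) (y - z) = 0 := by
        intro x hx
        have hcl : IsClosed {x | inner ℂ (D x) (y - z) = 0} :=
          isClosed_eq (by fun_prop) continuous_const
        refine closure_minimal (s := (testJets Λ : Set (JetSpace Λ))) ?_ hcl hx
        rintro _ ⟨φ, hφ, rfl⟩
        exact h φ hφ
      have := h0 _ hx
      rw [ContinuousLinearMap.coe_coe, hDD'] at this
      rw [← inner_conj_symm, this, map_zero]
  have hmem : ∀ y, HasH10Grad Λ (N (P y)) (fun i j => b • P y (some (i, j))) := fun y => by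
    rw [hasH10Grad_iff_mem]
    have h1 : D' (P y) ∈ H10 Λ := Submodule.starProjection_apply_mem V y
    rwa [show D' (P y) = mkJet (N (P y)) (fun i j => b • P y (some (i, j))) from
      jet_ext rfl fun _ _ => rfl] at h1
  -- The resolvent is `B* P B`, so it is symmetric and non-negative, and a contraction because each
  -- factor is.
  refine ⟨N.comp (P.comp B), ?_, ?_, ?_, ?_, ?_, ?_⟩
  · intro f g
    change inner ℂ (N (P (B f))) g = inner ℂ f (N (P (B g)))
    rw [hBadj', hPsymm, hBadj]
  · intro η h
    have h1 := (htest (B η) 0 V.zero_mem).1 (hform η h)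
    refine eq_zero_of_inner_testFun hΛ fun φ hφ => ?_
    have h2 := h1 φ hφ
    rw [sub_zero, ← hBadj'] at h2
    simpa [hN, hD, hw'w] using h2
  · intro η
    exact (hnorm' _).trans ((hcomp _ none).trans (hPB η))
  · intro η
    change 0 ≤ (inner ℂ (N (P (B η))) η).re
    rw [hBadj', ← hPP, hPsymm]
    exact inner_self_nonneg (𝕜 := ℂ)
  · intro ψ η
    rw [hamGraph_iff_inner hW.memLp]
    have hkey : ∀ g φ (hφ : IsTestFun Λ φ),
        inner ℂ (D (mkJet hφ.toL2 fun i j => (hφ.pderiv i j).toL2))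
          (B (η + ψ) - D (mkJet ψ g)) =
        inner ℂ hφ.toL2 η - ((1 / 2 : ℂ) * ∑ i, ∑ j, inner ℂ (hφ.pderiv i j).toL2 (g i j)
        + inner ℂ hφ.toL2 (mulOp hW.memLp ψ)) := by
      intro g φ hφ
      rw [inner_sub_right, inner_jet, inner_jet]
      simp only [hD, hB, diagJet_none, diagJet_some, embJet_none, embJet_some, mkJet_none,
        mkJet_some, inner_zero_right, Finset.sum_const_zero, add_zero, hsymm, hww', hwW,
        inner_smul_left, inner_smul_right, haconj, inner_add_right,
        Finset.mul_sum, ← mul_assoc, haa]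
      ring
    have hDmem : ∀ g, HasH10Grad Λ ψ g → D (mkJet ψ g) ∈ V := fun g hg => by
      rw [hV, Submodule.mem_comap, ContinuousLinearMap.coe_coe, hD'D]
      exact hasH10Grad_iff_mem.1 hg
    constructor
    · rintro ⟨g, hg, h⟩
      have := (htest (B (η + ψ)) _ (hDmem g hg)).2 fun φ hφ => by
        rw [hkey, h φ hφ, sub_self]
      change ψ = N (P (B (η + ψ)))
      rw [this]
      simp [hN, hD, hw'w]
    · intro h
      change ψ = N (P (B (η + ψ))) at h
      set g : ι → Fin d → L2 Λ := fun i j => b • P (B (η + ψ)) (some (i, j)) with hg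
      have hgrad : HasH10Grad Λ ψ g := by
        have := hmem (B (η + ψ))
        rwa [← h] at this
      refine ⟨g, hgrad, fun φ hφ => ?_⟩
      have heq : D (mkJet ψ g) = P (B (η + ψ)) := by
        refine jet_ext ?_ fun i j => ?_
        · rw [hD, diagJet_none, mkJet_none]
          nth_rw 1 [h]
          exact hww' _
        · rw [hD, diagJet_some, mkJet_some, hg, smul_smul, hab, one_smul]
      have h3 := (htest (B (η + ψ)) _ (hDmem g hgrad)).1 heq.symm φ hφ
      rw [hkey] at h3
      exact (sub_eq_zero.1 h3).symm
  · intro η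
    refine ⟨_, hmem (B η), fun i j => ?_⟩
    rw [norm_smul]
    gcongr
    exact (hcomp _ _).trans (hPB η)

end

section

/-! ### Compactness of the embedding of `H¹₀` into `L²` -/

lemma sq_lintegral_le {X : Type*} [MeasurableSpace X] {ν : Measure X} {g : X → ℝ≥0∞}
    (hg : AEMeasurable g ν) : (∫⁻ x, g x ∂ν) ^ 2 ≤ ν univ * ∫⁻ x, g x ^ 2 ∂ν := by
  have h := ENNReal.lintegral_mul_le_Lp_mul_Lq ν Real.HolderConjugate.two_two
    (aemeasurable_const (b := (1 : ℝ≥0∞))) hg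
  simp only [Pi.mul_apply, one_mul, ENNReal.one_rpow, lintegral_const] at h
  refine (pow_le_pow_left' h 2).trans_eq ?_
  rw [mul_pow, ← ENNReal.rpow_natCast, ← ENNReal.rpow_natCast, ← ENNReal.rpow_mul,
    ← ENNReal.rpow_mul]
  norm_num

lemma eLpNorm_two_pow_two {X F : Type*} [MeasurableSpace X] [NormedAddCommGroup F]
    {ν : Measure X} (f : X → F) : eLpNorm f 2 ν ^ 2 = ∫⁻ x, ‖f x‖ₑ ^ 2 ∂ν := by
  simpa using eLpNorm_nnreal_pow_eq_lintegral (f := f) (μ := ν) (p := 2) two_ne_zero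

variable {d : ℕ} {ι : Type}

/-- The half-open box of the grid of mesh size `h` with index `a`. -/
def gridBox (h : ℝ) (a : LatConfig d ι) : Set (Config d ι) :=
  {x | ∀ i j, x i j ∈ Ico (h * a i j) (h * a i j + h)}

lemma gridBox_eq_pi (h : ℝ) (a : LatConfig d ι) :
    gridBox h a = univ.pi fun i => univ.pi fun j => Ico (h * a i j) (h * a i j + h) := by
  ext x; simp [gridBox]

/-- The index of the box of the grid which contains the point `x`. -/
def gridIndex (h : ℝ) (x : Config d ι) : LatConfig d ι := fun i j => ⌊x i j / h⌋

lemma mem_gridBox_iff {h : ℝ} (hh : 0 < h) {a : LatConfig d ι} {x : Config d ι} :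
    x ∈ gridBox h a ↔ a = gridIndex h x := by
  have : ∀ i j, x i j ∈ Ico (h * a i j) (h * a i j + h) ↔ a i j = ⌊x i j / h⌋ := by
    intro i j
    rw [eq_comm, Int.floor_eq_iff, le_div_iff₀ hh, div_lt_iff₀ hh, mem_Ico]
    ring_nf
  simp only [gridBox, mem_ofPred_eq, this, funext_iff, gridIndex]

variable [Fintype ι]

/-- Translations of differentiable functions are close in `L²`. -/
lemma lintegral_translate_le {φ : Config d ι → ℂ} (hφ : ContDiff ℝ 1 φ) {z : Config d ι} :
    ∫⁻ x, ‖φ (x + z) - φ x‖ₑ ^ 2 ≤ ‖z‖ₑ ^ 2 * ∫⁻ x, ‖fderiv ℝ φ x‖ₑ ^ 2 := by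
  have hc : Continuous (fderiv ℝ φ) := hφ.continuous_fderiv (by norm_num)
  -- The increment is the integral of the derivative along the segment from `x` to `x + z`;
  -- Cauchy–Schwarz moves the square inside. Afterwards Tonelli and translation invariance remove
  -- the parameter `t`.
  have hpt : ∀ x, ‖φ (x + z) - φ x‖ₑ ^ 2 ≤
      ∫⁻ t in Ioc (0 : ℝ) 1, ‖z‖ₑ ^ 2 * ‖fderiv ℝ φ (x + t • z)‖ₑ ^ 2 := by
    intro x
    have hd : ∀ t ∈ uIcc (0 : ℝ) 1, HasDerivAt (fun t : ℝ => φ (x + t • z))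
        (fderiv ℝ φ (x + t • z) z) t := by
      intro t _
      have h1 : HasDerivAt (fun t : ℝ => x + t • z) z t := by
        simpa using ((hasDerivAt_id t).smul_const z).const_add x
      exact ((hφ.differentiable (by norm_num) _).hasFDerivAt).comp_hasDerivAt t h1
    have hcont : Continuous fun t : ℝ => fderiv ℝ φ (x + t • z) z := by fun_prop
    have hftc := intervalIntegral.integral_eq_sub_of_hasDerivAt hd (hcont.intervalIntegrable 0 1)
    simp only [one_smul, zero_smul, add_zero] at hftc
    rw [← hftc, intervalIntegral.integral_of_le zero_le_one]
    refine (pow_le_pow_left' (enorm_integral_le_lintegral_enorm _) 2).trans ?_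
    refine (sq_lintegral_le hcont.enorm.aemeasurable).trans ?_
    rw [Measure.restrict_apply_univ, Real.volume_Ioc]
    simp only [sub_zero, ENNReal.ofReal_one, one_mul]
    refine lintegral_mono fun t => ?_
    rw [← mul_pow, mul_comm]
    exact pow_le_pow_left' (ContinuousLinearMap.le_opENorm _ _) 2
  refine (lintegral_mono hpt).trans ?_
  have hm : Continuous fun p : Config d ι × ℝ => fderiv ℝ φ (p.1 + p.2 • z) := by fun_prop
  rw [lintegral_lintegral_swap (by
    exact ((ENNReal.continuous_pow 2 |>.comp hm.enorm).measurable.const_mul _).aemeasurable)]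
  have hin : ∀ t : ℝ, ∫⁻ x, ‖z‖ₑ ^ 2 * ‖fderiv ℝ φ (x + t • z)‖ₑ ^ 2 =
      ‖z‖ₑ ^ 2 * ∫⁻ x, ‖fderiv ℝ φ x‖ₑ ^ 2 := by
    intro t
    rw [lintegral_const_mul' _ _ (by simp),
      lintegral_add_right_eq_self (fun x => ‖fderiv ℝ φ x‖ₑ ^ 2) (t • z)]
  simp only [hin]
  simp

lemma measurableSet_gridBox (h : ℝ) (a : LatConfig d ι) : MeasurableSet (gridBox h a) := by
  rw [gridBox_eq_pi]
  exact MeasurableSet.univ_pi fun i => MeasurableSet.univ_pi fun j => measurableSet_Ico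

lemma volume_gridBox (h : ℝ) (a : LatConfig d ι) :
    volume (gridBox h a) = ∏ _i : ι, ∏ _j : Fin d, ENNReal.ofReal h := by
  rw [gridBox_eq_pi, volume_pi_pi]
  simp_rw [volume_pi_pi, Real.volume_Ico, add_sub_cancel_left]

lemma finite_gridIndex_image {h : ℝ} (hh : 0 < h) {Λ : Set (Config d ι)}
    (hΛ : Bornology.IsBounded Λ) : (gridIndex h '' Λ).Finite := by
  obtain ⟨r, hr⟩ := hΛ.exists_norm_le
  refine (Finite.pi' fun _ : ι => Finite.pi' fun _ : Fin d =>
    finite_Icc ⌊-r / h⌋ ⌊r / h⌋).subset ?_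
  rintro _ ⟨x, hx, rfl⟩
  have : ∀ i j, |x i j| ≤ r := fun i j =>
    ((norm_le_pi_norm (x i) j).trans (norm_le_pi_norm x i)).trans (hr x hx)
  exact fun i j => ⟨Int.floor_mono (by gcongr; exact (abs_le.1 (this i j)).1),
    Int.floor_mono (by gcongr; exact (abs_le.1 (this i j)).2)⟩

/-- A box containing the differences of the points of a box of the grid. -/
def diffBox (d : ℕ) (ι : Type) [Fintype ι] (h : ℝ) : Set (Config d ι) :=
  univ.pi fun _ => univ.pi fun _ => Icc (-h) h

lemma volume_diffBox (h : ℝ) :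
    volume (diffBox d ι h) = 2 ^ (Fintype.card ι * d) * ∏ _i : ι, ∏ _j : Fin d, ENNReal.ofReal h := by
  rw [diffBox, volume_pi_pi]
  simp_rw [volume_pi_pi, Real.volume_Icc]
  rw [show h - -h = 2 * h by ring, ENNReal.ofReal_mul (by norm_num)]
  simp [mul_pow, ← pow_mul, mul_comm]

lemma enorm_le_of_mem_diffBox {h : ℝ} (hh : 0 ≤ h) {z : Config d ι} (hz : z ∈ diffBox d ι h) :
    ‖z‖ₑ ≤ ENNReal.ofReal h := by
  rw [← ofReal_norm]
  refine ENNReal.ofReal_le_ofReal ?_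
  rw [pi_norm_le_iff_of_nonneg hh]
  intro i
  rw [pi_norm_le_iff_of_nonneg hh]
  intro j
  exact abs_le.2 (hz i trivial j trivial)

/-- The mean square oscillation of a function over the boxes of a grid. -/
lemma lintegral_osc_le {φ : Config d ι → ℂ} (hφ : ContDiff ℝ 1 φ) {h : ℝ} (hh : 0 < h) :
    ∫⁻ x, (∫⁻ y in gridBox h (gridIndex h x), ‖φ y - φ x‖ₑ ^ 2) ≤
      volume (diffBox d ι h) * (ENNReal.ofReal h ^ 2 * ∫⁻ x, ‖fderiv ℝ φ x‖ₑ ^ 2) := by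
  -- Substituting `y = x + z` replaces the box depending on `x` by one fixed set of increments, so
  -- the integrals can be exchanged.
  have h1 : ∀ x, (∫⁻ y in gridBox h (gridIndex h x), ‖φ y - φ x‖ₑ ^ 2) ≤
      ∫⁻ z in diffBox d ι h, ‖φ (x + z) - φ x‖ₑ ^ 2 := by
    intro x
    have hmeas : MeasurableSet (diffBox d ι h) :=
      MeasurableSet.univ_pi fun i => MeasurableSet.univ_pi fun j => measurableSet_Icc
    rw [← lintegral_indicator (measurableSet_gridBox _ _), ← lintegral_indicator hmeas,
      ← lintegral_add_left_eq_self _ x]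
    refine lintegral_mono fun z => ?_
    by_cases hz : x + z ∈ gridBox h (gridIndex h x)
    · have hx : x ∈ gridBox h (gridIndex h x) := (mem_gridBox_iff hh).2 rfl
      have hz' : z ∈ diffBox d ι h := fun i _ j _ => by
        have h1 := hz i j
        have h2 := hx i j
        simp only [Pi.add_apply, mem_Ico] at h1 h2
        constructor <;> linarith
      rw [indicator_of_mem hz, indicator_of_mem hz']
    · rw [indicator_of_notMem hz]
      exact zero_le
  refine (lintegral_mono h1).trans ?_
  rw [lintegral_lintegral_swap (by
    exact (ENNReal.continuous_pow 2 |>.comp (by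
      have := hφ.continuous
      fun_prop : Continuous fun p : Config d ι × Config d ι => φ (p.1 + p.2) - φ p.1).enorm).aemeasurable)]
  rw [mul_comm, ← setLIntegral_const]
  refine setLIntegral_mono' (MeasurableSet.univ_pi fun i => MeasurableSet.univ_pi fun j =>
    measurableSet_Icc) fun z hz => ?_
  refine (lintegral_translate_le hφ).trans ?_
  gcongr
  exact enorm_le_of_mem_diffBox hh.le hz

variable {Λ : Set (Config d ι)}

lemma IsTestFun.eLpNorm_eq {φ : Config d ι → ℂ} (hφ : IsTestFun Λ φ) :
    eLpNorm φ 2 volume = ENNReal.ofReal ‖hφ.toL2‖ := by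
  rw [IsTestFun.toL2, Lp.norm_toLp, ENNReal.ofReal_toReal hφ.memLp.eLpNorm_ne_top]
  exact (eLpNorm_restrict_eq_of_support_subset ((subset_tsupport φ).trans hφ.2.2)).symm

variable [LinearOrder ι]

lemma norm_fderiv_le_sum {φ : Config d ι → ℂ} (x : Config d ι) :
    ‖fderiv ℝ φ x‖ ≤ ∑ i, ∑ j, ‖pderiv i j φ x‖ := by
  refine ContinuousLinearMap.opNorm_le_bound _ (by positivity) fun v => ?_
  have hv : v = ∑ i, ∑ j, v i j • (Pi.single i (Pi.single j 1) : Config d ι) := by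
    ext i j
    simp [Finset.sum_apply, Pi.single_apply, apply_ite, ite_apply]
  have : fderiv ℝ φ x v = ∑ i, ∑ j, (v i j : ℂ) * pderiv i j φ x := by
    conv_lhs => rw [hv]
    simp [map_sum, pderiv]
  rw [this, Finset.sum_mul]
  refine (norm_sum_le _ _).trans (Finset.sum_le_sum fun i _ => ?_)
  rw [Finset.sum_mul]
  refine (norm_sum_le _ _).trans (Finset.sum_le_sum fun j _ => ?_)
  rw [norm_mul, Complex.norm_real, mul_comm]
  gcongr
  exact (norm_le_pi_norm (v i) j).trans (norm_le_pi_norm v i)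

/-- The translation estimate uses the full derivative on the whole space, whereas jets record
partial derivatives on `Λ`. The support condition and the triangle inequality in `L²` connect the
two. -/
lemma IsTestFun.lintegral_fderiv_le {φ : Config d ι → ℂ} (hφ : IsTestFun Λ φ) :
    ∫⁻ x, ‖fderiv ℝ φ x‖ₑ ^ 2 ≤ ENNReal.ofReal (∑ i, ∑ j, ‖(hφ.pderiv i j).toL2‖) ^ 2 := by
  have h1 : ∫⁻ x, ‖fderiv ℝ φ x‖ₑ ^ 2 = eLpNorm (fderiv ℝ φ) 2 volume ^ 2 :=
    (eLpNorm_two_pow_two _).symm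
  rw [h1]
  refine pow_le_pow_left' ?_ 2
  have h2 : eLpNorm (fderiv ℝ φ) 2 volume ≤
      eLpNorm (∑ i, ∑ j, fun x => ‖MPAnderson.pderiv i j φ x‖) 2 volume := by
    refine eLpNorm_mono_real fun x => ?_
    simpa using norm_fderiv_le_sum x
  have hm : ∀ i j, AEStronglyMeasurable (fun x => ‖MPAnderson.pderiv i j φ x‖) volume := fun i j =>
    (hφ.pderiv i j).1.continuous.norm.aestronglyMeasurable
  refine h2.trans ((eLpNorm_sum_le (fun i _ =>
    Finset.aestronglyMeasurable_sum _ fun j _ => hm i j) (by norm_num)).trans ?_)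
  rw [ENNReal.ofReal_sum_of_nonneg fun i _ => by positivity]
  refine Finset.sum_le_sum fun i _ => ?_
  refine (eLpNorm_sum_le (fun j _ => hm i j) (by norm_num)).trans ?_
  rw [ENNReal.ofReal_sum_of_nonneg fun i _ => by positivity]
  refine Finset.sum_le_sum fun j _ => ?_
  rw [eLpNorm_norm, (hφ.pderiv i j).eLpNorm_eq]

/-- Averaging over the boxes of a grid approximates functions from `H¹₀`. -/
theorem exists_finiteRank_approx (hΛ : IsOpen Λ) (hb : Bornology.IsBounded Λ) {h : ℝ}
    (hh : 0 < h) : ∃ F : L2 Λ →L[ℂ] L2 Λ, FiniteDimensional ℂ F.range ∧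
      ∀ ψ g, HasH10Grad Λ ψ g →
        ‖ψ - F ψ‖ ≤ 2 ^ (Fintype.card ι * d) * h * ∑ i, ∑ j, ‖g i j‖ := by
  set V : ℝ≥0∞ := ∏ _i : ι, ∏ _j : Fin d, ENNReal.ofReal h with hV
  have hvol : ∀ a : LatConfig d ι, volume (gridBox h a) = V := volume_gridBox h
  have hV0 : V ≠ 0 := by
    simp [hV, hh]
  have hVtop : V ≠ ⊤ :=
    ENNReal.prod_ne_top fun _ _ => ENNReal.prod_ne_top fun _ _ => ENNReal.ofReal_ne_top
  have hfin : ∀ a : LatConfig d ι, volume.restrict Λ (gridBox h a) ≠ ⊤ := fun a =>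
    ((Measure.restrict_apply_le _ _).trans_lt ((hvol a).trans_lt hVtop.lt_top)).ne
  set e : LatConfig d ι → L2 Λ := fun a =>
    indicatorConstLp 2 (measurableSet_gridBox h a) (hfin a) (1 : ℂ) with he
  set A := (finite_gridIndex_image hh hb).toFinset with hA
  -- `F` replaces a function by its means over the boxes meeting `Λ`. Dividing by the full box
  -- volume `V`, even for boxes that stick out, averages the extension by zero, which is smooth for
  -- test functions.
  set F : L2 Λ →L[ℂ] L2 Λ := ∑ a ∈ A, ((V.toReal⁻¹ : ℝ) : ℂ) • (innerSL ℂ (e a)).smulRight (e a)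
    with hF
  have hFapp : ∀ f, F f = ∑ a ∈ A, ((V.toReal⁻¹ : ℝ) : ℂ) • inner ℂ (e a) f • e a := fun f => by
    simp [hF]
  refine ⟨F, ?_, ?_⟩
  · have := FiniteDimensional.span_of_finite ℂ (A.finite_toSet.image e)
    refine Submodule.finiteDimensional_of_le (S₂ := Submodule.span ℂ (e '' A)) ?_
    rintro _ ⟨f, rfl⟩
    rw [ContinuousLinearMap.coe_coe, hFapp]
    refine Submodule.sum_mem _ fun a ha => Submodule.smul_mem _ _ (Submodule.smul_mem _ _ ?_)
    exact Submodule.subset_span ⟨a, ha, rfl⟩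
  have htest : ∀ φ (hφ : IsTestFun Λ φ), ‖hφ.toL2 - F hφ.toL2‖ ≤
      2 ^ (Fintype.card ι * d) * h * ∑ i, ∑ j, ‖(hφ.pderiv i j).toL2‖ := by
    intro φ hφ
    set S := ∑ i, ∑ j, ‖(hφ.pderiv i j).toL2‖ with hS
    have hinner : ∀ a, inner ℂ (e a) hφ.toL2 = ∫ y in gridBox h a, φ y := by
      intro a
      rw [he, L2.inner_indicatorConstLp_one,
        integral_congr_ae (ae_restrict_of_ae hφ.coeFn_toL2),
        Measure.restrict_restrict (measurableSet_gridBox h a)]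
      refine (setIntegral_eq_of_subset_of_forall_sdiff_eq_zero (measurableSet_gridBox h a)
        inter_subset_left fun x hx => ?_).symm
      exact image_eq_zero_of_notMem_tsupport fun hx' => hx.2 ⟨hx.1, hφ.2.2 hx'⟩
    have hFae : ∀ᵐ x ∂volume.restrict Λ,
        F hφ.toL2 x = ((V.toReal⁻¹ : ℝ) : ℂ) * ∫ y in gridBox h (gridIndex h x), φ y := by
      have h1 : ∀ᵐ x ∂volume.restrict Λ, ∀ a ∈ A, (((V.toReal⁻¹ : ℝ) : ℂ) •
          inner ℂ (e a) hφ.toL2 • e a : L2 Λ) x = ((V.toReal⁻¹ : ℝ) : ℂ) *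
            ((∫ y in gridBox h a, φ y) * (gridBox h a).indicator (fun _ => 1) x) := by
        rw [eventually_all_finset]
        intro a _
        filter_upwards [Lp.coeFn_smul ((V.toReal⁻¹ : ℝ) : ℂ) (inner ℂ (e a) hφ.toL2 • e a),
          Lp.coeFn_smul (inner ℂ (e a) hφ.toL2) (e a),
          indicatorConstLp_coeFn (p := 2) (hs := measurableSet_gridBox h a) (hμs := hfin a)
            (c := (1 : ℂ))] with x h1 h2 h3
        rw [h1, Pi.smul_apply, h2, Pi.smul_apply, h3, hinner, smul_eq_mul, smul_eq_mul]
      rw [hFapp]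
      filter_upwards [h1, Lp.coeFn_finsetSum A fun a => (((V.toReal⁻¹ : ℝ) : ℂ) •
          inner ℂ (e a) hφ.toL2 • e a : L2 Λ), ae_restrict_mem hΛ.measurableSet] with x h1 h2 h3
      rw [h2, Finset.sum_apply, Finset.sum_congr rfl h1, Finset.sum_eq_single (gridIndex h x)]
      · rw [indicator_of_mem ((mem_gridBox_iff hh).2 rfl), mul_one]
      · intro a _ ha
        rw [indicator_of_notMem fun hx => ha ((mem_gridBox_iff hh).1 hx), mul_zero, mul_zero]
      · intro hx
        exact absurd ((finite_gridIndex_image hh hb).mem_toFinset.2 ⟨x, h3, rfl⟩) hx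
    -- The deviation from the mean is the mean of the deviations; Cauchy–Schwarz bounds its square
    -- by the mean square.
    have hpt : ∀ x, ‖φ x - ((V.toReal⁻¹ : ℝ) : ℂ) * ∫ y in gridBox h (gridIndex h x), φ y‖ₑ ^ 2 ≤
        V⁻¹ * ∫⁻ y in gridBox h (gridIndex h x), ‖φ y - φ x‖ₑ ^ 2 := by
      intro x
      set Q := gridBox h (gridIndex h x)
      have hv : V.toReal ≠ 0 := (ENNReal.toReal_pos hV0 hVtop).ne'
      have hint : IntegrableOn φ Q volume :=
        (hφ.1.continuous.integrable_of_hasCompactSupport hφ.2.1).integrableOn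
      have hconst : IntegrableOn (fun _ => φ x) Q volume :=
        integrableOn_const (by rw [hvol]; exact hVtop)
      have h1 : φ x - ((V.toReal⁻¹ : ℝ) : ℂ) * ∫ y in Q, φ y =
          -(((V.toReal⁻¹ : ℝ) : ℂ) * ∫ y in Q, (φ y - φ x)) := by
        rw [integral_sub hint hconst, setIntegral_const, measureReal_def, hvol, mul_sub,
          Complex.real_smul, ← mul_assoc, ← Complex.ofReal_mul, inv_mul_cancel₀ hv,
          Complex.ofReal_one, one_mul]
        ring
      have h2 : ‖((V.toReal⁻¹ : ℝ) : ℂ)‖ₑ = V⁻¹ := by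
        rw [← ofReal_norm, Complex.norm_real, ← ENNReal.toReal_inv,
          Real.norm_of_nonneg ENNReal.toReal_nonneg,
          ENNReal.ofReal_toReal (ENNReal.inv_ne_top.2 hV0)]
      rw [h1, enorm_neg, enorm_mul, h2, mul_pow]
      calc V⁻¹ ^ 2 * ‖∫ y in Q, (φ y - φ x)‖ₑ ^ 2
          ≤ V⁻¹ ^ 2 * (V * ∫⁻ y in Q, ‖φ y - φ x‖ₑ ^ 2) := by
            gcongr
            refine (pow_le_pow_left' (enorm_integral_le_lintegral_enorm _) 2).trans ?_
            refine (sq_lintegral_le (hφ.1.continuous.sub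
              continuous_const).enorm.aemeasurable).trans_eq ?_
            rw [Measure.restrict_apply_univ, hvol]
            rfl
        _ = V⁻¹ * ∫⁻ y in Q, ‖φ y - φ x‖ₑ ^ 2 := by
            rw [← mul_assoc, sq, mul_assoc V⁻¹, ENNReal.inv_mul_cancel hV0 hVtop, mul_one]
    have h1 : ENNReal.ofReal (‖hφ.toL2 - F hφ.toL2‖) ^ 2 ≤
        ENNReal.ofReal (2 ^ (Fintype.card ι * d) * h * S) ^ 2 := by
      calc ENNReal.ofReal (‖hφ.toL2 - F hφ.toL2‖) ^ 2
          = ∫⁻ x in Λ, ‖(hφ.toL2 - F hφ.toL2) x‖ₑ ^ 2 := by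
            rw [← eLpNorm_two_pow_two, Lp.norm_def, ENNReal.ofReal_toReal (Lp.eLpNorm_ne_top _)]
        _ = ∫⁻ x in Λ, ‖φ x -
              ((V.toReal⁻¹ : ℝ) : ℂ) * ∫ y in gridBox h (gridIndex h x), φ y‖ₑ ^ 2 := by
            refine lintegral_congr_ae ?_
            filter_upwards [Lp.coeFn_sub hφ.toL2 (F hφ.toL2), hφ.coeFn_toL2, hFae]
              with x h1 h2 h3
            rw [h1, Pi.sub_apply, h2, h3]
        _ ≤ ∫⁻ x, V⁻¹ * ∫⁻ y in gridBox h (gridIndex h x), ‖φ y - φ x‖ₑ ^ 2 :=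
            (setLIntegral_le_lintegral _ _).trans (lintegral_mono hpt)
        _ ≤ V⁻¹ * (volume (diffBox d ι h) * (ENNReal.ofReal h ^ 2 * ENNReal.ofReal S ^ 2)) := by
            rw [lintegral_const_mul' _ _ (ENNReal.inv_ne_top.2 hV0)]
            gcongr
            refine (lintegral_osc_le (hφ.1.of_le (by norm_cast)) hh).trans ?_
            gcongr
            exact hφ.lintegral_fderiv_le
        _ = 2 ^ (Fintype.card ι * d) * (ENNReal.ofReal h ^ 2 * ENNReal.ofReal S ^ 2) := by
            rw [volume_diffBox, ← hV, mul_comm _ V, mul_assoc V, ← mul_assoc V⁻¹,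
              ENNReal.inv_mul_cancel hV0 hVtop, one_mul]
        _ ≤ ENNReal.ofReal (2 ^ (Fintype.card ι * d) * h * S) ^ 2 := by
            rw [ENNReal.ofReal_mul (by positivity), ENNReal.ofReal_mul (by positivity), mul_pow,
              mul_pow, ENNReal.ofReal_pow (by norm_num), mul_assoc]
            rw [ENNReal.ofReal_ofNat]
            -- The estimate produces `2^{nd}` under the square; enlarging it to `(2^{nd})²` avoids a
            -- square root in the constant.
            exact mul_le_mul' (le_self_pow₀ (one_le_pow₀ one_le_two) two_ne_zero) le_rfl
    rw [← ENNReal.ofReal_pow (norm_nonneg _), ← ENNReal.ofReal_pow (by positivity),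
      ENNReal.ofReal_le_ofReal_iff (by positivity)] at h1
    exact le_of_sq_le_sq h1 (by positivity)
  intro ψ g hg
  obtain ⟨φ, hφ, h0, h1⟩ := hasH10Grad_iff_seq.1 hg
  refine le_of_tendsto_of_tendsto' (h0.sub ((F.continuous.tendsto ψ).comp h0)).norm
    (Tendsto.const_mul _ (tendsto_finsetSum _ fun i _ => tendsto_finsetSum _ fun j _ =>
      (h1 i j).norm)) fun n => htest (φ n) (hφ n)

end

section

/-! ### Diagonalization -/

/-- A compact symmetric operator has a Hilbert basis of eigenvectors. -/
theorem exists_hilbertBasis_eigenvectors {H : Type} [NormedAddCommGroup H] [InnerProductSpace ℂ H]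
    [CompleteSpace H] {T : H →L[ℂ] H} (hT : IsCompactOperator T) (hT' : T.IsSymmetric) :
    ∃ (κ : Type) (b : HilbertBasis κ ℂ H) (ρ : κ → ℂ), ∀ k, T (b k) = ρ k • b k := by
  have hcl : ∀ μ : ℂ, CompleteSpace (Module.End.eigenspace (T : Module.End ℂ H) μ) := fun μ =>
by
    have : IsClosed (Module.End.eigenspace (T : Module.End ℂ H) μ : Set H) := by
      convert isClosed_eq T.continuous (continuous_const_smul μ) using 1
      ext x
      simp
    exact this.completeSpace_coe
  choose w b hb using fun μ : ℂ =>
    exists_hilbertBasis ℂ (Module.End.eigenspace (T : Module.End ℂ H) μ)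
  have hortho : Orthonormal ℂ
      (fun a : Σ μ : ℂ, w μ => ((b a.1 a.2 : Module.End.eigenspace (T : Module.End ℂ H) a.1) : H)) :=
    (hT'.orthogonalFamily_eigenspaces).orthonormal_sigma_orthonormal fun μ => (b μ).orthonormal
  refine ⟨Σ μ : ℂ, w μ, HilbertBasis.mkOfOrthogonalEqBot hortho ?_, fun a => a.1, fun a => ?_⟩
  · rw [Submodule.eq_bot_iff]
    intro x hx
    rw [Submodule.mem_orthogonal] at hx
    -- The spectral theorem says that no nonzero vector is orthogonal to all eigenspaces, so it
    -- suffices to pass from the bases of the eigenspaces to the eigenspaces themselves.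
    have h1 := ContinuousLinearMap.orthogonalComplement_iSup_eigenspaces_eq_bot hT hT'
    rw [Submodule.eq_bot_iff] at h1
    refine h1 x ?_
    rw [← Submodule.iInf_orthogonal, Submodule.mem_iInf]
    intro μ
    rw [Submodule.mem_orthogonal]
    intro y hy
    have h2 := (b μ).hasSum_repr ⟨y, hy⟩
    have h3 := (innerSL ℂ x).hasSum
      ((Module.End.eigenspace (T : Module.End ℂ H) μ).subtypeL.hasSum h2)
    have h4 : inner ℂ x y = (0 : ℂ) := by
      refine h3.unique ?_
      convert hasSum_zero with i
      have := hx _ (Submodule.subset_span ⟨⟨μ, i⟩, rfl⟩)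
      simp only [map_smul, innerSL_apply_apply, smul_eq_mul]
      rw [← inner_conj_symm, Submodule.subtypeL_apply, this, map_zero, mul_zero]
    rw [← inner_conj_symm, h4, map_zero]
  · rw [HilbertBasis.coe_mkOfOrthogonalEqBot]
    exact Module.End.mem_eigenspace_iff.1 (b a.1 a.2).2

lemma HilbertBasis.ext_inner {κ H : Type} [NormedAddCommGroup H] [InnerProductSpace ℂ H]
    (b : HilbertBasis κ ℂ H) {x y : H} (h : ∀ k, inner ℂ (b k) x = inner ℂ (b k) y) : x = y := by
  refine b.repr.injective (lp.ext (funext fun k => ?_))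
  rw [b.repr_apply_apply, b.repr_apply_apply, h]

lemma HilbertBasis.hasSum_norm_sq {κ H : Type} [NormedAddCommGroup H] [InnerProductSpace ℂ H]
    (b : HilbertBasis κ ℂ H) (x : H) : HasSum (fun k => ‖inner ℂ (b k) x‖ ^ 2) (‖x‖ ^ 2) := by
  have h := b.hasSum_inner_mul_inner x x
  rw [inner_self_eq_norm_sq_to_K,
    show (RCLike.ofReal ‖x‖ : ℂ) ^ 2 = ((‖x‖ ^ 2 : ℝ) : ℂ) from (Complex.ofReal_pow _ _).symm] at h
  have h2 : ∀ k, inner ℂ x (b k) * inner ℂ (b k) x = ((‖inner ℂ (b k) x‖ ^ 2 : ℝ) : ℂ) := by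
    intro k
    rw [← inner_conj_symm x (b k), ← Complex.normSq_eq_conj_mul_self, Complex.normSq_eq_norm_sq]
  simp only [h2] at h
  exact Complex.hasSum_ofReal.1 h

variable {d : ℕ} {ι : Type} [Fintype ι] [LinearOrder ι] {Λ : Set (Config d ι)} {W : Config d ι → ℝ}

/-- The Hilbert basis `e` diagonalizes `-½Δ + W`, with the eigenvalues `lam k ≥ 0`. -/
structure HamDiag {κ : Type} (W : Config d ι → ℝ) (e : HilbertBasis κ ℂ (L2 Λ)) (lam : κ → ℝ) :
    Prop where
  nonneg : ∀ k, 0 ≤ lam k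
  graph_iff : ∀ ψ η : L2 Λ, HamGraph Λ W ψ η ↔
    ∀ k, inner ℂ (e k) η = (lam k : ℂ) * inner ℂ (e k) ψ

/-- `(H + 1)⁻¹` is the norm limit of its compositions with grid averages, hence compact, and the
gradient bound gives the rate. Its eigenvalues lie in `(0, 1]` by injectivity, positivity and
contractivity, so each `ρ` gives an eigenvalue `1/ρ - 1 ≥ 0` of `H`. -/
theorem exists_hamDiag (hΛ : IsOpen Λ) (hb : Bornology.IsBounded Λ) (hW : IsBddPot Λ W) :
    ∃ (κ : Type) (e : HilbertBasis κ ℂ (L2 Λ)) (lam : κ → ℝ), HamDiag W e lam := by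
  obtain ⟨R, hRs, hRinj, hRn, hRp, hRg, hRh⟩ := exists_resolvent_neg_one hΛ hW
  have hcomp : IsCompactOperator R := by
    set C : ℝ := 2 ^ (Fintype.card ι * d) * (∑ _i : ι, ∑ _j : Fin d, 2) with hC
    choose F hF1 hF2 using fun n : ℕ =>
      exists_finiteRank_approx hΛ hb (h := 1 / ((n : ℝ) + 1)) (by positivity)
    have hn : ∀ n, ‖R - (F n).comp R‖ ≤ C * (1 / ((n : ℝ) + 1)) := fun n => by
      refine ContinuousLinearMap.opNorm_le_bound _ (by positivity) fun η => ?_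
      obtain ⟨g, hg, hgn⟩ := hRh η
      refine (hF2 n _ g hg).trans ?_
      calc _ ≤ 2 ^ (Fintype.card ι * d) * (1 / ((n : ℝ) + 1)) *
            ∑ _i : ι, ∑ _j : Fin d, 2 * ‖η‖ := by
              gcongr with i _ j _
              exact hgn i j
        _ = C * (1 / ((n : ℝ) + 1)) * ‖η‖ := by
              simp_rw [hC, ← Finset.sum_mul]; ring
    have hlim : Tendsto (fun n => (F n).comp R) atTop (𝓝 R) := by
      rw [tendsto_iff_norm_sub_tendsto_zero]
      refine squeeze_zero (fun _ => norm_nonneg _) (fun n => ?_)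
        (by simpa using tendsto_one_div_add_atTop_nhds_zero_nat.const_mul C)
      rw [norm_sub_rev]
      simpa using hn n
    refine isCompactOperator_of_tendsto hlim (Eventually.of_forall fun n => ?_)
    have := hF1 n
    have hc : IsCompactOperator ((F n).codRestrict (F n).range fun x => ⟨x, rfl⟩) := by
      have : ProperSpace (F n).range := FiniteDimensional.proper ℂ _
      have h1 : IsCompactOperator (id : (F n).range → (F n).range) :=
        isCompactOperator_id
      exact h1.comp_clm _
    exact (hc.clm_comp (F n).range.subtypeL).comp_clm R
  obtain ⟨κ, e, ρ, hρ⟩ := exists_hilbertBasis_eigenvectors hcomp hRs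
  have hen : ∀ k, ‖e k‖ = 1 := fun k => e.orthonormal.1 k
  have hee : ∀ k, inner ℂ (e k) (e k) = (1 : ℂ) := fun k => by
    rw [inner_self_eq_norm_sq_to_K, hen]; simp
  have hRe : ∀ k x, inner ℂ (e k) (R x) = (starRingEnd ℂ) (ρ k) * inner ℂ (e k) x := fun k x => by
    have h1 : inner ℂ (R (e k)) x = inner ℂ (e k) (R x) := hRs (e k) x
    rw [← h1, hρ, inner_smul_left]
  have hreal : ∀ k, ρ k = ((ρ k).re : ℂ) := fun k => by
    have := hRe k (e k)
    rw [hρ, inner_smul_right, hee, mul_one, mul_one] at this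
    exact (Complex.conj_eq_iff_re.1 this.symm).symm
  have hρ0 : ∀ k, 0 < (ρ k).re := fun k => by
    have h1 := hRp (e k)
    rw [hρ, inner_smul_left, hee, mul_one, Complex.conj_re] at h1
    refine lt_of_le_of_ne h1 fun h0 => ?_
    have h2 := hRinj (e k) (by rw [hρ, hreal, ← h0, Complex.ofReal_zero, zero_smul])
    have := hen k
    rw [h2, norm_zero] at this
    exact zero_ne_one this
  have hρ1 : ∀ k, (ρ k).re ≤ 1 := fun k => by
    have h1 := hRn (e k)
    rw [hρ, norm_smul, hen, mul_one, hreal, Complex.norm_real] at h1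
    exact (le_abs_self _).trans h1
  refine ⟨κ, e, fun k => ((ρ k).re)⁻¹ - 1, fun k => sub_nonneg.2 ((one_le_inv₀ (hρ0 k)).2 (hρ1 k)),
    fun ψ η => ?_⟩
  rw [hRg]
  have hk : ∀ k, inner ℂ (e k) ψ = inner ℂ (e k) (R (η + ψ)) ↔
      inner ℂ (e k) η = ((((ρ k).re)⁻¹ - 1 : ℝ) : ℂ) * inner ℂ (e k) ψ := fun k => by
    have h0 : ((ρ k).re : ℂ) ≠ 0 := Complex.ofReal_ne_zero.2 (hρ0 k).ne'
    rw [hRe, hreal, Complex.conj_ofReal, inner_add_right, Complex.ofReal_re]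
    push_cast
    rw [sub_mul, one_mul, eq_sub_iff_add_eq, eq_comm, ← mul_right_inj' (inv_ne_zero h0),
      inv_mul_cancel_left₀ h0]
  exact ⟨fun h k => (hk k).1 (congrArg _ h),
    fun h => HilbertBasis.ext_inner e fun k => (hk k).2 (h k)⟩

namespace HamDiag

variable {κ : Type} {e : HilbertBasis κ ℂ (L2 Λ)} {lam : κ → ℝ}

lemma graph_basis (h : HamDiag W e lam) (k : κ) : HamGraph Λ W (e k) ((lam k : ℂ) • e k) := by
  rw [h.graph_iff]
  intro j
  rw [inner_smul_right]
  by_cases hjk : j = k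
  · rw [hjk]
  · rw [e.orthonormal.2 hjk, mul_zero, mul_zero]

/-- A resolvent at an eigenvalue would give `e k = G 0 = 0`. This inclusion suffices: spectral
hypotheses are only ever applied at the eigenvalues of a basis. -/
lemma mem_hamSpectrum (h : HamDiag W e lam) (k : κ) : lam k ∈ hamSpectrum Λ W := by
  rintro ⟨G, hG⟩
  have h2 := (hG (e k) 0).1 (by rw [zero_add]; exact h.graph_basis k)
  have := e.orthonormal.1 k
  rw [h2, map_zero, norm_zero] at this
  exact zero_ne_one this

/-- Turns the resolvent equation into division by `lam k - E` in each coordinate. -/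
lemma graph_shift_iff (h : HamDiag W e lam) {ψ η : L2 Λ} {E : ℝ} :
    HamGraph Λ W ψ (η + (E : ℂ) • ψ) ↔
      ∀ k, inner ℂ (e k) η = ((lam k - E : ℝ) : ℂ) * inner ℂ (e k) ψ := by
  rw [h.graph_iff]
  refine forall_congr' fun k => ?_
  rw [inner_add_right, inner_smul_right]
  push_cast
  rw [sub_mul, eq_sub_iff_add_eq]

/-- The distance to the spectrum controls the norms of solutions. -/
lemma norm_le (h : HamDiag W e lam) {ψ η : L2 Λ} {E c : ℝ} (hc : 0 < c)
    (hE : ∀ k, c ≤ |lam k - E|) (hψ : HamGraph Λ W ψ (η + (E : ℂ) • ψ)) :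
    c * ‖ψ‖ ≤ ‖η‖ := by
  rw [h.graph_shift_iff] at hψ
  refine le_of_sq_le_sq ?_ (norm_nonneg _)
  rw [mul_pow]
  refine hasSum_le (fun k => ?_) ((HilbertBasis.hasSum_norm_sq e ψ).mul_left (c ^ 2))
    (HilbertBasis.hasSum_norm_sq e η)
  rw [hψ k, norm_mul, mul_pow, Complex.norm_real, Real.norm_eq_abs]
  gcongr
  exact hE k

end HamDiag

end

section

/-! ### Tensor products of `L²` functions -/

lemma HilbertBasis.clm_eq_zero {κ H : Type} [NormedAddCommGroup H] [InnerProductSpace ℂ H]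
    (b : HilbertBasis κ ℂ H) {A : H →L[ℂ] ℂ} (h : ∀ k, A (b k) = 0) (x : H) : A x = 0 := by
  refine (A.hasSum (b.hasSum_repr x)).unique ?_
  convert hasSum_zero with k
  rw [map_smul, h, smul_zero]

lemma tendsto_bilin {E F G : Type*} [NormedAddCommGroup E] [NormedAddCommGroup F]
    [NormedAddCommGroup G] [NormedSpace ℂ E] [NormedSpace ℂ F] [NormedSpace ℂ G]
    (B : E →L[ℂ] F →L[ℂ] G) {a : ℕ → E} {b : ℕ → F} {x : E} {y : F} (ha : Tendsto a atTop (𝓝 x))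
    (hb : Tendsto b atTop (𝓝 y)) : Tendsto (fun n => B (a n) (b n)) atTop (𝓝 (B x y)) :=
  (B.isBoundedBilinearMap.continuous.tendsto (x, y)).comp (ha.prodMk_nhds hb)

section Tensor

variable {X Y Z : Type} [MeasurableSpace X] [MeasurableSpace Y] [MeasurableSpace Z]
  {μ : Measure X} {ν : Measure Y} {ρ : Measure Z} {p : Z ≃ᵐ X × Y}

lemma ae_comp_fst {P : X → Prop} (hp : MeasurePreserving p ρ (μ.prod ν))
    (h : ∀ᵐ x ∂μ, P x) : ∀ᵐ z ∂ρ, P (p z).1 :=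
  (Measure.quasiMeasurePreserving_fst.comp hp.quasiMeasurePreserving).ae h

lemma ae_comp_snd {P : Y → Prop} (hp : MeasurePreserving p ρ (μ.prod ν))
    (h : ∀ᵐ y ∂ν, P y) : ∀ᵐ z ∂ρ, P (p z).2 :=
  (Measure.quasiMeasurePreserving_snd.comp hp.quasiMeasurePreserving).ae h

lemma memLp_tensor (hp : MeasurePreserving p ρ (μ.prod ν)) {f : X → ℂ} {h : Y → ℂ}
    (hf : MemLp f 2 μ) (hh : MemLp h 2 ν) :
    MemLp (fun z => f (p z).1 * h (p z).2) 2 ρ := by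
  have h1 : MemLp (fun q : X × Y => f q.1 * h q.2) 2 (μ.prod ν) := by
    refine (memLp_two_iff_integrable_sq_norm (hf.1.comp_fst.mul hh.1.comp_snd)).2 ?_
    simp only [Pi.mul_apply, norm_mul, mul_pow]
    exact hf.integrable_norm_pow (by norm_num) |>.mul_prod (hh.integrable_norm_pow (by norm_num))
  exact h1.comp_measurePreserving hp

variable (hp : MeasurePreserving p ρ (μ.prod ν))

/-- The tensor product of two functions, as a function. -/
def tensorFun (f : Lp ℂ 2 μ) (h : Lp ℂ 2 ν) : Lp ℂ 2 ρ :=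
  (memLp_tensor hp (Lp.memLp f) (Lp.memLp h)).toLp _

lemma coeFn_tensorFun (f : Lp ℂ 2 μ) (h : Lp ℂ 2 ν) :
    tensorFun hp f h =ᵐ[ρ] fun z => f (p z).1 * h (p z).2 := MemLp.coeFn_toLp _

variable [SigmaFinite μ] [SigmaFinite ν]

lemma inner_tensorFun (f f' : Lp ℂ 2 μ) (h h' : Lp ℂ 2 ν) :
    inner ℂ (tensorFun hp f h) (tensorFun hp f' h') = inner ℂ f f' * inner ℂ h h' := by
  rw [inner_L2_eq, inner_L2_eq, inner_L2_eq, ← integral_prod_mul,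
    ← hp.integral_comp p.measurableEmbedding]
  refine integral_congr_ae ?_
  filter_upwards [coeFn_tensorFun hp f h, coeFn_tensorFun hp f' h'] with z h1 h2
  rw [h1, h2, map_mul]
  ring

lemma norm_tensorFun (f : Lp ℂ 2 μ) (h : Lp ℂ 2 ν) : ‖tensorFun hp f h‖ = ‖f‖ * ‖h‖ := by
  have h1 := inner_tensorFun hp f f h h
  simp only [inner_self_eq_norm_sq_to_K] at h1
  rw [← abs_of_nonneg (norm_nonneg (tensorFun hp f h)), ← abs_of_nonneg
    (by positivity : 0 ≤ ‖f‖ * ‖h‖), ← sq_eq_sq_iff_abs_eq_abs, mul_pow]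
  exact_mod_cast h1

/-- The tensor product of `L²` functions, as a continuous bilinear map. -/
def tensor : Lp ℂ 2 μ →L[ℂ] Lp ℂ 2 ν →L[ℂ] Lp ℂ 2 ρ :=
  LinearMap.mkContinuous₂ (LinearMap.mk₂ ℂ (tensorFun hp)
    (fun f f' h => by
      refine Lp.ext ?_
      filter_upwards [coeFn_tensorFun hp (f + f') h, coeFn_tensorFun hp f h,
        coeFn_tensorFun hp f' h, Lp.coeFn_add (tensorFun hp f h) (tensorFun hp f' h),
        ae_comp_fst hp (Lp.coeFn_add f f')] with z h1 h2 h3 h4 h5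
      rw [h1, h4, Pi.add_apply, h2, h3, h5, Pi.add_apply, add_mul])
    (fun c f h => by
      refine Lp.ext ?_
      filter_upwards [coeFn_tensorFun hp (c • f) h, coeFn_tensorFun hp f h,
        Lp.coeFn_smul c (tensorFun hp f h), ae_comp_fst hp (Lp.coeFn_smul c f)] with z h1 h2 h4 h5
      rw [h1, h4, Pi.smul_apply, h2, h5, Pi.smul_apply, smul_eq_mul, smul_eq_mul, mul_assoc])
    (fun f h h' => by
      refine Lp.ext ?_
      filter_upwards [coeFn_tensorFun hp f (h + h'), coeFn_tensorFun hp f h,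
        coeFn_tensorFun hp f h', Lp.coeFn_add (tensorFun hp f h) (tensorFun hp f h'),
        ae_comp_snd hp (Lp.coeFn_add h h')] with z h1 h2 h3 h4 h5
      rw [h1, h4, Pi.add_apply, h2, h3, h5, Pi.add_apply, mul_add])
    (fun c f h => by
      refine Lp.ext ?_
      filter_upwards [coeFn_tensorFun hp f (c • h), coeFn_tensorFun hp f h,
        Lp.coeFn_smul c (tensorFun hp f h), ae_comp_snd hp (Lp.coeFn_smul c h)] with z h1 h2 h4 h5
      rw [h1, h4, Pi.smul_apply, h2, h5, Pi.smul_apply, smul_eq_mul, smul_eq_mul]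
      ring))
    1 (fun f h => by rw [one_mul]; exact (norm_tensorFun hp f h).le)

lemma coeFn_tensor (f : Lp ℂ 2 μ) (h : Lp ℂ 2 ν) :
    tensor hp f h =ᵐ[ρ] fun z => f (p z).1 * h (p z).2 := coeFn_tensorFun hp f h

lemma tendsto_tensor {a : ℕ → Lp ℂ 2 μ} {b : ℕ → Lp ℂ 2 ν} {f : Lp ℂ 2 μ} {h : Lp ℂ 2 ν}
    (ha : Tendsto a atTop (𝓝 f)) (hb : Tendsto b atTop (𝓝 h)) :
    Tendsto (fun n => tensor hp (a n) (b n)) atTop (𝓝 (tensor hp f h)) :=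
  tendsto_bilin _ ha hb

lemma inner_tensor (f f' : Lp ℂ 2 μ) (h h' : Lp ℂ 2 ν) :
    inner ℂ (tensor hp f h) (tensor hp f' h') = inner ℂ f f' * inner ℂ h h' :=
  inner_tensorFun hp f f' h h'

lemma tensor_eq_of_ae {f : Lp ℂ 2 μ} {h : Lp ℂ 2 ν} {x : Lp ℂ 2 ρ} {F : X → ℂ} {H : Y → ℂ}
    (hf : f =ᵐ[μ] F) (hh : h =ᵐ[ν] H) (hx : x =ᵐ[ρ] fun z => F (p z).1 * H (p z).2) :
    tensor hp f h = x := by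
  refine Lp.ext ?_
  filter_upwards [coeFn_tensor hp f h, ae_comp_fst hp hf, ae_comp_snd hp hh, hx] with z h1 h2 h3 h4
  rw [h1, h2, h3, h4]

/-- An element of `L²` orthogonal to all tensor products vanishes. -/
lemma eq_zero_of_inner_tensor [IsFiniteMeasure μ] [IsFiniteMeasure ν] {x : Lp ℂ 2 ρ}
    (h : ∀ f g, inner ℂ (tensor hp f g) x = 0) : x = 0 := by
  have hfin : IsFiniteMeasure ρ := ⟨by
    have := hp.measure_preimage_equiv univ
    rw [preimage_univ] at this
    rw [this]
    exact measure_lt_top _ _⟩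
  have hint : Integrable x ρ := (Lp.memLp x).integrable (by norm_num)
  -- Tensor products of indicator functions are the indicators of rectangles. The integral of `x`
  -- thus vanishes on a generating π-system, and Dynkin's theorem extends this to all measurable
  -- sets.
  have hbasic : ∀ A B, MeasurableSet A → MeasurableSet B →
      ∫ z in p ⁻¹' (A ×ˢ B), x z ∂ρ = 0 := by
    intro A B hA hB
    have h1 := h (indicatorConstLp 2 hA (measure_ne_top _ _) 1)
      (indicatorConstLp 2 hB (measure_ne_top _ _) 1)
    have h2 := tensor_eq_of_ae hp (x := indicatorConstLp 2 (p.measurable (hA.prod hB))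
      (measure_ne_top _ _) (1 : ℂ)) (indicatorConstLp_coeFn (p := 2) (hs := hA)
        (hμs := measure_ne_top μ A) (c := (1 : ℂ))) (indicatorConstLp_coeFn (p := 2) (hs := hB)
        (hμs := measure_ne_top ν B) (c := (1 : ℂ))) (by
          filter_upwards [indicatorConstLp_coeFn (p := 2) (hs := p.measurable (hA.prod hB))
            (hμs := measure_ne_top ρ _) (c := (1 : ℂ))] with z hz
          rw [hz]
          by_cases h1 : (p z).1 ∈ A <;> by_cases h2 : (p z).2 ∈ B <;>
            simp [Set.indicator, h1, h2])
    rw [h2, L2.inner_indicatorConstLp_one] at h1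
    exact h1
  have hall : ∀ s : Set (X × Y), MeasurableSet s → ∫ z in p ⁻¹' s, x z ∂ρ = 0 := by
    intro s hs
    induction s, hs using MeasurableSpace.induction_on_inter generateFrom_prod.symm
      isPiSystem_prod with
    | empty => simp
    | basic t ht =>
      obtain ⟨A, hA, B, hB, rfl⟩ := ht
      exact hbasic A B hA hB
    | compl t ht ih =>
      have h1 := integral_add_compl (p.measurable ht) hint
      have h2 := hbasic univ univ MeasurableSet.univ MeasurableSet.univ
      rw [univ_prod_univ, preimage_univ, setIntegral_univ] at h2
      rw [ih, h2, zero_add] at h1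
      exact h1
    | iUnion t hd ht ih =>
      rw [preimage_iUnion, integral_iUnion (fun i => p.measurable (ht i))
        (fun i j hij => (hd hij).preimage p) hint.integrableOn]
      simp [ih]
  refine Lp.ext ((hint.ae_eq_zero_of_forall_setIntegral_eq_zero fun s hs _ => ?_).trans
    (Lp.coeFn_zero ℂ 2 ρ).symm)
  have := hall (p.symm ⁻¹' s) (p.symm.measurable hs)
  rwa [← preimage_comp, p.symm_comp_self, preimage_id] at this

/-- The tensor products of the elements of two Hilbert bases form a Hilbert basis. -/
lemma exists_tensorBasis [IsFiniteMeasure μ] [IsFiniteMeasure ν] {κ κ' : Type}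
    (e : HilbertBasis κ ℂ (Lp ℂ 2 μ)) (e' : HilbertBasis κ' ℂ (Lp ℂ 2 ν)) :
    ∃ b : HilbertBasis (κ × κ') ℂ (Lp ℂ 2 ρ), ∀ k l, b (k, l) = tensor hp (e k) (e' l) := by
  classical
  have ho : Orthonormal ℂ fun a : κ × κ' => tensor hp (e a.1) (e' a.2) := by
    rw [orthonormal_iff_ite]
    rintro ⟨k, l⟩ ⟨k', l'⟩
    rw [inner_tensor, orthonormal_iff_ite.1 e.orthonormal, orthonormal_iff_ite.1 e'.orthonormal]
    by_cases h1 : k = k' <;> by_cases h2 : l = l' <;> simp [h1, h2]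
  refine ⟨HilbertBasis.mkOfOrthogonalEqBot ho ?_, fun k l => ?_⟩
  · rw [Submodule.eq_bot_iff]
    intro x hx
    rw [Submodule.mem_orthogonal] at hx
    have h0 : ∀ k l, inner ℂ x (tensor hp (e k) (e' l)) = (0 : ℂ) := fun k l => by
      rw [← inner_conj_symm, hx _ (Submodule.subset_span ⟨(k, l), rfl⟩), map_zero]
    have h1 : ∀ k g, inner ℂ x (tensor hp (e k) g) = (0 : ℂ) := fun k g =>
      HilbertBasis.clm_eq_zero e' (A := (innerSL ℂ x).comp (tensor hp (e k))) (h0 k) g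
    refine eq_zero_of_inner_tensor hp fun f g => ?_
    have h2 : inner ℂ x (tensor hp f g) = (0 : ℂ) :=
      HilbertBasis.clm_eq_zero e (A := (innerSL ℂ x).comp ((tensor hp).flip g)) (fun k => h1 k g) f
    rw [← inner_conj_symm, h2, map_zero]
  · rw [HilbertBasis.coe_mkOfOrthogonalEqBot]

/-- The partial inner product with an element of `L²`. -/
def partialInner (f : Lp ℂ 2 μ) : Lp ℂ 2 ρ →L[ℂ] Lp ℂ 2 ν :=
  ContinuousLinearMap.adjoint (tensor hp f)

lemma inner_partialInner (f : Lp ℂ 2 μ) (g : Lp ℂ 2 ν) (x : Lp ℂ 2 ρ) :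
    inner ℂ g (partialInner hp f x) = inner ℂ (tensor hp f g) x :=
  ContinuousLinearMap.adjoint_inner_right _ _ _

/-- Parseval in the product basis, summed first over the basis of the second factor. It is what sums
the componentwise decay estimates. -/
lemma hasSum_norm_sq_partialInner [IsFiniteMeasure μ] [IsFiniteMeasure ν] {κ : Type}
    (e : HilbertBasis κ ℂ (Lp ℂ 2 μ)) (x : Lp ℂ 2 ρ) :
    HasSum (fun k => ‖partialInner hp (e k) x‖ ^ 2) (‖x‖ ^ 2) := by
  obtain ⟨w, e', -⟩ := exists_hilbertBasis ℂ (Lp ℂ 2 ν)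
  obtain ⟨b, hb⟩ := exists_tensorBasis hp e e'
  refine (HilbertBasis.hasSum_norm_sq b x).prod_fiberwise fun k => ?_
  have := HilbertBasis.hasSum_norm_sq e' (partialInner hp (e k) x)
  simpa only [hb, inner_partialInner] using this

end Tensor

end

section

/-! ### Splitting the particles into two groups -/

variable {d : ℕ} {ι ι₁ ι₂ : Type}

/-- Splitting a configuration into two configurations of two groups of particles. -/
def splitConfig [Fintype ι] [Fintype ι₁] [Fintype ι₂] (d : ℕ) (σ : ι₁ ⊕ ι₂ ≃ ι) :
    Config d ι ≃ᵐ Config d ι₁ × Config d ι₂ :=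
  (MeasurableEquiv.piCongrLeft (fun _ => Fin d → ℝ) σ).symm.trans
    (MeasurableEquiv.sumPiEquivProdPi fun _ => Fin d → ℝ)

/-- The configuration of the particles of the first group. -/
def fstConfig (σ : ι₁ ⊕ ι₂ ≃ ι) : Config d ι →L[ℝ] Config d ι₁ :=
  ContinuousLinearMap.pi fun i => ContinuousLinearMap.proj (σ (Sum.inl i))

/-- The configuration of the particles of the second group. -/
def sndConfig (σ : ι₁ ⊕ ι₂ ≃ ι) : Config d ι →L[ℝ] Config d ι₂ :=
  ContinuousLinearMap.pi fun i => ContinuousLinearMap.proj (σ (Sum.inr i))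

/-- Joining configurations of two groups of particles. -/
def joinConfig (σ : ι₁ ⊕ ι₂ ≃ ι) : Config d ι₁ × Config d ι₂ →L[ℝ] Config d ι :=
  ContinuousLinearMap.pi fun i => (σ.symm i).elim
    (fun k => (ContinuousLinearMap.proj k).comp (ContinuousLinearMap.fst ℝ _ _))
    (fun k => (ContinuousLinearMap.proj k).comp (ContinuousLinearMap.snd ℝ _ _))

@[simp] lemma fstConfig_apply (σ : ι₁ ⊕ ι₂ ≃ ι) (z : Config d ι) (i : ι₁) :
    fstConfig σ z i = z (σ (Sum.inl i)) := rfl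

@[simp] lemma sndConfig_apply (σ : ι₁ ⊕ ι₂ ≃ ι) (z : Config d ι) (i : ι₂) :
    sndConfig σ z i = z (σ (Sum.inr i)) := rfl

@[simp] lemma joinConfig_inl (σ : ι₁ ⊕ ι₂ ≃ ι) (q : Config d ι₁ × Config d ι₂) (i : ι₁) :
    joinConfig σ q (σ (Sum.inl i)) = q.1 i := by
  simp [joinConfig]

@[simp] lemma joinConfig_inr (σ : ι₁ ⊕ ι₂ ≃ ι) (q : Config d ι₁ × Config d ι₂) (i : ι₂) :
    joinConfig σ q (σ (Sum.inr i)) = q.2 i := by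
  simp [joinConfig]

@[simp] lemma fstConfig_joinConfig (σ : ι₁ ⊕ ι₂ ≃ ι) (q : Config d ι₁ × Config d ι₂) :
    fstConfig σ (joinConfig σ q) = q.1 := by
  funext i; simp

@[simp] lemma sndConfig_joinConfig (σ : ι₁ ⊕ ι₂ ≃ ι) (q : Config d ι₁ × Config d ι₂) :
    sndConfig σ (joinConfig σ q) = q.2 := by
  funext i; simp

@[simp] lemma joinConfig_fst_snd (σ : ι₁ ⊕ ι₂ ≃ ι) (z : Config d ι) :
    joinConfig σ (fstConfig σ z, sndConfig σ z) = z := by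
  funext i
  obtain ⟨k, rfl⟩ := σ.surjective i
  rcases k with k | k <;> simp

section Single

variable {σ : ι₁ ⊕ ι₂ ≃ ι}

lemma fstConfig_single_inl [DecidableEq ι] [DecidableEq ι₁] (i : ι₁) (w : Fin d → ℝ) :
    fstConfig σ (Pi.single (σ (Sum.inl i)) w) = Pi.single i w := by
  funext k
  simp [Pi.single_apply]

lemma fstConfig_single_inr [DecidableEq ι] (i : ι₂) (w : Fin d → ℝ) :
    fstConfig σ (Pi.single (σ (Sum.inr i)) w) = 0 := by
  funext k
  simp

lemma sndConfig_single_inr [DecidableEq ι] [DecidableEq ι₂] (i : ι₂) (w : Fin d → ℝ) :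
    sndConfig σ (Pi.single (σ (Sum.inr i)) w) = Pi.single i w := by
  funext k
  simp [Pi.single_apply]

lemma sndConfig_single_inl [DecidableEq ι] (i : ι₁) (w : Fin d → ℝ) :
    sndConfig σ (Pi.single (σ (Sum.inl i)) w) = 0 := by
  funext k
  simp

lemma joinConfig_single [DecidableEq ι] [DecidableEq ι₁] (i : ι₁) (w : Fin d → ℝ) :
    joinConfig σ (Pi.single i w, (0 : Config d ι₂)) = Pi.single (σ (Sum.inl i)) w := by
  rw [← joinConfig_fst_snd σ (Pi.single (σ (Sum.inl i)) w), fstConfig_single_inl,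
    sndConfig_single_inl]

end Single

/-- The set `Λ` is the product of the sets `Λ₁` and `Λ₂` of configurations of two groups. -/
structure IsProdSet (σ : ι₁ ⊕ ι₂ ≃ ι) (Λ : Set (Config d ι)) (Λ₁ : Set (Config d ι₁))
    (Λ₂ : Set (Config d ι₂)) :
    Prop where
  measurableSet_fst : MeasurableSet Λ₁
  measurableSet_snd : MeasurableSet Λ₂
  mem_iff : ∀ z, z ∈ Λ ↔ fstConfig σ z ∈ Λ₁ ∧ sndConfig σ z ∈ Λ₂

/-- Exchanging the groups lets every statement be proved for one group only. -/
lemma IsProdSet.swap {σ : ι₁ ⊕ ι₂ ≃ ι} {Λ : Set (Config d ι)} {Λ₁ : Set (Config d ι₁)}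
    {Λ₂ : Set (Config d ι₂)} (h : IsProdSet σ Λ Λ₁ Λ₂) :
    IsProdSet ((Equiv.sumComm ι₂ ι₁).trans σ) Λ Λ₂ Λ₁ :=
  ⟨h.measurableSet_snd, h.measurableSet_fst, fun z => (h.mem_iff z).trans and_comm⟩

section Measure

variable [Fintype ι] [Fintype ι₁] [Fintype ι₂] (σ : ι₁ ⊕ ι₂ ≃ ι)

lemma splitConfig_fst (z : Config d ι) : (splitConfig d σ z).1 = fstConfig σ z := rfl

lemma splitConfig_snd (z : Config d ι) : (splitConfig d σ z).2 = sndConfig σ z := rfl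

lemma joinConfig_splitConfig (z : Config d ι) : joinConfig σ (splitConfig d σ z) = z :=
  joinConfig_fst_snd σ z

variable {σ} {Λ : Set (Config d ι)} {Λ₁ : Set (Config d ι₁)} {Λ₂ : Set (Config d ι₂)}

lemma IsProdSet.measurePreserving (h : IsProdSet σ Λ Λ₁ Λ₂) :
    MeasurePreserving (splitConfig d σ) (volume.restrict Λ)
      ((volume.restrict Λ₁).prod (volume.restrict Λ₂)) := by
  have hΛ : Λ = splitConfig d σ ⁻¹' (Λ₁ ×ˢ Λ₂) := Set.ext h.mem_iff
  rw [Measure.prod_restrict, hΛ]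
  exact ((volume_measurePreserving_piCongrLeft (fun _ => Fin d → ℝ) σ).symm.trans
    (volume_measurePreserving_sumPiEquivProdPi fun _ => Fin d → ℝ)).restrict_preimage
      (h.measurableSet_fst.prod h.measurableSet_snd)

lemma IsProdSet.tensor_swap (h : IsProdSet σ Λ Λ₁ Λ₂) (f : L2 Λ₁) (g : L2 Λ₂) :
    tensor h.swap.measurePreserving g f = tensor h.measurePreserving f g :=
  tensor_eq_of_ae _ (ae_eq_refl _) (ae_eq_refl _) (by
    filter_upwards [coeFn_tensor h.measurePreserving f g] with z hz
    rw [hz, mul_comm]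
    rfl)

end Measure

/-! ### Slices and products of test functions. -/

section Slices

variable {Λ : Set (Config d ι)} {Λ₁ : Set (Config d ι₁)} {Λ₂ : Set (Config d ι₂)}
  [Fintype ι] [Fintype ι₁] [Fintype ι₂] {σ : ι₁ ⊕ ι₂ ≃ ι}

lemma IsTestFun.slice (hs : IsProdSet σ Λ Λ₁ Λ₂) {Φ : Config d ι → ℂ} (hΦ : IsTestFun Λ Φ)
    (y : Config d ι₂) : IsTestFun Λ₁ (fun x => Φ (joinConfig σ (x, y))) := by
  have hc : Continuous fun x : Config d ι₁ => joinConfig σ (x, y) := by fun_prop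
  have hsupp : tsupport (fun x => Φ (joinConfig σ (x, y))) ⊆
      (fun x => joinConfig σ (x, y)) ⁻¹' tsupport Φ :=
    tsupport_comp_subset_preimage Φ hc
  refine ⟨hΦ.1.comp ((joinConfig σ).contDiff.comp (contDiff_id.prodMk contDiff_const)), ?_, ?_⟩
  · refine HasCompactSupport.intro (hΦ.2.1.isCompact.image (fstConfig σ).continuous) fun x hx => ?_
    refine image_eq_zero_of_notMem_tsupport fun h => hx ⟨_, h, ?_⟩
    simp
  · intro x hx
    have := ((hs.mem_iff _).1 (hΦ.2.2 (hsupp hx))).1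
    rwa [fstConfig_joinConfig] at this

lemma IsTestFun.tensor (hs : IsProdSet σ Λ Λ₁ Λ₂) {φ₁ : Config d ι₁ → ℂ} {φ₂ : Config d ι₂ → ℂ}
    (h₁ : IsTestFun Λ₁ φ₁)
    (h₂ : IsTestFun Λ₂ φ₂) :
    IsTestFun Λ (fun z => φ₁ (fstConfig σ z) * φ₂ (sndConfig σ z)) := by
  have hsub : ∀ z ∉ joinConfig σ '' (tsupport φ₁ ×ˢ tsupport φ₂),
      φ₁ (fstConfig σ z) * φ₂ (sndConfig σ z) = 0 := by
    intro z hz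
    by_contra h0
    refine hz ⟨(fstConfig σ z, sndConfig σ z), ⟨?_, ?_⟩, joinConfig_fst_snd σ z⟩
    · exact subset_tsupport _ (left_ne_zero_of_mul h0)
    · exact subset_tsupport _ (right_ne_zero_of_mul h0)
  have hK : IsCompact (joinConfig σ '' (tsupport φ₁ ×ˢ tsupport φ₂)) :=
    (h₁.2.1.isCompact.prod h₂.2.1.isCompact).image (joinConfig σ).continuous
  refine ⟨(h₁.1.comp (fstConfig σ).contDiff).mul (h₂.1.comp (sndConfig σ).contDiff),
    HasCompactSupport.intro hK hsub, ?_⟩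
  refine (closure_minimal (fun z hz => ?_) hK.isClosed).trans ?_
  · by_contra h
    exact hz (hsub z h)
  · rintro _ ⟨q, hq, rfl⟩
    rw [hs.mem_iff, fstConfig_joinConfig, sndConfig_joinConfig]
    exact ⟨h₁.2.2 hq.1, h₂.2.2 hq.2⟩

lemma IsTestFun.toL2_tensor (hs : IsProdSet σ Λ Λ₁ Λ₂)
    {φ₁ : Config d ι₁ → ℂ} {φ₂ : Config d ι₂ → ℂ} (h₁ : IsTestFun Λ₁ φ₁)
    (h₂ : IsTestFun Λ₂ φ₂) :
    (h₁.tensor hs h₂).toL2 =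
      MPAnderson.tensor (hs.measurePreserving) h₁.toL2 h₂.toL2 :=
  (tensor_eq_of_ae _ h₁.coeFn_toL2 h₂.coeFn_toL2 (h₁.tensor hs h₂).coeFn_toL2).symm

/-- Fubini: pairing with a tensor product is pairing the slices with `f`, weighted by `h`. A weak
equation in the first group can then be used slice by slice. -/
lemma inner_tensor_eq_integral (hs : IsProdSet σ Λ Λ₁ Λ₂)
    {Φ : Config d ι → ℂ} (hΦ : IsTestFun Λ Φ) (f : L2 Λ₁) (h : L2 Λ₂) :
    Integrable (fun y => h y * inner ℂ (hΦ.slice hs y).toL2 f) (volume.restrict Λ₂) ∧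
    inner ℂ hΦ.toL2 (tensor (hs.measurePreserving) f h) =
      ∫ y in Λ₂, h y * inner ℂ (hΦ.slice hs y).toL2 f := by
  set hp := hs.measurePreserving with hhp
  set F : Config d ι₁ × Config d ι₂ → ℂ := fun q =>
    f q.1 * h q.2 * (starRingEnd ℂ) (Φ (joinConfig σ q)) with hF
  have hae : (fun z => tensor hp f h z * (starRingEnd ℂ) (Φ z))
      =ᵐ[volume.restrict Λ] F ∘ splitConfig d σ := by
    filter_upwards [coeFn_tensor hp f h] with z hz
    rw [hz, Function.comp_apply, hF]
    simp only [joinConfig_splitConfig]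
  have hint : Integrable F ((volume.restrict Λ₁).prod (volume.restrict Λ₂)) := by
    rw [← hp.integrable_comp_emb (splitConfig d σ).measurableEmbedding]
    exact (integrable_mul_conj (tensor hp f h) hΦ).congr hae
  have hslice : ∀ y, ∫ x in Λ₁, F (x, y) = h y * inner ℂ (hΦ.slice hs y).toL2 f := by
    intro y
    rw [← integral_mul_eq_inner, ← integral_const_mul]
    refine integral_congr_ae (Eventually.of_forall fun x => ?_)
    simp only [hF]; ring
  constructor
  · simpa only [hslice] using hint.integral_prod_right
  · rw [← integral_mul_eq_inner, integral_congr_ae hae]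
    simp only [Function.comp_apply]
    rw [hp.integral_comp (splitConfig d σ).measurableEmbedding, integral_prod_symm _ hint]
    simp only [hslice]

end Slices

/-! ### Derivatives and weak gradients of products. -/

section Deriv

variable [Fintype ι] [LinearOrder ι] {σ : ι₁ ⊕ ι₂ ≃ ι}

lemma pderiv_comp_fstConfig [Fintype ι₁] {φ : Config d ι₁ → ℂ} (hφ : ContDiff ℝ ∞ φ) (i : ι)
    (j : Fin d)
    (z : Config d ι) : pderiv i j (fun z => φ (fstConfig σ z)) z =
      fderiv ℝ φ (fstConfig σ z) (fstConfig σ (Pi.single i (Pi.single j 1))) :=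
  congrArg (fun L => L (Pi.single i (Pi.single j 1)))
    ((hφ.differentiable (by simp) _).hasFDerivAt.comp z (fstConfig σ).hasFDerivAt).fderiv

lemma pderiv_comp_sndConfig [Fintype ι₂] {φ : Config d ι₂ → ℂ} (hφ : ContDiff ℝ ∞ φ) (i : ι)
    (j : Fin d)
    (z : Config d ι) : pderiv i j (fun z => φ (sndConfig σ z)) z =
      fderiv ℝ φ (sndConfig σ z) (sndConfig σ (Pi.single i (Pi.single j 1))) :=
  congrArg (fun L => L (Pi.single i (Pi.single j 1)))
    ((hφ.differentiable (by simp) _).hasFDerivAt.comp z (sndConfig σ).hasFDerivAt).fderiv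

end Deriv

section Eigenfunctions

variable {Λ : Set (Config d ι)} {Λ₁ : Set (Config d ι₁)} {Λ₂ : Set (Config d ι₂)}
  [Fintype ι] [Fintype ι₁] [Fintype ι₂] [LinearOrder ι]
  {σ : ι₁ ⊕ ι₂ ≃ ι}

lemma pderiv_tensor_inl [LinearOrder ι₁] {φ₁ : Config d ι₁ → ℂ} {φ₂ : Config d ι₂ → ℂ}
    (h₁ : ContDiff ℝ ∞ φ₁)
    (h₂ : ContDiff ℝ ∞ φ₂) (i : ι₁) (j : Fin d) :
    pderiv (σ (Sum.inl i)) j (fun z => φ₁ (fstConfig σ z) * φ₂ (sndConfig σ z)) =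
      fun z => pderiv i j φ₁ (fstConfig σ z) * φ₂ (sndConfig σ z) := by
  rw [pderiv_mul (w := fun z => φ₁ (fstConfig σ z)) (φ := fun z => φ₂ (sndConfig σ z))
    (h₁.comp (fstConfig σ).contDiff) (h₂.comp (sndConfig σ).contDiff)]
  funext z
  rw [pderiv_comp_fstConfig h₁, pderiv_comp_sndConfig h₂, fstConfig_single_inl,
    sndConfig_single_inl, map_zero, mul_zero, zero_add]
  rfl

lemma pderiv_tensor_inr [LinearOrder ι₂] {φ₁ : Config d ι₁ → ℂ} {φ₂ : Config d ι₂ → ℂ}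
    (h₁ : ContDiff ℝ ∞ φ₁)
    (h₂ : ContDiff ℝ ∞ φ₂) (i : ι₂) (j : Fin d) :
    pderiv (σ (Sum.inr i)) j (fun z => φ₁ (fstConfig σ z) * φ₂ (sndConfig σ z)) =
      fun z => φ₁ (fstConfig σ z) * pderiv i j φ₂ (sndConfig σ z) := by
  rw [pderiv_mul (w := fun z => φ₁ (fstConfig σ z)) (φ := fun z => φ₂ (sndConfig σ z))
    (h₁.comp (fstConfig σ).contDiff) (h₂.comp (sndConfig σ).contDiff)]
  funext z
  rw [pderiv_comp_fstConfig h₁, pderiv_comp_sndConfig h₂, fstConfig_single_inr,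
    sndConfig_single_inr, map_zero, zero_mul, add_zero]
  rfl

lemma pderiv_slice [LinearOrder ι₁] {Φ : Config d ι → ℂ} (hΦ : ContDiff ℝ ∞ Φ) (y : Config d ι₂)
    (i : ι₁)
    (j : Fin d) : pderiv i j (fun x => Φ (joinConfig σ (x, y))) =
      fun x => pderiv (σ (Sum.inl i)) j Φ (joinConfig σ (x, y)) := by
  funext x
  have h1 : HasFDerivAt (fun x : Config d ι₁ => joinConfig σ (x, y))
      ((joinConfig σ).comp ((ContinuousLinearMap.id ℝ _).prod 0)) x :=
    (joinConfig σ).hasFDerivAt.comp x ((hasFDerivAt_id x).prodMk (hasFDerivAt_const y x))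
  have h2 := ((hΦ.differentiable (by simp) _).hasFDerivAt.comp x h1).fderiv
  refine (congrArg (fun L => L (Pi.single i (Pi.single j 1))) h2).trans ?_
  simp only [pderiv, ContinuousLinearMap.comp_apply, ContinuousLinearMap.prod_apply,
    ContinuousLinearMap.id_apply, _root_.zero_apply, joinConfig_single]

/-- Products of approximating test functions approximate the tensor product, and each partial
derivative acts on the factor of its own group. -/
lemma HasH10Grad.tensor [LinearOrder ι₁] [LinearOrder ι₂] (hs : IsProdSet σ Λ Λ₁ Λ₂) {ψ₁ : L2 Λ₁}
    {ψ₂ : L2 Λ₂} {g₁ : ι₁ → Fin d → L2 Λ₁} {g₂ : ι₂ → Fin d → L2 Λ₂} (h₁ : HasH10Grad Λ₁ ψ₁ g₁)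
    (h₂ : HasH10Grad Λ₂ ψ₂ g₂) :
    HasH10Grad Λ (tensor (hs.measurePreserving) ψ₁ ψ₂)
      (fun i j => (σ.symm i).elim
        (fun k => tensor (hs.measurePreserving) (g₁ k j) ψ₂)
        (fun k => tensor (hs.measurePreserving) ψ₁ (g₂ k j))) := by
  set hp := hs.measurePreserving
  rw [hasH10Grad_iff_seq] at h₁ h₂ ⊢
  obtain ⟨φ₁, t₁, hψ₁, hg₁⟩ := h₁
  obtain ⟨φ₂, t₂, hψ₂, hg₂⟩ := h₂
  refine ⟨fun n z => φ₁ n (fstConfig σ z) * φ₂ n (sndConfig σ z),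
    fun n => (t₁ n).tensor hs (t₂ n), ?_, fun i j => ?_⟩
  · exact (tendsto_tensor hp hψ₁ hψ₂).congr fun n =>
      (IsTestFun.toL2_tensor hs (t₁ n) (t₂ n)).symm
  · obtain ⟨k, rfl⟩ := σ.surjective i
    rw [Equiv.symm_apply_apply]
    rcases k with k | k
    · have : ∀ n, (((t₁ n).tensor hs (t₂ n)).pderiv (σ (Sum.inl k)) j).toL2 =
          MPAnderson.tensor hp ((t₁ n).pderiv k j).toL2 (t₂ n).toL2 := fun n => by
        rw [← IsTestFun.toL2_tensor hs]
        exact IsTestFun.toL2_congr _ _ (pderiv_tensor_inl (t₁ n).1 (t₂ n).1 k j)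
      exact (tendsto_tensor hp (hg₁ k j) hψ₂).congr fun n => (this n).symm
    · have : ∀ n, (((t₁ n).tensor hs (t₂ n)).pderiv (σ (Sum.inr k)) j).toL2 =
          MPAnderson.tensor hp (t₁ n).toL2 ((t₂ n).pderiv k j).toL2 := fun n => by
        rw [← IsTestFun.toL2_tensor hs]
        exact IsTestFun.toL2_congr _ _ (pderiv_tensor_inr (t₁ n).1 (t₂ n).1 k j)
      exact (tendsto_tensor hp hψ₁ (hg₂ k j)).congr fun n => (this n).symm

end Eigenfunctions

end

section

/-! ### Hamiltonians of non-interacting groups of particles -/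

section IndicatorOp

variable {X : Type} [MeasurableSpace X] {μ : Measure X}

lemma coeFn_indicatorOp {S : Set X} (hS : MeasurableSet S) (f : Lp ℂ 2 μ) :
    indicatorOp μ S hS f =ᵐ[μ] S.indicator f := coeFn_indicatorFun μ S hS f

lemma norm_indicatorOp_le {S : Set X} (hS : MeasurableSet S) (f : Lp ℂ 2 μ) :
    ‖indicatorOp μ S hS f‖ ≤ ‖f‖ := by
  exact (norm_indicatorFun_le μ S hS f).trans_eq (one_mul _)

lemma inner_indicatorOp_left {S : Set X} (hS : MeasurableSet S) (f g : Lp ℂ 2 μ) :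
    inner ℂ (indicatorOp μ S hS f) g = inner ℂ f (indicatorOp μ S hS g) := by
  rw [inner_L2_eq, inner_L2_eq]
  refine integral_congr_ae ?_
  filter_upwards [coeFn_indicatorOp hS f, coeFn_indicatorOp hS g] with x h1 h2
  rw [h1, h2]
  by_cases hx : x ∈ S <;> simp [hx]

lemma indicatorOp_indicatorOp {S T : Set X} (hS : MeasurableSet S) (hT : MeasurableSet T)
    (f : Lp ℂ 2 μ) :
    indicatorOp μ S hS (indicatorOp μ T hT f) = indicatorOp μ (S ∩ T) (hS.inter hT) f := by
  refine Lp.ext ?_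
  filter_upwards [coeFn_indicatorOp hS (indicatorOp μ T hT f), coeFn_indicatorOp hT f,
    coeFn_indicatorOp (hS.inter hT) f] with x h1 h2 h3
  rw [h1, h3, ← indicator_indicator]
  by_cases hx : x ∈ S <;> simp [hx, h2]

end IndicatorOp

variable {d : ℕ} {ι ι₁ ι₂ : Type} [Fintype ι] [Fintype ι₁] [Fintype ι₂]
  {σ : ι₁ ⊕ ι₂ ≃ ι} {Λ : Set (Config d ι)} {Λ₁ : Set (Config d ι₁)} {Λ₂ : Set (Config d ι₂)}

lemma tensor_indicatorOp (hs : IsProdSet σ Λ Λ₁ Λ₂) {S : Set (Config d ι₂)} (hS : MeasurableSet S)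
    (f : L2 Λ₁) (g : L2 Λ₂) :
    tensor hs.measurePreserving f (indicatorOp _ S hS g) =
      indicatorOp _ (sndConfig σ ⁻¹' S) ((sndConfig σ).measurable hS)
        (tensor hs.measurePreserving f g) := by
  refine tensor_eq_of_ae _ (ae_eq_refl _) (coeFn_indicatorOp hS g) ?_
  filter_upwards [coeFn_indicatorOp ((sndConfig σ).measurable hS)
    (tensor hs.measurePreserving f g), coeFn_tensor hs.measurePreserving f g] with z h1 h2
  rw [h1, splitConfig_fst, splitConfig_snd]
  by_cases hz : sndConfig σ z ∈ S
  · rw [indicator_of_mem hz, indicator_of_mem (show z ∈ sndConfig σ ⁻¹' S from hz), h2]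
    rfl
  · rw [indicator_of_notMem hz, indicator_of_notMem (show z ∉ sndConfig σ ⁻¹' S from hz), mul_zero]

/-- Taking a component along the first group commutes with cutting off in the second; this is dual
to `tensor_indicatorOp`. -/
lemma partialInner_indicatorOp (hs : IsProdSet σ Λ Λ₁ Λ₂) {S : Set (Config d ι₂)}
    (hS : MeasurableSet S) (f : L2 Λ₁) (x : L2 Λ) :
    partialInner hs.measurePreserving f
      (indicatorOp _ (sndConfig σ ⁻¹' S) ((sndConfig σ).measurable hS) x) =
      indicatorOp _ S hS (partialInner hs.measurePreserving f x) := by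
  refine ext_inner_left ℂ fun g => ?_
  rw [inner_partialInner, ← inner_indicatorOp_left, ← inner_indicatorOp_left, inner_partialInner,
    tensor_indicatorOp hs]

variable [LinearOrder ι] [LinearOrder ι₁] {W : Config d ι → ℝ}
  {W₁ : Config d ι₁ → ℝ} {W₂ : Config d ι₂ → ℝ}

/-- The weak formulation of the eigenvalue equation for the first group of particles. -/
lemma weak_tensor_fst (hs : IsProdSet σ Λ Λ₁ Λ₂) {g₁ : ι₁ → Fin d → L2 Λ₁} {p₁ η₁ : L2 Λ₁}
    (h : ∀ φ (hφ : IsTestFun Λ₁ φ), (1 / 2 : ℂ) * ∑ i, ∑ j, inner ℂ (hφ.pderiv i j).toL2 (g₁ i j)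
        + inner ℂ hφ.toL2 p₁ = inner ℂ hφ.toL2 η₁) (ψ₂ : L2 Λ₂)
    {Φ : Config d ι → ℂ} (hΦ : IsTestFun Λ Φ) :
    (1 / 2 : ℂ) * ∑ i, ∑ j, inner ℂ (hΦ.pderiv (σ (Sum.inl i)) j).toL2
        (tensor hs.measurePreserving (g₁ i j) ψ₂)
      + inner ℂ hΦ.toL2 (tensor hs.measurePreserving p₁ ψ₂)
      = inner ℂ hΦ.toL2 (tensor hs.measurePreserving η₁ ψ₂) := by
  have h1 := fun i j => inner_tensor_eq_integral hs (hΦ.pderiv (σ (Sum.inl i)) j) (g₁ i j) ψ₂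
  have h2 := inner_tensor_eq_integral hs hΦ p₁ ψ₂
  have h3 := inner_tensor_eq_integral hs hΦ η₁ ψ₂
  rw [h2.2, h3.2, Finset.sum_congr rfl fun i _ => Finset.sum_congr rfl fun j _ => (h1 i j).2,
    Finset.sum_congr rfl fun i _ => (integral_finsetSum _ fun j _ => (h1 i j).1).symm,
    ← integral_finsetSum _ fun i _ => integrable_finsetSum _ fun j _ => (h1 i j).1,
    ← integral_const_mul, ← integral_add ((integrable_finsetSum _ fun i _ =>
      integrable_finsetSum _ fun j _ => (h1 i j).1).const_mul _) h2.1]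
  refine integral_congr_ae (Eventually.of_forall fun y => ?_)
  have h4 := h _ (hΦ.slice hs y)
  have h5 : ∀ i j, ((hΦ.pderiv (σ (Sum.inl i)) j).slice hs y).toL2 =
      ((hΦ.slice hs y).pderiv i j).toL2 := fun i j =>
    IsTestFun.toL2_congr _ _ (pderiv_slice hΦ.1 y i j).symm
  simp only [h5]
  rw [← h4, mul_add]
  congr 1
  simp only [Finset.mul_sum]
  exact Finset.sum_congr rfl fun i _ => Finset.sum_congr rfl fun j _ => by ring

variable [LinearOrder ι₂]

/-- The Hamiltonian of two non-interacting groups of particles on tensor products. -/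
theorem hamGraph_tensor (hs : IsProdSet σ Λ Λ₁ Λ₂) (hW : IsBddPot Λ W) (hW₁ : IsBddPot Λ₁ W₁)
    (hW₂ : IsBddPot Λ₂ W₂) (hadd : ∀ z, W z = W₁ (fstConfig σ z) + W₂ (sndConfig σ z))
    {ψ₁ η₁ : L2 Λ₁} {ψ₂ η₂ : L2 Λ₂} (h₁ : HamGraph Λ₁ W₁ ψ₁ η₁) (h₂ : HamGraph Λ₂ W₂ ψ₂ η₂) :
    HamGraph Λ W (tensor hs.measurePreserving ψ₁ ψ₂)
      (tensor hs.measurePreserving η₁ ψ₂ + tensor hs.measurePreserving ψ₁ η₂) := by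
  rw [hamGraph_iff_inner hW₁.memLp] at h₁
  rw [hamGraph_iff_inner hW₂.memLp] at h₂
  rw [hamGraph_iff_inner hW.memLp]
  obtain ⟨g₁, hg₁, h₁⟩ := h₁
  obtain ⟨g₂, hg₂, h₂⟩ := h₂
  refine ⟨_, hg₁.tensor hs hg₂, fun Φ hΦ => ?_⟩
  have hpot : mulOp hW.memLp (tensor hs.measurePreserving ψ₁ ψ₂) =
      tensor hs.measurePreserving (mulOp hW₁.memLp ψ₁) ψ₂ +
        tensor hs.measurePreserving ψ₁ (mulOp hW₂.memLp ψ₂) := by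
    refine Lp.ext ?_
    filter_upwards [coeFn_mulOp hW.memLp (tensor hs.measurePreserving ψ₁ ψ₂),
      coeFn_tensor hs.measurePreserving ψ₁ ψ₂,
      coeFn_tensor hs.measurePreserving (mulOp hW₁.memLp ψ₁) ψ₂,
      coeFn_tensor hs.measurePreserving ψ₁ (mulOp hW₂.memLp ψ₂),
      ae_comp_fst hs.measurePreserving (coeFn_mulOp hW₁.memLp ψ₁),
      ae_comp_snd hs.measurePreserving (coeFn_mulOp hW₂.memLp ψ₂),
      Lp.coeFn_add (tensor hs.measurePreserving (mulOp hW₁.memLp ψ₁) ψ₂)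
        (tensor hs.measurePreserving ψ₁ (mulOp hW₂.memLp ψ₂))] with z e1 e2 e3 e4 e5 e6 e7
    rw [e1, e7, Pi.add_apply, e2, e3, e4, e5, e6, hadd, splitConfig_fst, splitConfig_snd]
    push_cast
    ring
  -- The weak equation of each group holds after tensoring with the other factor, against every test
  -- function of the product; the sum of the two is the claim.
  have e1 := weak_tensor_fst hs h₁ ψ₂ hΦ
  have e2 := weak_tensor_fst hs.swap h₂ ψ₁ hΦ
  simp only [hs.tensor_swap] at e2
  rw [hpot, inner_add_right, inner_add_right, ← e1, ← e2, ← σ.sum_comp, Fintype.sum_sum_type]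
  simp only [Equiv.symm_apply_apply, Sum.elim_inl, Sum.elim_inr, Equiv.trans_apply,
    Equiv.sumComm_apply, Sum.swap_inl]
  ring

/-- Symmetry of `H`, read off from the real eigenvalues in coordinates. -/
lemma HamDiag.inner_symm {κ : Type} {e : HilbertBasis κ ℂ (L2 Λ)} {lam : κ → ℝ}
    (h : HamDiag W e lam) {x y x' y' : L2 Λ} (hx : HamGraph Λ W x y) (hx' : HamGraph Λ W x' y') :
    inner ℂ y x' = inner ℂ x y' := by
  rw [h.graph_iff] at hx hx'
  refine (e.hasSum_inner_mul_inner y x').unique ?_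
  convert e.hasSum_inner_mul_inner x y' using 2 with k
  rw [hx' k, ← inner_conj_symm y, hx k, ← inner_conj_symm x, map_mul, Complex.conj_ofReal]
  ring

variable {κ₁ κ₂ κ : Type} {e₁ : HilbertBasis κ₁ ℂ (L2 Λ₁)} {lam₁ : κ₁ → ℝ}
  {e₂ : HilbertBasis κ₂ ℂ (L2 Λ₂)} {lam₂ : κ₂ → ℝ} {e : HilbertBasis κ ℂ (L2 Λ)} {lam : κ → ℝ}

/-- Reduction of the Hamiltonian of two non-interacting groups to the eigenspaces of the
Hamiltonian of the first group. -/
theorem hamGraph_partialInner (hs : IsProdSet σ Λ Λ₁ Λ₂) (hW : IsBddPot Λ W)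
    (hW₁ : IsBddPot Λ₁ W₁) (hW₂ : IsBddPot Λ₂ W₂)
    (hadd : ∀ z, W z = W₁ (fstConfig σ z) + W₂ (sndConfig σ z))
    (D : HamDiag W e lam) (D₁ : HamDiag W₁ e₁ lam₁) (D₂ : HamDiag W₂ e₂ lam₂)
    {ψ η : L2 Λ} {E : ℝ} (h : HamGraph Λ W ψ (η + (E : ℂ) • ψ)) (k : κ₁) :
    HamGraph Λ₂ W₂ (partialInner hs.measurePreserving (e₁ k) ψ)
      (partialInner hs.measurePreserving (e₁ k) η +
        ((E - lam₁ k : ℝ) : ℂ) • partialInner hs.measurePreserving (e₁ k) ψ) := by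
  rw [D₂.graph_shift_iff]
  intro l
  have h₁ : HamGraph Λ₁ W₁ (e₁ k) ((lam₁ k : ℂ) • e₁ k) := D₁.graph_basis k
  have h₂ : HamGraph Λ₂ W₂ (e₂ l) ((lam₂ l : ℂ) • e₂ l) := D₂.graph_basis l
  -- `e₁ k ⊗ e₂ l` is an eigenvector for `lam₁ k + lam₂ l`. Moving `H` onto it gives the `l`-th
  -- coordinate of the equation for the second group at energy `E - lam₁ k`.
  have h3 := D.inner_symm (hamGraph_tensor hs hW hW₁ hW₂ hadd h₁ h₂) h
  rw [map_smul, _root_.smul_apply, map_smul, ← add_smul, inner_smul_left, inner_add_right,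
    inner_smul_right] at h3
  rw [inner_partialInner, inner_partialInner]
  rw [← Complex.ofReal_add, Complex.conj_ofReal] at h3
  push_cast at h3 ⊢
  linear_combination -h3

/-- Decay estimate for two non-interacting groups of particles. -/
theorem norm_indicatorOp_snd_le (hs : IsProdSet σ Λ Λ₁ Λ₂) (hW : IsBddPot Λ W)
    (hW₁ : IsBddPot Λ₁ W₁) (hW₂ : IsBddPot Λ₂ W₂)
    (hadd : ∀ z, W z = W₁ (fstConfig σ z) + W₂ (sndConfig σ z))
    (D : HamDiag W e lam) (D₁ : HamDiag W₁ e₁ lam₁) (D₂ : HamDiag W₂ e₂ lam₂)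
    (hfin₁ : volume Λ₁ ≠ ⊤) (hfin₂ : volume Λ₂ ≠ ⊤)
    {S C₂ : Set (Config d ι₂)} (hS : MeasurableSet S) (hC₂ : MeasurableSet C₂)
    {C₁ : Set (Config d ι₁)} (hC₁ : MeasurableSet C₁) {E s : ℝ}
    (hdecay : ∀ k, ∀ g h : L2 Λ₂, HamGraph Λ₂ W₂ g
      (indicatorOp _ C₂ hC₂ h + ((E - lam₁ k : ℝ) : ℂ) • g) →
      ‖indicatorOp _ S hS g‖ ≤ s * ‖h‖)
    {ψ η : L2 Λ} (h : HamGraph Λ W ψ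
      (indicatorOp _ (sndConfig σ ⁻¹' C₂ ∩ fstConfig σ ⁻¹' C₁)
        (((sndConfig σ).measurable hC₂).inter ((fstConfig σ).measurable hC₁)) η + (E : ℂ) • ψ)) :
    ‖indicatorOp _ (sndConfig σ ⁻¹' S) ((sndConfig σ).measurable hS) ψ‖ ≤ |s| * ‖η‖ := by
  have : IsFiniteMeasure (volume.restrict Λ₁) := ⟨by simpa using hfin₁.lt_top⟩
  have : IsFiniteMeasure (volume.restrict Λ₂) := ⟨by simpa using hfin₂.lt_top⟩
  set hp := hs.measurePreserving
  -- The cutoff in the first group does not commute with the expansion, so it is absorbed into the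
  -- right-hand side, where it does not increase the norm.
  set η' := indicatorOp _ _ ((fstConfig σ).measurable hC₁) η with hη'
  refine le_trans ?_ (mul_le_mul_of_nonneg_left (norm_indicatorOp_le
    ((fstConfig σ).measurable hC₁) η) (abs_nonneg s))
  refine le_of_sq_le_sq ?_ (by positivity)
  rw [mul_pow]
  refine hasSum_le (fun k => ?_) (hasSum_norm_sq_partialInner hp e₁ _)
    ((hasSum_norm_sq_partialInner hp e₁ η').mul_left _)
  rw [partialInner_indicatorOp hs hS, ← mul_pow]
  refine pow_le_pow_left₀ (norm_nonneg _) ?_ 2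
  refine (hdecay k _ (partialInner hp (e₁ k) η') ?_).trans
    (mul_le_mul_of_nonneg_right (le_abs_self s) (norm_nonneg _))
  rw [← indicatorOp_indicatorOp ((sndConfig σ).measurable hC₂) ((fstConfig σ).measurable hC₁)] at h
  have := hamGraph_partialInner hs hW hW₁ hW₂ hadd D D₁ D₂ h k
  rwa [partialInner_indicatorOp hs hC₂] at this

end

section

/-! ### Exponential decay of resolvents below the spectrum -/

/-! ### Weights and cutoffs. -/

section Multiplication

variable {X : Type} [MeasurableSpace X] {μ : Measure X}

lemma inner_mulOp_mulOp {w w' : X → ℝ} (hw : MemLp (fun x => (w x : ℂ)) ∞ μ)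
    (hw' : MemLp (fun x => (w' x : ℂ)) ∞ μ) (h : ∀ᵐ x ∂μ, w' x = w x * w x) (f g : Lp ℂ 2 μ) :
    inner ℂ (mulOp hw' f) g = inner ℂ (mulOp hw f) (mulOp hw g) := by
  rw [inner_L2_eq, inner_L2_eq]
  refine integral_congr_ae ?_
  filter_upwards [coeFn_mulOp hw f, coeFn_mulOp hw g, coeFn_mulOp hw' f, h] with x h1 h2 h3 h4
  rw [h1, h2, h3, h4, map_mul, map_mul, Complex.conj_ofReal, Complex.conj_ofReal]
  push_cast
  ring

lemma mulOp_comm {w w' : X → ℂ} (hw : MemLp w ∞ μ) (hw' : MemLp w' ∞ μ) (f : Lp ℂ 2 μ) :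
    mulOp hw (mulOp hw' f) = mulOp hw' (mulOp hw f) := by
  refine Lp.ext ?_
  filter_upwards [coeFn_mulOp hw (mulOp hw' f), coeFn_mulOp hw' f, coeFn_mulOp hw' (mulOp hw f),
    coeFn_mulOp hw f] with x h1 h2 h3 h4
  rw [h1, h2, h3, h4]
  ring

lemma re_inner_mulOp_nonneg {w : X → ℝ} (hw : MemLp (fun x => (w x : ℂ)) ∞ μ)
    (h : ∀ᵐ x ∂μ, 0 ≤ w x) (f : Lp ℂ 2 μ) : 0 ≤ (inner ℂ f (mulOp hw f)).re := by
  rw [inner_L2_eq]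
  have : ∫ x, mulOp hw f x * (starRingEnd ℂ) (f x) ∂μ =
      ∫ x, ((w x * ‖f x‖ ^ 2 : ℝ) : ℂ) ∂μ := by
    refine integral_congr_ae ?_
    filter_upwards [coeFn_mulOp hw f] with x hx
    rw [hx, mul_assoc, Complex.mul_conj, Complex.normSq_eq_norm_sq]
    push_cast
    rfl
  rw [this, integral_complex_ofReal, Complex.ofReal_re]
  refine integral_nonneg_of_ae ?_
  filter_upwards [h] with x hx
  positivity

/-- Allows a layer in the max-norm to be treated one coordinate direction at a time. -/
lemma norm_indicatorOp_le_sum {κ : Type} [Fintype κ] {S : Set X} (hS : MeasurableSet S)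
    {T : κ → Set X} (hT : ∀ k, MeasurableSet (T k)) (h : ∀ᵐ x ∂μ, x ∈ S → ∃ k, x ∈ T k)
    (f : Lp ℂ 2 μ) : ‖indicatorOp μ S hS f‖ ≤ ∑ k, ‖indicatorOp μ (T k) (hT k) f‖ := by
  have key : ‖indicatorOp μ S hS f‖ₑ ≤ ∑ k, ‖indicatorOp μ (T k) (hT k) f‖ₑ := by
    simp only [Lp.enorm_def]
    refine le_trans (eLpNorm_mono_ae (g := ∑ k, fun x => ‖indicatorOp μ (T k) (hT k) f x‖) ?_)
      ((eLpNorm_sum_le (fun k _ => (Lp.aestronglyMeasurable _).norm) (by norm_num)).trans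
        (Finset.sum_le_sum fun k _ => (eLpNorm_norm _).le))
    have hall : ∀ᵐ x ∂μ, ∀ k, indicatorOp μ (T k) (hT k) f x = (T k).indicator f x :=
      ae_all_iff.2 fun k => coeFn_indicatorOp (hT k) f
    filter_upwards [coeFn_indicatorOp hS f, hall, h] with x h1 h2 h3
    rw [h1, Finset.sum_apply, Real.norm_of_nonneg (Finset.sum_nonneg fun k _ => norm_nonneg _)]
    by_cases hx : x ∈ S
    · obtain ⟨k, hk⟩ := h3 hx
      refine le_trans ?_ (Finset.single_le_sum (fun k _ => norm_nonneg _) (Finset.mem_univ k))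
      rw [h2, indicator_of_mem hx, indicator_of_mem hk]
    · rw [indicator_of_notMem hx, norm_zero]
      exact Finset.sum_nonneg fun k _ => norm_nonneg _
  have hfin : ∀ k ∈ Finset.univ, ‖indicatorOp μ (T k) (hT k) f‖ₑ ≠ ⊤ := fun k _ => enorm_ne_top
  have := ENNReal.toReal_mono (ENNReal.sum_ne_top.2 hfin) key
  rwa [ENNReal.toReal_sum hfin] at this

end Multiplication

variable {d : ℕ} {ι : Type} [Fintype ι] {Λ : Set (Config d ι)}

/-- The exponential weight in the `j`-th coordinate of the `i`-th particle. -/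
def expWeight (i : ι) (j : Fin d) (b t : ℝ) (x : Config d ι) : ℝ := Real.exp (b * (x i j - t))

lemma contDiff_expWeight (i : ι) (j : Fin d) (b t : ℝ) :
    ContDiff ℝ ∞ (expWeight (d := d) i j b t) := by
  unfold expWeight
  fun_prop

lemma expWeight_memLp (hb : Bornology.IsBounded Λ) (hΛ : MeasurableSet Λ) (i : ι) (j : Fin d)
    (b t : ℝ) : MemLp (fun x => (expWeight i j b t x : ℂ)) ∞ (volume.restrict Λ) := by
  obtain ⟨R, hR⟩ := hb.exists_norm_le
  refine memLp_top_ofReal (contDiff_expWeight i j b t).continuous.measurable.aemeasurable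
    (c := Real.exp (|b| * (R + |t|))) ?_
  filter_upwards [ae_restrict_mem hΛ] with x hx
  rw [expWeight, Real.abs_exp, Real.exp_le_exp]
  refine (le_abs_self _).trans ?_
  rw [abs_mul]
  gcongr
  refine (abs_sub _ _).trans ?_
  gcongr
  exact (norm_le_pi_norm (x i) j).trans ((norm_le_pi_norm x i).trans (hR x hx))

variable [LinearOrder ι] {W : Config d ι → ℝ}

lemma pderiv_expWeight (i : ι) (j : Fin d) (b t : ℝ) (i' : ι) (j' : Fin d) :
    pderiv i' j' (fun x => (expWeight i j b t x : ℂ)) = fun x =>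
      if (i', j') = (i, j) then (b : ℂ) * expWeight i j b t x else 0 := by
  funext x
  have h1 : HasFDerivAt (fun x : Config d ι => x i j)
      ((ContinuousLinearMap.proj (R := ℝ) j).comp
        (ContinuousLinearMap.proj (R := ℝ) (φ := fun _ : ι => Fin d → ℝ) i)) x :=
    ((ContinuousLinearMap.proj (R := ℝ) j).comp
        (ContinuousLinearMap.proj (R := ℝ) (φ := fun _ : ι => Fin d → ℝ) i)).hasFDerivAt
  have h2 := Complex.ofRealCLM.hasFDerivAt.comp x ((h1.sub_const t).const_mul b).exp
  have h3 := congrArg (fun L => L (Pi.single i' (Pi.single j' 1))) h2.fderiv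
  refine h3.trans ?_
  by_cases hi : i' = i
  · subst hi
    by_cases hj : j' = j
    · subst hj
      simp [expWeight, mul_comm]
    · simp [hj, Ne.symm hj]
  · simp [hi, Ne.symm hi]

/-- The weighted energy estimate below the spectrum (Combes–Thomas). -/
theorem norm_expWeight_le (hΛ : MeasurableSet Λ) (hb : Bornology.IsBounded Λ) (hW : IsBddPot Λ W)
    {ψ η : L2 Λ} {E κ b : ℝ} (hE : E ≤ -κ) (hκ : b ^ 2 ≤ κ) (t : ℝ) (i : ι) (j : Fin d)
    (h : HamGraph Λ W ψ (η + (E : ℂ) • ψ)) :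
    κ / 2 * ‖mulOp (expWeight_memLp hb hΛ i j b t) ψ‖ ≤
      ‖mulOp (expWeight_memLp hb hΛ i j b t) η‖ := by
  set M := mulOp (expWeight_memLp hb hΛ i j b t) with hM
  -- The equation is tested with the squared weight times `ψ`, approximated by the squared weight
  -- times test functions; differentiating the square produces the factor `2 * b`.
  have hw2 := expWeight_memLp hb hΛ i j (2 * b) t
  set M₂ := mulOp hw2 with hM₂
  have hM₂M : ∀ f g : L2 Λ, inner ℂ (M₂ f) g = inner ℂ (M f) (M g) :=
    inner_mulOp_mulOp _ _ (ae_of_all _ fun x => by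
      rw [expWeight, expWeight, ← Real.exp_add]; ring_nf)
  rw [hamGraph_iff_inner hW.memLp] at h
  obtain ⟨g, hg, heq⟩ := h
  obtain ⟨φ, hφ, hφ0, hφ1⟩ := hasH10Grad_iff_seq.1 hg
  have hsm : ContDiff ℝ ∞ (fun x => (expWeight (d := d) i j (2 * b) t x : ℂ)) :=
    Complex.ofRealCLM.contDiff.comp (contDiff_expWeight i j (2 * b) t)
  have hmul : ∀ n, ((hφ n).mul_left hsm).toL2 = M₂ (hφ n).toL2 := fun n => Lp.ext (by
    filter_upwards [((hφ n).mul_left hsm).coeFn_toL2, coeFn_mulOp hw2 (hφ n).toL2,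
      (hφ n).coeFn_toL2] with x h1 h2 h3
    rw [h1, h2, h3])
  have hder : ∀ n i' j', (((hφ n).mul_left hsm).pderiv i' j').toL2 =
      M₂ ((hφ n).pderiv i' j').toL2 +
        (if (i', j') = (i, j) then (2 * b : ℂ) else 0) • M₂ (hφ n).toL2 := by
    intro n i' j'
    refine Lp.ext ?_
    filter_upwards [(((hφ n).mul_left hsm).pderiv i' j').coeFn_toL2,
      coeFn_mulOp hw2 (hφ n).toL2, coeFn_mulOp hw2 ((hφ n).pderiv i' j').toL2,
      (hφ n).coeFn_toL2, ((hφ n).pderiv i' j').coeFn_toL2,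
      Lp.coeFn_add (M₂ ((hφ n).pderiv i' j').toL2)
        ((if (i', j') = (i, j) then (2 * b : ℂ) else 0) • M₂ (hφ n).toL2),
      Lp.coeFn_smul (if (i', j') = (i, j) then (2 * b : ℂ) else 0) (M₂ (hφ n).toL2)]
      with x h1 h2 h3 h4 h5 h6 h7
    rw [h1, h6, Pi.add_apply, h7, Pi.smul_apply, h2, h3, h4, h5, pderiv_mul hsm (hφ n).1,
      pderiv_expWeight]
    split_ifs
    · push_cast
      rw [smul_eq_mul]
      ring
    · simp
  have hlim : (1 / 2 : ℂ) * ∑ i', ∑ j', inner ℂ (M₂ (g i' j') +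
        (if (i', j') = (i, j) then (2 * b : ℂ) else 0) • M₂ ψ) (g i' j')
      + inner ℂ (M₂ ψ) (mulOp hW.memLp ψ) = inner ℂ (M₂ ψ) (η + (E : ℂ) • ψ) := by
    refine tendsto_nhds_unique (f := fun n => (1 / 2 : ℂ) * ∑ i', ∑ j',
      inner ℂ (((hφ n).mul_left hsm).pderiv i' j').toL2 (g i' j')
        + inner ℂ ((hφ n).mul_left hsm).toL2 (mulOp hW.memLp ψ)) (l := atTop) ?_ ?_
    · simp only [hmul, hder]
      refine (tendsto_const_nhds.mul (tendsto_finsetSum _ fun i' _ => tendsto_finsetSum _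
        fun j' _ => Tendsto.inner (Tendsto.add ?_ ?_) tendsto_const_nhds)).add
          (Tendsto.inner ?_ tendsto_const_nhds)
      · exact (M₂.continuous.tendsto _).comp (hφ1 i' j')
      · exact ((M₂.continuous.tendsto _).comp hφ0).const_smul _
      · exact (M₂.continuous.tendsto _).comp hφ0
    · refine Tendsto.congr (fun n => (heq _ ((hφ n).mul_left hsm)).symm) ?_
      simp only [hmul]
      exact Tendsto.inner (𝕜 := ℂ) ((M₂.continuous.tendsto _).comp hφ0) tendsto_const_nhds
  have hsum : ∑ i', ∑ j', inner ℂ (M₂ (g i' j') +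
        (if (i', j') = (i, j) then (2 * b : ℂ) else 0) • M₂ ψ) (g i' j') =
      ∑ i', ∑ j', ((‖M (g i' j')‖ ^ 2 : ℝ) : ℂ) + (2 * b : ℂ) * inner ℂ (M ψ) (M (g i j)) := by
    simp only [inner_add_left, inner_smul_left, hM₂M, inner_self_eq_norm_sq_to_K,
      Finset.sum_add_distrib]
    congr 1
    · norm_cast
    · rw [Finset.sum_eq_single i, Finset.sum_eq_single j]
      · simp [Complex.conj_ofNat]
      · intro j' _ hj'
        simp [hj']
      · simp
      · intro i' _ hi'
        simp [hi']
      · simp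
  rw [hsum] at hlim
  have hMW : inner ℂ (M₂ ψ) (mulOp hW.memLp ψ) = inner ℂ (M ψ) (mulOp hW.memLp (M ψ)) := by
    rw [hM₂M, hM, mulOp_comm]
  rw [hMW, inner_add_right, inner_smul_right, hM₂M, hM₂M, inner_self_eq_norm_sq_to_K] at hlim
  have hre := congrArg Complex.re hlim
  have hWpos := re_inner_mulOp_nonneg hW.memLp hW.nonneg (M ψ)
  have hq : ‖M (g i j)‖ ^ 2 ≤ ∑ i', ∑ j', ‖M (g i' j')‖ ^ 2 :=
    (Finset.single_le_sum (f := fun j' => ‖M (g i j')‖ ^ 2) (fun _ _ => by positivity)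
      (Finset.mem_univ j)).trans
      (Finset.single_le_sum (f := fun i' => ∑ j', ‖M (g i' j')‖ ^ 2)
        (fun _ _ => by positivity) (Finset.mem_univ i))
  have hcs : -(|b| * (‖M ψ‖ * ‖M (g i j)‖)) ≤ b * (inner ℂ (M ψ) (M (g i j))).re := by
    refine le_trans (neg_le_neg ?_) (neg_abs_le _)
    rw [abs_mul]
    gcongr
    exact (Complex.abs_re_le_norm _).trans (norm_inner_le_norm _ _)
  have hcs2 : (inner ℂ (M ψ) (M η)).re ≤ ‖M ψ‖ * ‖M η‖ :=
    (Complex.re_le_norm _).trans (norm_inner_le_norm _ _)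
  have hre' : 1 / 2 * ∑ i', ∑ j', ‖M (g i' j')‖ ^ 2 + b * (inner ℂ (M ψ) (M (g i j))).re
      + (inner ℂ (M ψ) (mulOp hW.memLp (M ψ))).re =
      (inner ℂ (M ψ) (M η)).re + E * ‖M ψ‖ ^ 2 := by
    have e1 : (1 / 2 : ℂ) * (∑ i', ∑ j', ((‖M (g i' j')‖ ^ 2 : ℝ) : ℂ) +
        (2 * b : ℂ) * inner ℂ (M ψ) (M (g i j))) =
        ((1 / 2 * ∑ i', ∑ j', ‖M (g i' j')‖ ^ 2 : ℝ) : ℂ) +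
          (b : ℂ) * inner ℂ (M ψ) (M (g i j)) := by
      push_cast
      ring
    have e2 : (E : ℂ) * (RCLike.ofReal ‖M ψ‖ : ℂ) ^ 2 = ((E * ‖M ψ‖ ^ 2 : ℝ) : ℂ) := by
      push_cast
      rfl
    rw [e1, e2] at hre
    simpa only [Complex.add_re, Complex.ofReal_re, Complex.re_ofReal_mul] using hre
  -- Completing the square, `½ q² - |b| q p ≥ -½ b² p²` with `q = ‖M (g i j)‖` and `p = ‖M ψ‖`. The
  -- remaining coefficient `κ - b²/2` is at least `κ/2`.
  have hfin : κ / 2 * ‖M ψ‖ ^ 2 ≤ ‖M ψ‖ * ‖M η‖ := by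
    nlinarith [sq_nonneg (‖M (g i j)‖ - |b| * ‖M ψ‖), sq_abs b,
      mul_le_mul_of_nonneg_right hE (sq_nonneg ‖M ψ‖),
      mul_le_mul_of_nonneg_right hκ (sq_nonneg ‖M ψ‖)]
  rcases (norm_nonneg (M ψ)).eq_or_lt with h0 | h0
  · rw [← h0, mul_zero]
    exact norm_nonneg _
  · refine le_of_mul_le_mul_left ?_ h0
    calc ‖M ψ‖ * (κ / 2 * ‖M ψ‖) = κ / 2 * ‖M ψ‖ ^ 2 := by ring
      _ ≤ _ := hfin

/-- Exponential decay of the resolvent of the Hamiltonian in a cube, below the spectrum. -/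
theorem norm_indicatorOp_cubeOut_le {u : LatConfig d ι} {L : ℕ} {R : ℝ} (hR : 0 ≤ R)
    {S : Set (Config d ι)} (hS : MeasurableSet S) (hSR : ∀ x ∈ S, R < ‖x - latEmb u‖)
    (hW : IsBddPot (cube u L) W) {ψ h : L2 (cube u L)} {E c : ℝ} (hc : 0 < c)
    (hE : E ≤ -c ^ 2)
    (hψ : HamGraph (cube u L) W ψ (indicatorOp _ (cell u) (measurableSet_cell u) h + (E : ℂ) • ψ)) :
    ‖indicatorOp _ S hS ψ‖ ≤
      (Fintype.card ι * d) * 2 * (2 / c ^ 2 * Real.exp (c * (1 / 2 - R))) * ‖h‖ := by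
  have hΛ := (isOpen_cube u L).measurableSet
  have hb : Bornology.IsBounded (cube u L) :=
    (Metric.isBounded_ball (x := latEmb u) (r := (L : ℝ) + 1 / 2)).subset fun x hx => by
      rwa [Metric.mem_ball, dist_eq_norm]
  -- The max-norm exceeds `R` exactly when some signed coordinate does. Each of the `2nd`
  -- half-spaces gets its own smooth weight, at least `exp (c * R)` there and at most `exp (c / 2)`
  -- on the cell.
  set s : Bool → ℝ := fun o => cond o 1 (-1) with hs
  set T : (ι × Fin d) × Bool → Set (Config d ι) := fun p =>
    {x | R < s p.2 * (x p.1.1 p.1.2 - latEmb u p.1.1 p.1.2)} with hT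
  have hTm : ∀ p, MeasurableSet (T p) := fun p =>
    (isOpen_lt continuous_const (by fun_prop)).measurableSet
  have hcov : ∀ x ∈ S, ∃ p, x ∈ T p := by
    intro x hx
    have h1 := hSR x hx
    by_contra! hcon
    refine h1.not_ge ?_
    rw [pi_norm_le_iff_of_nonneg hR]
    intro i
    rw [pi_norm_le_iff_of_nonneg hR]
    intro j
    rw [Real.norm_eq_abs, abs_le]
    have a1 := hcon ((i, j), true)
    have a2 := hcon ((i, j), false)
    simp only [hT, hs, mem_ofPred_eq, not_lt, cond_true, cond_false] at a1 a2
    constructor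
    · simp only [Pi.sub_apply]; linarith
    · simp only [Pi.sub_apply]; linarith
  have hterm : ∀ p, ‖indicatorOp (volume.restrict (cube u L)) (T p) (hTm p) ψ‖ ≤
      2 / c ^ 2 * Real.exp (c * (1 / 2 - R)) * ‖h‖ := by
    rintro ⟨⟨i, j⟩, o⟩
    have hss : s o ^ 2 = 1 := by cases o <;> simp [hs]
    have habs : |s o| = 1 := by cases o <;> simp [hs]
    set t := latEmb u i j
    have hM := expWeight_memLp hb hΛ i j (c * s o) t
    have h1 := norm_expWeight_le hΛ hb hW hE (b := c * s o) (by rw [mul_pow, hss, mul_one]) t i j hψ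
    have h2 : Real.exp (c * R) * ‖indicatorOp (volume.restrict (cube u L)) _ (hTm ((i, j), o)) ψ‖ ≤
        ‖mulOp hM ψ‖ := by
      rw [← Real.norm_of_nonneg (Real.exp_pos (c * R)).le, ← Complex.norm_real, ← norm_smul]
      refine Lp.norm_le_norm_of_ae_le ?_
      filter_upwards [coeFn_mulOp hM ψ, Lp.coeFn_smul ((Real.exp (c * R) : ℝ) : ℂ)
        (indicatorOp (volume.restrict (cube u L)) _ (hTm ((i, j), o)) ψ),
        coeFn_indicatorOp (hTm ((i, j), o)) ψ] with x e1 e2 e3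
      rw [e1, e2, Pi.smul_apply, e3]
      by_cases hx : x ∈ T ((i, j), o)
      · rw [indicator_of_mem hx, norm_smul, norm_mul, Complex.norm_real, Complex.norm_real,
          Real.norm_of_nonneg (Real.exp_pos _).le, expWeight,
          Real.norm_of_nonneg (Real.exp_pos _).le]
        refine mul_le_mul_of_nonneg_right (Real.exp_le_exp.2 ?_) (norm_nonneg _)
        rw [mul_assoc]
        exact mul_le_mul_of_nonneg_left (le_of_lt hx) hc.le
      · rw [indicator_of_notMem hx, smul_zero, norm_zero]
        exact norm_nonneg _
    have h3 : ‖mulOp hM (indicatorOp (volume.restrict (cube u L)) (cell u)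
        (measurableSet_cell u) h)‖ ≤ Real.exp (c * (1 / 2)) * ‖h‖ := by
      refine Lp.norm_le_mul_norm_of_ae_le_mul ?_
      filter_upwards [coeFn_mulOp hM (indicatorOp (volume.restrict (cube u L)) (cell u)
        (measurableSet_cell u) h), coeFn_indicatorOp (measurableSet_cell u) h] with x e1 e2
      rw [e1, e2]
      by_cases hx : x ∈ cell u
      · rw [indicator_of_mem hx, norm_mul, Complex.norm_real, expWeight,
          Real.norm_of_nonneg (Real.exp_pos _).le]
        refine mul_le_mul_of_nonneg_right (Real.exp_le_exp.2 ?_) (norm_nonneg _)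
        rw [mul_assoc]
        refine mul_le_mul_of_nonneg_left ((le_abs_self _).trans ?_) hc.le
        rw [abs_mul, habs, one_mul]
        have := (norm_le_pi_norm ((x - latEmb u) i) j).trans
          ((norm_le_pi_norm (x - latEmb u) i).trans hx)
        simpa using this
      · rw [indicator_of_notMem hx, mul_zero, norm_zero]
        positivity
    have hexp : Real.exp (c * (1 / 2 - R)) * Real.exp (c * R) = Real.exp (c * (1 / 2)) := by
      rw [← Real.exp_add]; ring_nf
    have h4 : c ^ 2 / 2 * (Real.exp (c * R) *
        ‖indicatorOp (volume.restrict (cube u L)) _ (hTm ((i, j), o)) ψ‖) ≤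
        Real.exp (c * (1 / 2)) * ‖h‖ :=
      (mul_le_mul_of_nonneg_left h2 (by positivity)).trans (h1.trans h3)
    have hpos : 0 < c ^ 2 / 2 * Real.exp (c * R) := by positivity
    refine le_of_mul_le_mul_left ?_ hpos
    calc _ = c ^ 2 / 2 * (Real.exp (c * R) *
          ‖indicatorOp (volume.restrict (cube u L)) _ (hTm ((i, j), o)) ψ‖) := by ring
      _ ≤ Real.exp (c * (1 / 2)) * ‖h‖ := h4
      _ = _ := by
        rw [← hexp]
        field_simp
  refine (norm_indicatorOp_le_sum hS hTm (ae_of_all _ hcov) ψ).trans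
    ((Finset.sum_le_sum fun p _ => hterm p).trans_eq ?_)
  rw [Finset.sum_const, nsmul_eq_mul, Finset.card_univ, Fintype.card_prod, Fintype.card_prod,
    Fintype.card_fin, Fintype.card_bool]
  push_cast
  ring

end

section

/-! ### Bounded perturbations of Hamiltonians -/

variable {d : ℕ} {ι ι₁ ι₂ : Type} [Fintype ι] [Fintype ι₁] [Fintype ι₂]

section Perturbation

variable {Λ : Set (Config d ι)} [LinearOrder ι] {W W₀ U : Config d ι → ℝ}

lemma hamGraph_add_iff (hW : IsBddPot Λ W) (hW₀ : IsBddPot Λ W₀)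
    (hU : MemLp (fun x => (U x : ℂ)) ∞ (volume.restrict Λ)) (h : ∀ x, W x = W₀ x + U x)
    {ψ η : L2 Λ} : HamGraph Λ W ψ η ↔ HamGraph Λ W₀ ψ (η - mulOp hU ψ) := by
  have hsum : mulOp hW.memLp ψ = mulOp hW₀.memLp ψ + mulOp hU ψ := by
    refine Lp.ext ?_
    filter_upwards [coeFn_mulOp hW.memLp ψ, coeFn_mulOp hW₀.memLp ψ, coeFn_mulOp hU ψ,
      Lp.coeFn_add (mulOp hW₀.memLp ψ) (mulOp hU ψ)] with x h1 h2 h3 h4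
    rw [h1, h4, Pi.add_apply, h2, h3, h x]
    push_cast
    ring
  rw [hamGraph_iff_inner hW.memLp, hamGraph_iff_inner hW₀.memLp]
  refine exists_congr fun g => and_congr_right fun _ => forall_congr' fun φ => forall_congr' fun hφ => ?_
  rw [hsum, inner_add_right, inner_sub_right, ← add_assoc, eq_sub_iff_add_eq]

/-- Resolvents of Hamiltonians that differ by a small bounded potential. -/
lemma exists_perturbed_solution (hW : IsBddPot Λ W) (hW₀ : IsBddPot Λ W₀)
    (hU : MemLp (fun x => (U x : ℂ)) ∞ (volume.restrict Λ)) (h : ∀ x, W x = W₀ x + U x)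
    {E ρ ε : ℝ} {G : L2 Λ →L[ℂ] L2 Λ} (hG : IsResolvent Λ W E G) (hρ : 0 < ρ) (hε : 0 ≤ ε)
    (hερ : ε ≤ ρ / 2) (hGρ : ∀ η, ρ * ‖G η‖ ≤ ‖η‖) (hUε : ∀ᵐ x ∂volume.restrict Λ, |U x| ≤ ε)
    (η : L2 Λ) :
    ∃ f, HamGraph Λ W₀ f (η + (E : ℂ) • f) ∧ ‖G η - f‖ ≤ 2 * ε / ρ ^ 2 * ‖η‖ := by
  have hUn : ∀ f, ‖mulOp hU f‖ ≤ ε * ‖f‖ := norm_mulOp_apply_le hU (by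
    filter_upwards [hUε] with x hx
    rwa [Complex.norm_real])
  have hGU : ‖G.comp (mulOp hU)‖ ≤ 1 / 2 := by
    refine ContinuousLinearMap.opNorm_le_bound _ (by norm_num) fun f => ?_
    refine le_of_mul_le_mul_left ?_ hρ
    calc ρ * ‖G (mulOp hU f)‖ ≤ ‖mulOp hU f‖ := hGρ _
      _ ≤ ε * ‖f‖ := hUn f
      _ ≤ ρ / 2 * ‖f‖ := by gcongr
      _ = ρ * (1 / 2 * ‖f‖) := by ring
  set T := Units.oneSub (G.comp (mulOp hU)) (hGU.trans_lt (by norm_num)) with hT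
  -- `f = (1 - G U)⁻¹ G η` satisfies `f = G (η + U f)`, so it solves the unperturbed equation.
  -- Invertibility of `H₀ - E` is never needed.
  set f : L2 Λ := (↑T⁻¹ : L2 Λ →L[ℂ] L2 Λ) (G η) with hf
  have hTf : f - G (mulOp hU f) = G η := by
    have h1 : ((T : L2 Λ →L[ℂ] L2 Λ) * (↑T⁻¹ : L2 Λ →L[ℂ] L2 Λ)) (G η) = G η := by
      rw [Units.mul_inv]; rfl
    exact h1
  have hfG : f = G (η + mulOp hU f) := by
    rw [map_add, ← hTf, sub_add_cancel]
  refine ⟨f, ?_, ?_⟩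
  · have h2 := (hG f (η + mulOp hU f)).2 hfG
    rw [hamGraph_add_iff hW hW₀ hU h] at h2
    convert h2 using 1
    abel
  -- From `ρ ‖f‖ ≤ ‖η‖ + (ρ/2) ‖f‖`. The error `G η - f = -G U f` then costs one more factor `ε/ρ`.
  · have hfn : ρ / 2 * ‖f‖ ≤ ‖η‖ := by
      have h3 := hGρ (η + mulOp hU f)
      rw [← hfG] at h3
      have h4 : ‖η + mulOp hU f‖ ≤ ‖η‖ + ρ / 2 * ‖f‖ :=
        (norm_add_le _ _).trans (add_le_add_right ((hUn f).trans (by gcongr)) _)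
      linarith
    rw [← hTf, sub_sub_cancel_left, norm_neg]
    have h5 : ρ * ‖G (mulOp hU f)‖ ≤ ε * ‖f‖ := (hGρ _).trans (hUn f)
    have h6 : ρ ^ 2 * ‖G (mulOp hU f)‖ ≤ 2 * ε * ‖η‖ := by
      nlinarith [mul_le_mul_of_nonneg_left h5 hρ.le, mul_le_mul_of_nonneg_left hfn hε]
    rw [div_mul_eq_mul_div, le_div_iff₀ (by positivity)]
    linarith

end Perturbation

/-! ### Products of cubes -/

section Geometry

lemma isBounded_cube (u : LatConfig d ι) (L : ℕ) : Bornology.IsBounded (cube u L) :=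
  (Metric.isBounded_ball (x := latEmb u) (r := (L : ℝ) + 1 / 2)).subset fun x hx => by
    rwa [Metric.mem_ball, dist_eq_norm]

lemma volume_cube_ne_top (u : LatConfig d ι) (L : ℕ) : volume (cube u L) ≠ ⊤ :=
  (isBounded_cube u L).measure_lt_top.ne

lemma lt_norm_of_mem_cubeOut {u : LatConfig d ι} {L : ℕ} {x : Config d ι} (hx : x ∈ cubeOut u L) :
    (L : ℝ) - 1 / 2 < ‖x - latEmb u‖ := by
  obtain ⟨y, hy, hxy⟩ := Metric.mem_thickening_iff.1 hx.2
  have hball : cube u L = Metric.ball (latEmb u) ((L : ℝ) + 1 / 2) := by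
    ext z; rw [Metric.mem_ball, dist_eq_norm]; rfl
  rw [hball] at hy
  have h1 : dist y (latEmb u) = (L : ℝ) + 1 / 2 := Metric.frontier_ball_subset_sphere hy
  have h2 := dist_triangle y x (latEmb u)
  rw [dist_comm y x] at h2
  rw [← dist_eq_norm]
  linarith

/-- The radial projection of `x` onto the boundary is at distance `L + 1/2 - ‖x - u‖ < 1`. The
condition `1 ≤ L` keeps `x` away from the centre, where this projection is undefined. -/
lemma mem_cubeOut {u : LatConfig d ι} {L : ℕ} (hL : 1 ≤ L) {x : Config d ι} (hx : x ∈ cube u L)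
    (h : (L : ℝ) - 1 / 2 < ‖x - latEmb u‖) : x ∈ cubeOut u L := by
  refine ⟨hx, Metric.mem_thickening_iff.2 ?_⟩
  have hL' : (1 : ℝ) ≤ L := by exact_mod_cast hL
  have hball : cube u L = Metric.ball (latEmb u) ((L : ℝ) + 1 / 2) := by
    ext z; rw [Metric.mem_ball, dist_eq_norm]; rfl
  have hpos : 0 < ‖x - latEmb u‖ := by linarith
  have hx' : ‖x - latEmb u‖ < (L : ℝ) + 1 / 2 := hx
  set t : ℝ := ((L : ℝ) + 1 / 2) / ‖x - latEmb u‖ with ht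
  refine ⟨latEmb u + t • (x - latEmb u), ?_, ?_⟩
  · rw [hball, frontier_ball _ (by positivity), Metric.mem_sphere, dist_eq_norm,
      add_sub_cancel_left, norm_smul, Real.norm_of_nonneg (by positivity), ht, div_mul_cancel₀ _ hpos.ne']
  · have e : x - (latEmb u + t • (x - latEmb u)) = (1 - t) • (x - latEmb u) := by
      rw [sub_smul, one_smul]; abel
    have ht1 : 1 ≤ t := by rw [ht, le_div_iff₀ hpos]; linarith
    rw [dist_eq_norm, e, norm_smul, Real.norm_of_nonpos (by linarith), neg_sub, sub_mul, one_mul,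
      ht, div_mul_cancel₀ _ hpos.ne']
    linarith

variable (σ : ι₁ ⊕ ι₂ ≃ ι) (u : LatConfig d ι)

/-- The part of a lattice configuration formed by the first group of particles. -/
def fstLat : LatConfig d ι₁ := fun i => u (σ (Sum.inl i))

/-- The part of a lattice configuration formed by the second group of particles. -/
def sndLat : LatConfig d ι₂ := fun i => u (σ (Sum.inr i))

lemma norm_eq_max (z : Config d ι) : ‖z‖ = max ‖fstConfig σ z‖ ‖sndConfig σ z‖ := by
  refine le_antisymm ?_ (max_le ?_ ?_)
  · refine (pi_norm_le_iff_of_nonneg (le_max_of_le_left (norm_nonneg _))).2 fun i => ?_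
    obtain ⟨k | k, rfl⟩ := σ.surjective i
    · exact (norm_le_pi_norm (fstConfig σ z) k).trans (le_max_left _ _)
    · exact (norm_le_pi_norm (sndConfig σ z) k).trans (le_max_right _ _)
  · exact (pi_norm_le_iff_of_nonneg (norm_nonneg _)).2 fun i => norm_le_pi_norm z _
  · exact (pi_norm_le_iff_of_nonneg (norm_nonneg _)).2 fun i => norm_le_pi_norm z _

lemma norm_sub_latEmb (z : Config d ι) : ‖z - latEmb u‖ =
    max ‖fstConfig σ z - latEmb (fstLat σ u)‖ ‖sndConfig σ z - latEmb (sndLat σ u)‖ := by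
  rw [norm_eq_max σ, map_sub, map_sub]
  rfl

lemma isProdSet_cube (L : ℕ) :
    IsProdSet σ (cube u L) (cube (fstLat σ u) L) (cube (sndLat σ u) L) where
  measurableSet_fst := (isOpen_cube _ _).measurableSet
  measurableSet_snd := (isOpen_cube _ _).measurableSet
  mem_iff z := by
    rw [cube, cube, cube, mem_ofPred_eq, mem_ofPred_eq, mem_ofPred_eq, norm_sub_latEmb σ u,
      max_lt_iff]

lemma cell_eq : cell u =
    sndConfig σ ⁻¹' cell (sndLat σ u) ∩ fstConfig σ ⁻¹' cell (fstLat σ u) := by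
  ext z
  rw [cell, mem_ofPred_eq, norm_sub_latEmb σ u, max_le_iff, and_comm]
  rfl

/-- The max-norm is the larger of the norms of the two parts, so in the layer one of them exceeds `L
- 1/2`. -/
lemma cubeOut_subset {L : ℕ} (hL : 1 ≤ L) {z : Config d ι} (hz : z ∈ cubeOut u L) :
    fstConfig σ z ∈ cubeOut (fstLat σ u) L ∨ sndConfig σ z ∈ cubeOut (sndLat σ u) L := by
  have h1 := lt_norm_of_mem_cubeOut hz
  have h2 := ((isProdSet_cube σ u L).mem_iff z).1 hz.1
  rw [norm_sub_latEmb σ u, lt_max_iff] at h1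
  exact h1.imp (mem_cubeOut hL h2.1) (mem_cubeOut hL h2.2)

end Geometry

/-! ### Decay of the resolvent of two weakly coupled groups of particles -/

lemma indicatorOp_congr {X : Type} [MeasurableSpace X] {μ : Measure X} {S T : Set X}
    (hS : MeasurableSet S) (hT : MeasurableSet T) (h : S = T) :
    indicatorOp μ S hS = indicatorOp μ T hT := by
  subst h; rfl

lemma norm_indicatorOp_le_add {X : Type} [MeasurableSpace X] {μ : Measure X} {S T₁ T₂ : Set X}
    (hS : MeasurableSet S) (hT₁ : MeasurableSet T₁) (hT₂ : MeasurableSet T₂)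
    (h : ∀ x ∈ S, x ∈ T₁ ∨ x ∈ T₂) (f : Lp ℂ 2 μ) :
    ‖indicatorOp μ S hS f‖ ≤ ‖indicatorOp μ T₁ hT₁ f‖ + ‖indicatorOp μ T₂ hT₂ f‖ := by
  have := norm_indicatorOp_le_sum hS (T := fun o : Bool => cond o T₁ T₂)
    (fun o => by cases o <;> assumption) (ae_of_all _ fun x hx => (h x hx).elim
      (fun h => ⟨true, h⟩) (fun h => ⟨false, h⟩)) f
  simpa using this

variable [LinearOrder ι] [LinearOrder ι₁] [LinearOrder ι₂] {W U : Config d ι → ℝ}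
  {W₁ : Config d ι₁ → ℝ} {W₂ : Config d ι₂ → ℝ}

/-- The solutions `g` of `(H - E) g = χ h` are bounded by `s ‖h‖` near the boundary of the cube. -/
def HasDecay (W : Config d ι → ℝ) (u : LatConfig d ι) (L : ℕ) (E s : ℝ) : Prop :=
  ∀ g h : L2 (cube u L),
    HamGraph (cube u L) W g (indicatorOp _ (cell u) (measurableSet_cell u) h + (E : ℂ) • g) →
      ‖indicatorOp _ (cubeOut u L) (measurableSet_cubeOut u L) g‖ ≤ s * ‖h‖

/-- The functional-analytic core: `2 * s` comes from the layers of the two factors for the decoupled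
problem, and `2 * ε / ρ ^ 2` from removing the coupling `U`. -/
theorem norm_out_resolvent_cell_le (σ : ι₁ ⊕ ι₂ ≃ ι) (u : LatConfig d ι) {L : ℕ} (hL : 1 ≤ L)
    (hW : IsBddPot (cube u L) W) (hW₁ : IsBddPot (cube (fstLat σ u) L) W₁)
    (hW₂ : IsBddPot (cube (sndLat σ u) L) W₂)
    (hW₀ : IsBddPot (cube u L) fun z => W₁ (fstConfig σ z) + W₂ (sndConfig σ z))
    (hU : MemLp (fun x => (U x : ℂ)) ∞ (volume.restrict (cube u L)))
    (hadd : ∀ z, W z = W₁ (fstConfig σ z) + W₂ (sndConfig σ z) + U z)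
    {E ρ ε s : ℝ} (hρ : 0 < ρ) (hε : 0 ≤ ε) (hερ : ε ≤ ρ / 2) (hs : 0 ≤ s)
    (hUε : ∀ x ∈ cube u L, |U x| ≤ ε) (hE : ∀ lam ∈ hamSpectrum (cube u L) W, ρ ≤ |lam - E|)
    (hdecay₂ : ∀ lam ∈ hamSpectrum (cube (fstLat σ u) L) W₁, 0 ≤ lam →
      HasDecay W₂ (sndLat σ u) L (E - lam) s)
    (hdecay₁ : ∀ lam ∈ hamSpectrum (cube (sndLat σ u) L) W₂, 0 ≤ lam →
      HasDecay W₁ (fstLat σ u) L (E - lam) s) :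
    ∃ G : L2 (cube u L) →L[ℂ] L2 (cube u L), IsResolvent (cube u L) W E G ∧
      ‖(indicatorOp (volume.restrict (cube u L)) (cubeOut u L) (measurableSet_cubeOut u L)).comp
        (G.comp (indicatorOp (volume.restrict (cube u L)) (cell u) (measurableSet_cell u)))‖
      ≤ 2 * s + 2 * ε / ρ ^ 2 := by
  have hEspec : E ∉ hamSpectrum (cube u L) W := fun h => by
    have := hE E h
    rw [sub_self, abs_zero] at this
    exact absurd hρ this.not_gt
  obtain ⟨G, hG⟩ := not_not.1 hEspec
  obtain ⟨κ, e, lam, D⟩ := exists_hamDiag (isOpen_cube u L) (isBounded_cube u L) hW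
  obtain ⟨κ₀, e₀, lam₀, D₀⟩ := exists_hamDiag (isOpen_cube u L) (isBounded_cube u L) hW₀
  obtain ⟨κ₁, e₁, lam₁, D₁⟩ := exists_hamDiag (isOpen_cube _ L) (isBounded_cube _ L) hW₁
  obtain ⟨κ₂, e₂, lam₂, D₂⟩ := exists_hamDiag (isOpen_cube _ L) (isBounded_cube _ L) hW₂
  refine ⟨G, hG, ContinuousLinearMap.opNorm_le_bound _ (by positivity) fun η => ?_⟩
  have hGρ : ∀ η, ρ * ‖G η‖ ≤ ‖η‖ := fun η =>
    D.norm_le hρ (fun k => hE _ (D.mem_hamSpectrum k)) ((hG _ _).2 rfl)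
  set χη := indicatorOp (volume.restrict (cube u L)) (cell u) (measurableSet_cell u) η with hχη
  have hχle : ‖χη‖ ≤ ‖η‖ := norm_indicatorOp_le _ _
  obtain ⟨f, hf, hGf⟩ := exists_perturbed_solution hW hW₀ hU hadd hG hρ hε hερ hGρ
    ((ae_restrict_mem (isOpen_cube u L).measurableSet).mono hUε) χη
  have hps := isProdSet_cube σ u L
  have h₂ : ‖indicatorOp (volume.restrict (cube u L)) (sndConfig σ ⁻¹' cubeOut (sndLat σ u) L)
      ((sndConfig σ).measurable (measurableSet_cubeOut _ _)) f‖ ≤ s * ‖η‖ := by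
    rw [hχη, indicatorOp_congr _ (((sndConfig σ).measurable (measurableSet_cell _)).inter
      ((fstConfig σ).measurable (measurableSet_cell _))) (cell_eq σ u)] at hf
    have := norm_indicatorOp_snd_le hps hW₀ hW₁ hW₂ (fun _ => rfl) D₀ D₁ D₂
      (volume_cube_ne_top _ _) (volume_cube_ne_top _ _) (measurableSet_cubeOut _ _)
      (measurableSet_cell _) (measurableSet_cell _)
      (fun k => hdecay₂ _ (D₁.mem_hamSpectrum k) (D₁.nonneg k)) hf
    rwa [abs_of_nonneg hs] at this
  have h₁ : ‖indicatorOp (volume.restrict (cube u L)) (fstConfig σ ⁻¹' cubeOut (fstLat σ u) L)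
      ((fstConfig σ).measurable (measurableSet_cubeOut _ _)) f‖ ≤ s * ‖η‖ := by
    rw [hχη, indicatorOp_congr _ (((fstConfig σ).measurable (measurableSet_cell _)).inter
      ((sndConfig σ).measurable (measurableSet_cell _)))
      ((cell_eq σ u).trans (inter_comm _ _))] at hf
    have := norm_indicatorOp_snd_le hps.swap hW₀ hW₂ hW₁ (fun _ => add_comm _ _) D₀ D₂ D₁
      (volume_cube_ne_top _ _) (volume_cube_ne_top _ _) (measurableSet_cubeOut _ _)
      (measurableSet_cell _) (measurableSet_cell _)
      (fun k => hdecay₁ _ (D₂.mem_hamSpectrum k) (D₂.nonneg k)) hf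
    rwa [abs_of_nonneg hs] at this
  calc ‖indicatorOp _ (cubeOut u L) (measurableSet_cubeOut u L) (G χη)‖
      = ‖indicatorOp _ (cubeOut u L) (measurableSet_cubeOut u L) f +
          indicatorOp _ (cubeOut u L) (measurableSet_cubeOut u L) (G χη - f)‖ := by
        rw [← map_add, add_sub_cancel]
    _ ≤ (s * ‖η‖ + s * ‖η‖) + 2 * ε / ρ ^ 2 * ‖η‖ := by
        refine (norm_add_le _ _).trans (add_le_add ?_ ?_)
        · exact (norm_indicatorOp_le_add _ _ _ (fun z hz => cubeOut_subset σ u hL hz) f).trans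
            (add_le_add h₁ h₂)
        · refine (norm_indicatorOp_le _ _).trans (hGf.trans ?_)
          gcongr
    _ = (2 * s + 2 * ε / ρ ^ 2) * ‖η‖ := by ring

/-- Decay from non-singularity at the energies `E - lam` with `lam ≤ E*`, and from the
Combes–Thomas estimate at the energies `E - lam` with `lam > E*`. -/
lemma hasDecay_sub {u : LatConfig d ι} {L : ℕ} (hL : 1 ≤ L) (hW : IsBddPot (cube u L) W)
    {C E Estar lam δ m c : ℝ} (hC : 0 < C) (hc : 0 < c) (hcE : c ^ 2 ≤ Estar - E) (hlam : 0 ≤ lam)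
    (hNS : lam ∈ Icc 0 Estar → IsNS C W u L (E - lam) δ m) :
    HasDecay W u L (E - lam) (Real.exp (-m * (L : ℝ) ^ δ) /
        (C * (3 * (L : ℝ)) ^ (Fintype.card ι * d)) +
      (Fintype.card ι * d) * 2 * (2 / c ^ 2 * Real.exp (c * (1 - L)))) := by
  have hL' : (1 : ℝ) ≤ L := by exact_mod_cast hL
  intro g h hg
  rcases le_or_gt lam Estar with hle | hlt
  · obtain ⟨G, hG, hGn⟩ := hNS ⟨hlam, hle⟩
    rw [(hG _ _).1 hg]
    rw [mul_comm, ← le_div_iff₀ (by positivity)] at hGn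
    refine (ContinuousLinearMap.le_opNorm ((indicatorOp (volume.restrict (cube u L)) (cubeOut u L)
      (measurableSet_cubeOut u L)).comp (G.comp (indicatorOp (volume.restrict (cube u L)) (cell u)
        (measurableSet_cell u)))) h).trans ?_
    gcongr
    exact hGn.trans (le_add_of_nonneg_right (by positivity))
  -- Here `E - lam < E - Estar ≤ -c ^ 2`. The layer starts at radius `L - 1/2` and the cell ends at
  -- `1/2`, hence the exponent `c * (1 - L)`.
  · refine (norm_indicatorOp_cubeOut_le (R := L - 1 / 2) (by linarith) (measurableSet_cubeOut u L)
      (fun x hx => lt_norm_of_mem_cubeOut hx) hW hc (by linarith) hg).trans ?_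
    have e : c * (1 / 2 - ((L : ℝ) - 1 / 2)) = c * (1 - L) := by ring
    rw [e]
    gcongr
    exact le_add_of_nonneg_left (by positivity)

end

section

/-! ### The potential energy -/

variable {d : ℕ} {ζ CU r₁ Cφ cV : ℝ} {U₂ : ℝ → ℝ} {φ : (Fin d → ℤ) → (Fin d → ℝ) → ℝ}
  {v : (Fin d → ℤ) → ℝ}

lemma IsTwoBody.const_nonneg (hU : IsTwoBody ζ CU U₂) : 0 ≤ CU :=
  nonneg_of_mul_nonneg_left ((hU.nonneg 0 le_rfl).trans (hU.decay 0 le_rfl)) (Real.exp_pos _)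

lemma IsTwoBody.le_const (hU : IsTwoBody ζ CU U₂) {r : ℝ} (hr : 0 ≤ r) : U₂ r ≤ CU :=
  (hU.decay r hr).trans (mul_le_of_le_one_right hU.const_nonneg
    (Real.exp_le_one_iff.2 (neg_nonpos.2 (Real.rpow_nonneg hr ζ))))

lemma alloy_nonneg (hφ : IsFlatTiling r₁ Cφ φ) (hv : ∀ a, v a ∈ Icc 0 cV) (x : Fin d → ℝ) :
    0 ≤ alloy φ v x :=
  tsum_nonneg fun a => mul_nonneg (hv a).1 (hφ.nonneg a _)

/-- The tiling identity bounds the potential by that with all amplitudes equal to `cV`. It holds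
only almost everywhere, which is why bounded potentials are defined that way. -/
lemma alloy_le (hφ : IsFlatTiling r₁ Cφ φ) (hv : ∀ a, v a ∈ Icc 0 cV) :
    ∀ᵐ x : Fin d → ℝ, alloy φ v x ≤ cV * Cφ := by
  filter_upwards [hφ.tiling] with x hx
  have h2 := hx.mul_left cV
  have hle : ∀ a, v a * φ a (x - siteEmb a) ≤ cV * φ a (x - siteEmb a) := fun a =>
    mul_le_mul_of_nonneg_right (hv a).2 (hφ.nonneg a _)
  exact hasSum_le hle (Summable.of_nonneg_of_le
    (fun a => mul_nonneg (hv a).1 (hφ.nonneg a _)) hle h2.summable).hasSum h2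

lemma measurable_alloy (hφ : IsFlatTiling r₁ Cφ φ) : Measurable (alloy φ v) :=
  Measurable.tsum fun a => ((hφ.measurable a).comp (measurable_id.sub_const _)).const_mul _

/-! ### The interaction within and between groups. -/

section Interaction

variable {ι ι₁ ι₂ : Type} [Fintype ι₁] [Fintype ι₂]

/-- The energy of the interaction between two groups of particles. -/
def crossInteraction (U₂ : ℝ → ℝ) (σ : ι₁ ⊕ ι₂ ≃ ι) (x : Config d ι) : ℝ :=
  ∑ i, ∑ j, U₂ ‖x (σ (Sum.inl i)) - x (σ (Sum.inr j))‖

lemma measurable_crossInteraction (hU : IsTwoBody ζ CU U₂) (σ : ι₁ ⊕ ι₂ ≃ ι) :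
    Measurable (crossInteraction (d := d) U₂ σ) := by
  unfold crossInteraction
  have := hU.measurable
  fun_prop

lemma crossInteraction_nonneg (hU : IsTwoBody ζ CU U₂) (σ : ι₁ ⊕ ι₂ ≃ ι) (x : Config d ι) :
    0 ≤ crossInteraction U₂ σ x :=
  Finset.sum_nonneg fun _ _ => Finset.sum_nonneg fun _ _ => hU.nonneg _ (norm_nonneg _)

lemma crossInteraction_le [Fintype ι] (hU : IsTwoBody ζ CU U₂) (hζ : 0 ≤ ζ) (σ : ι₁ ⊕ ι₂ ≃ ι)
    {R : ℝ}
    (hR : 0 ≤ R) {x : Config d ι} (hx : ∀ i j, R ≤ ‖x (σ (Sum.inl i)) - x (σ (Sum.inr j))‖) :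
    crossInteraction U₂ σ x ≤ (Fintype.card ι : ℝ) ^ 2 * (CU * Real.exp (-R ^ ζ)) := by
  have h1 : crossInteraction U₂ σ x ≤ ∑ _i : ι₁, ∑ _j : ι₂, CU * Real.exp (-R ^ ζ) := by
    refine Finset.sum_le_sum fun i _ => Finset.sum_le_sum fun j _ =>
      (hU.decay _ (norm_nonneg _)).trans ?_
    have := hU.const_nonneg
    gcongr
    exact hx i j
  refine h1.trans ?_
  have hc := hU.const_nonneg
  have hcard : Fintype.card ι = Fintype.card ι₁ + Fintype.card ι₂ := by
    rw [← Fintype.card_sum, Fintype.card_congr σ]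
  simp only [Finset.sum_const, Finset.card_univ, nsmul_eq_mul]
  rw [← mul_assoc, hcard]
  refine mul_le_mul_of_nonneg_right ?_ (by positivity)
  push_cast
  nlinarith [Nat.cast_nonneg (α := ℝ) (Fintype.card ι₁), Nat.cast_nonneg (α := ℝ) (Fintype.card ι₂)]

variable [Fintype ι] [LinearOrder ι] [LinearOrder ι₁] [LinearOrder ι₂]

lemma measurable_interaction (hU : IsTwoBody ζ CU U₂) :
    Measurable (interaction U₂ : Config d ι → ℝ) := by
  unfold interaction
  have := hU.measurable
  fun_prop

lemma interaction_nonneg (hU : IsTwoBody ζ CU U₂) (x : Config d ι) : 0 ≤ interaction U₂ x :=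
  Finset.sum_nonneg fun _ _ => Finset.sum_nonneg fun _ _ => hU.nonneg _ (norm_nonneg _)

lemma interaction_le (hU : IsTwoBody ζ CU U₂) (x : Config d ι) :
    interaction U₂ x ≤ ∑ _i : ι, ∑ _j : ι, CU := by
  refine Finset.sum_le_sum fun i _ => ?_
  refine (Finset.sum_le_sum fun j _ => hU.le_const (norm_nonneg (x i - x j))).trans ?_
  exact Finset.sum_le_sum_of_subset_of_nonneg (Finset.filter_subset _ _)
    fun _ _ _ => hU.const_nonneg

lemma measurable_potential (hU : IsTwoBody ζ CU U₂) (hφ : IsFlatTiling r₁ Cφ φ) :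
    Measurable (potential U₂ φ v : Config d ι → ℝ) :=
  (measurable_interaction hU).add
    (Finset.measurable_fun_sum _ fun i _ => (measurable_alloy hφ).comp (measurable_pi_apply i))

lemma potential_nonneg (hU : IsTwoBody ζ CU U₂) (hφ : IsFlatTiling r₁ Cφ φ)
    (hv : ∀ a, v a ∈ Icc 0 cV) (x : Config d ι) : 0 ≤ potential U₂ φ v x :=
  add_nonneg (interaction_nonneg hU x) (Finset.sum_nonneg fun i _ => alloy_nonneg hφ hv (x i))

lemma isBddPot_potential (hU : IsTwoBody ζ CU U₂) (hφ : IsFlatTiling r₁ Cφ φ)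
    (hv : ∀ a, v a ∈ Icc 0 cV) (Λ : Set (Config d ι)) : IsBddPot Λ (potential U₂ φ v) where
  aemeasurable := (measurable_potential hU hφ).aemeasurable
  nonneg := ae_of_all _ (potential_nonneg hU hφ hv)
  bdd := by
    refine ⟨∑ _i : ι, ∑ _j : ι, CU + ∑ _i : ι, cV * Cφ, ae_restrict_of_ae ?_⟩
    have h : ∀ᵐ x : Config d ι, ∀ i, alloy φ v (x i) ≤ cV * Cφ := ae_all_iff.2 fun i =>
      (Measure.quasiMeasurePreserving_eval (fun _ : ι => (volume : Measure (Fin d → ℝ))) i).ae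
        (alloy_le hφ hv)
    filter_upwards [h] with x hx
    exact add_le_add (interaction_le hU x) (Finset.sum_le_sum fun i _ => hx i)

/-- Each pair is counted once, in increasing order. Monotone labelling preserves this order within
the groups; a mixed pair may come in either order, and symmetry of the distance merges the two
cases. -/
lemma potential_split (σ : ι₁ ⊕ ι₂ ≃ ι) (h₁ : StrictMono fun i => σ (Sum.inl i))
    (h₂ : StrictMono fun i => σ (Sum.inr i)) (z : Config d ι) :
    potential U₂ φ v z = potential U₂ φ v (fstConfig σ z) + potential U₂ φ v (sndConfig σ z)
      + crossInteraction U₂ σ z := by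
  have hint : interaction U₂ z = interaction U₂ (fstConfig σ z) + interaction U₂ (sndConfig σ z)
      + crossInteraction U₂ σ z := by
    have hcross : crossInteraction U₂ σ z =
        ∑ i, ∑ j, (if σ (Sum.inl i) < σ (Sum.inr j) then
          U₂ ‖z (σ (Sum.inl i)) - z (σ (Sum.inr j))‖ else 0) +
        ∑ j, ∑ i, (if σ (Sum.inr j) < σ (Sum.inl i) then
          U₂ ‖z (σ (Sum.inr j)) - z (σ (Sum.inl i))‖ else 0) := by
      rw [Finset.sum_comm (s := (Finset.univ : Finset ι₂)), ← Finset.sum_add_distrib]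
      refine Finset.sum_congr rfl fun i _ => ?_
      rw [← Finset.sum_add_distrib]
      refine Finset.sum_congr rfl fun j _ => ?_
      have hne : σ (Sum.inl i) ≠ σ (Sum.inr j) := fun h => by simpa using σ.injective h
      rcases hne.lt_or_gt with hlt | hlt
      · rw [if_pos hlt, if_neg hlt.le.not_gt, add_zero]
      · rw [if_pos hlt, if_neg hlt.le.not_gt, zero_add, norm_sub_rev]
    rw [hcross]
    simp only [interaction, Finset.sum_filter]
    rw [← σ.sum_comp, Fintype.sum_sum_type]
    simp only [← σ.sum_comp (fun j => if _ < j then _ else _), Fintype.sum_sum_type,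
      Finset.sum_add_distrib, fstConfig_apply, sndConfig_apply, h₁.lt_iff_lt, h₂.lt_iff_lt]
    ring
  rw [potential, potential, potential, hint, ← σ.sum_comp, Fintype.sum_sum_type]
  simp only [fstConfig_apply, sndConfig_apply]
  ring

lemma isBddPot_split (hU : IsTwoBody ζ CU U₂) (hφ : IsFlatTiling r₁ Cφ φ)
    (hv : ∀ a, v a ∈ Icc 0 cV) (σ : ι₁ ⊕ ι₂ ≃ ι) (h₁ : StrictMono fun i => σ (Sum.inl i))
    (h₂ : StrictMono fun i => σ (Sum.inr i)) (Λ : Set (Config d ι)) :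
    IsBddPot Λ fun z =>
      potential U₂ φ v (fstConfig σ z) + potential U₂ φ v (sndConfig σ z) where
  aemeasurable := (((measurable_potential hU hφ).comp (fstConfig σ).measurable).add
    ((measurable_potential hU hφ).comp (sndConfig σ).measurable)).aemeasurable
  nonneg := ae_of_all _ fun z => add_nonneg (potential_nonneg hU hφ hv _)
    (potential_nonneg hU hφ hv _)
  bdd := by
    -- The cross term is non-negative, so a bound for the full potential also bounds the decoupled
    -- one.
    obtain ⟨c, hc⟩ := (isBddPot_potential (ι := ι) hU hφ hv Λ).bdd
    refine ⟨c, ?_⟩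
    filter_upwards [hc] with z hz
    rw [potential_split σ h₁ h₂] at hz
    have := crossInteraction_nonneg hU σ z
    linarith

end Interaction

/-! ### The decomposition of a cube -/

section Decomposition

variable {N : ℕ} (J : Finset (Fin N))

/-- The particles from `J` and from its complement, taken together. -/
def sumCompl : J ⊕ (Jᶜ : Finset (Fin N)) ≃ Fin N :=
  (Equiv.sumCongr (Equiv.refl _) (Equiv.subtypeEquivRight fun _ => Finset.mem_compl)).trans
    (Equiv.sumCompl (· ∈ J))

lemma lt_norm_sub_of_isDecomp {u : LatConfig d (Fin N)} {L : ℕ} {J : Finset (Fin N)}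
    (h : IsDecomp u L J) {z : Config d (Fin N)} (hz : z ∈ cube u L) {i j : Fin N} (hi : i ∈ J)
    (hj : j ∈ Jᶜ) : (L : ℝ) < ‖z i - z j‖ := by
  obtain ⟨h1, h2⟩ := ((isProdSet_cube (sumCompl J) u L).mem_iff z).1 hz
  have h3 := h.2.2.trans_le ((iInf₂_le (z i) ⟨_, h1, ⟨i, hi⟩, rfl⟩).trans
    (iInf₂_le (z j) ⟨_, h2, ⟨j, hj⟩, rfl⟩))
  rw [edist_dist, ← dist_eq_norm] at *
  rw [← ENNReal.ofReal_natCast] at h3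
  exact (ENNReal.ofReal_lt_ofReal_iff_of_nonneg (Nat.cast_nonneg L)).1 h3

end Decomposition

end

section

/-! ### Masses and the initial scale -/

/-- Half of `c * L ^ γ` dominates `M * L ^ δ`; the exponential of the other half beats the
polynomial. -/
lemma eventually_pow_mul_exp_le (Q M : ℝ) (p : ℕ) {c γ δ r : ℝ} (hc : 0 < c) (hγ : 0 < γ)
    (hδ : δ < γ) (hr : 0 < r) : ∀ᶠ L : ℕ in atTop,
      Q * (3 * (L : ℝ)) ^ p * Real.exp (M * (L : ℝ) ^ δ - c * (L : ℝ) ^ γ) ≤ r := by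
  have h1 : ∀ᶠ x : ℝ in atTop, M * x ^ δ ≤ c / 2 * x ^ γ := by
    have h2 := (tendsto_rpow_neg_atTop (sub_pos.2 hδ)).const_mul M
    rw [mul_zero] at h2
    filter_upwards [h2.eventually_le_const (half_pos hc), eventually_gt_atTop 0] with x hx hx0
    have h3 : x ^ δ = x ^ (-(γ - δ)) * x ^ γ := by
      rw [← Real.rpow_add hx0]; ring_nf
    rw [h3, ← mul_assoc]
    exact mul_le_mul_of_nonneg_right hx (Real.rpow_nonneg hx0.le γ)
  have h3 : Tendsto (fun x : ℝ => |Q| * 3 ^ p *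
      ((x ^ γ) ^ ((p : ℝ) / γ) * Real.exp (-(c / 2) * x ^ γ))) atTop (𝓝 0) := by
    have := ((tendsto_rpow_mul_exp_neg_mul_atTop_nhds_zero ((p : ℝ) / γ) (c / 2)
      (half_pos hc)).comp (tendsto_rpow_atTop hγ)).const_mul (|Q| * 3 ^ p)
    rwa [mul_zero] at this
  suffices h : ∀ᶠ x : ℝ in atTop, Q * (3 * x) ^ p * Real.exp (M * x ^ δ - c * x ^ γ) ≤ r from
    tendsto_natCast_atTop_atTop.eventually h
  filter_upwards [h1, h3.eventually_le_const hr, eventually_ge_atTop 0] with x hx1 hx2 hx0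
  refine le_trans ?_ hx2
  rw [← Real.rpow_mul hx0, mul_div_cancel₀ _ hγ.ne', Real.rpow_natCast, mul_pow]
  have h4 : Real.exp (M * x ^ δ - c * x ^ γ) ≤ Real.exp (-(c / 2) * x ^ γ) :=
    Real.exp_le_exp.2 (by linarith)
  calc Q * (3 ^ p * x ^ p) * Real.exp (M * x ^ δ - c * x ^ γ)
      ≤ |Q| * (3 ^ p * x ^ p) * Real.exp (-(c / 2) * x ^ γ) := by
        gcongr
        exact le_abs_self Q
    _ = _ := by ring

variable {mstar β δ : ℝ} {Nstar L₀ : ℕ}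

lemma mass_ge_one (hm : 1 ≤ mstar) (n : ℕ) : 1 ≤ mass mstar β δ Nstar L₀ n :=
  one_le_mul_of_one_le_of_one_le hm (one_le_pow₀ (le_add_of_nonneg_right (by positivity)))

/-- A bound on all masses independent of `L₀`, so that the threshold for the initial scale can be
chosen before `L₀`. -/
lemma mass_le (hm : 1 ≤ mstar) (hβδ : β < δ) (hL₀ : 1 ≤ L₀) (n : ℕ) :
    mass mstar β δ Nstar L₀ n ≤ mstar * 5 ^ Nstar := by
  have h1 : (L₀ : ℝ) ^ (-δ + β) ≤ 1 :=
    Real.rpow_le_one_of_one_le_of_nonpos (by exact_mod_cast hL₀) (by linarith)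
  have h2 : (1 + 4 * (L₀ : ℝ) ^ (-δ + β)) ^ (Nstar - n) ≤ 5 ^ (Nstar - n) :=
    pow_le_pow_left₀ (by positivity) (by linarith) _
  exact mul_le_mul_of_nonneg_left (h2.trans (pow_le_pow_right₀ (by norm_num) (Nat.sub_le _ _)))
    (by linarith)

/-- The gain in the mass under the passage to a smaller number of particles. -/
lemma mass_mul_rpow_add_le (hm : 1 ≤ mstar) (hβδ : β < δ) (hL₀ : 1 ≤ L₀) {L n N : ℕ} (hL : L₀ ≤ L)
    (hn : n < N) (hN : N ≤ Nstar) :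
    mass mstar β δ Nstar L₀ N * (L : ℝ) ^ δ + 4 * (L : ℝ) ^ β ≤
      mass mstar β δ Nstar L₀ n * (L : ℝ) ^ δ := by
  have hL₀' : (0 : ℝ) < L₀ := by exact_mod_cast hL₀
  have hL' : (L₀ : ℝ) ≤ L := by exact_mod_cast hL
  have hLpos : (0 : ℝ) < L := hL₀'.trans_le hL'
  set q := 1 + 4 * (L₀ : ℝ) ^ (-δ + β) with hq
  have hq1 : 1 ≤ q := le_add_of_nonneg_right (by positivity)
  -- Losing at least one particle gains at least one factor `q`. Its excess over `1` is worth `4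
  -- L^β`, since the mass is at least `1` and `L ↦ L^{β-δ}` decreases.
  have h1 : mass mstar β δ Nstar L₀ N * q ≤ mass mstar β δ Nstar L₀ n := by
    rw [mass, mass, mul_assoc, ← pow_succ]
    exact mul_le_mul_of_nonneg_left (pow_le_pow_right₀ hq1 (by omega)) (by linarith)
  have h2 : (L : ℝ) ^ β ≤ (L₀ : ℝ) ^ (-δ + β) * (L : ℝ) ^ δ := by
    have h3 : (L : ℝ) ^ (-δ + β) ≤ (L₀ : ℝ) ^ (-δ + β) :=
      Real.rpow_le_rpow_of_nonpos hL₀' hL' (by linarith)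
    calc (L : ℝ) ^ β = (L : ℝ) ^ (-δ + β) * (L : ℝ) ^ δ := by
          rw [← Real.rpow_add hLpos]; congr 1; ring
      _ ≤ _ := by gcongr
  have h4 := mass_ge_one (β := β) (δ := δ) (Nstar := Nstar) (L₀ := L₀) hm N
  have h5 : (L : ℝ) ^ β ≤
      mass mstar β δ Nstar L₀ N * ((L₀ : ℝ) ^ (-δ + β) * (L : ℝ) ^ δ) :=
    h2.trans (le_mul_of_one_le_left (by positivity) h4)
  calc _ ≤ mass mstar β δ Nstar L₀ N * q * (L : ℝ) ^ δ := by rw [hq]; linarith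
    _ ≤ _ := by gcongr

/-- The scales that are large enough for the decay estimates: `A` and `B` bound the constants of
the geometric resolvent inequality and their inverses, `K` and `c` describe the decay below the
spectrum, and `ε L` bounds the interaction of the groups. -/
structure IsLargeScale (β δ M c A B K : ℝ) (ε : ℝ → ℝ) (p L : ℕ) : Prop where
  one_le : 1 ≤ L
  bound_nonsingular : 2 * A * B * (3 * (L : ℝ)) ^ p * Real.exp (-(4 * (L : ℝ) ^ β)) ≤ 1 / 3
  bound_below : 2 * A * K * (3 * (L : ℝ)) ^ p * Real.exp (M * (L : ℝ) ^ δ - c * L) ≤ 1 / 3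
  bound_interaction :
    2 * A * (3 * (L : ℝ)) ^ p * (Real.exp (M * (L : ℝ) ^ δ + 2 * (L : ℝ) ^ β) * ε L) ≤ 1 / 3
  interaction_le : ε L ≤ Real.exp (-(L : ℝ) ^ β) / 2

lemma eventually_isLargeScale {ζ M c A B K Q : ℝ} {p : ℕ} (hβ : 0 < β) (hβδ : β < δ) (hδ1 : δ < 1)
    (hδζ : δ < ζ) (hc : 0 < c) (hA : 0 ≤ A) (hQ : 0 ≤ Q) :
    ∀ᶠ L : ℕ in atTop,
      IsLargeScale β δ M c A B K (fun x => Q * Real.exp (-x ^ ζ)) p L := by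
  have hδ0 := hβ.trans hβδ
  filter_upwards [eventually_ge_atTop 1,
    -- With `M = 0` the lower exponent plays no role; `β - 1` is just some number below `β`.
    eventually_pow_mul_exp_le (2 * A * B) 0 p four_pos hβ (sub_one_lt β) (r := 1 / 3) (by norm_num),
    eventually_pow_mul_exp_le (2 * A * K) M p hc one_pos hδ1 (r := 1 / 3) (by norm_num),
    eventually_pow_mul_exp_le (2 * A * Q) (M + 2) p one_pos (hδ0.trans hδζ) hδζ (r := 1 / 3)
      (by norm_num),
    eventually_pow_mul_exp_le Q 1 0 one_pos (hδ0.trans hδζ) hδζ (r := 1 / 2) (by norm_num)]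
    with L h1 h2 h3 h4 h5
  have hL : (1 : ℝ) ≤ L := by exact_mod_cast h1
  have hpow : (L : ℝ) ^ β ≤ (L : ℝ) ^ δ := Real.rpow_le_rpow_of_exponent_le hL hβδ.le
  refine ⟨h1, ?_, ?_, ?_, ?_⟩
  · rwa [zero_mul, zero_sub] at h2
  · rwa [Real.rpow_one] at h3
  · refine le_trans ?_ h4
    have h6 : Real.exp (M * (L : ℝ) ^ δ + 2 * (L : ℝ) ^ β) * Real.exp (-(L : ℝ) ^ ζ) ≤
        Real.exp ((M + 2) * (L : ℝ) ^ δ - 1 * (L : ℝ) ^ ζ) := by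
      rw [← Real.exp_add, Real.exp_le_exp]
      linarith
    calc _ = 2 * A * Q * (3 * (L : ℝ)) ^ p *
          (Real.exp (M * (L : ℝ) ^ δ + 2 * (L : ℝ) ^ β) * Real.exp (-(L : ℝ) ^ ζ)) := by ring
      _ ≤ _ := by gcongr
  · have h6 : Real.exp (-(L : ℝ) ^ ζ) ≤ Real.exp (-(L : ℝ) ^ β) *
        Real.exp (1 * (L : ℝ) ^ δ - 1 * (L : ℝ) ^ ζ) := by
      rw [← Real.exp_add, Real.exp_le_exp]
      linarith
    rw [pow_zero, mul_one] at h5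
    calc Q * Real.exp (-(L : ℝ) ^ ζ) ≤ Q * (Real.exp (-(L : ℝ) ^ β) *
          Real.exp (1 * (L : ℝ) ^ δ - 1 * (L : ℝ) ^ ζ)) := by gcongr
      _ = Real.exp (-(L : ℝ) ^ β) * (Q * Real.exp (1 * (L : ℝ) ^ δ - 1 * (L : ℝ) ^ ζ)) := by ring
      _ ≤ Real.exp (-(L : ℝ) ^ β) * (1 / 2) := by gcongr
      _ = _ := by ring

/-- Each of the three contributions is at most a third of `exp (-m * L ^ δ)`. The last two contain
no mass, so that factor is inserted using `m ≤ M`. -/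
lemma IsLargeScale.mul_add_le {M c A B K m C : ℝ} {ε : ℝ → ℝ} {p p' L : ℕ}
    (h : IsLargeScale β δ M c A B K ε p L) (hm : m ≤ M) (hp : p' ≤ p) (hC : 0 ≤ C) (hCA : C ≤ A)
    (hB : 0 ≤ B) (hK : 0 ≤ K) (hε : 0 ≤ ε L) :
    C * (3 * (L : ℝ)) ^ p' *
      (2 * (Real.exp (-m * (L : ℝ) ^ δ) * (B * Real.exp (-(4 * (L : ℝ) ^ β))) +
        K * Real.exp (-(c * L))) + 2 * ε L / Real.exp (-(L : ℝ) ^ β) ^ 2) ≤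
      Real.exp (-m * (L : ℝ) ^ δ) := by
  have hL : (1 : ℝ) ≤ L := by exact_mod_cast h.one_le
  set e := Real.exp (-m * (L : ℝ) ^ δ) with he
  have hee : 1 ≤ e * Real.exp (M * (L : ℝ) ^ δ) := by
    rw [he, ← Real.exp_add, Real.one_le_exp_iff]
    have := mul_le_mul_of_nonneg_right hm (Real.rpow_nonneg (by linarith : (0 : ℝ) ≤ L) δ)
    linarith
  have hA : 0 ≤ A := hC.trans hCA
  have hCA' : C * (3 * (L : ℝ)) ^ p' ≤ A * (3 * (L : ℝ)) ^ p := by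
    have : (3 * (L : ℝ)) ^ p' ≤ (3 * (L : ℝ)) ^ p := pow_le_pow_right₀ (by linarith) hp
    gcongr
  have e2 : 2 * ε L / Real.exp (-(L : ℝ) ^ β) ^ 2 = 2 * (Real.exp (2 * (L : ℝ) ^ β) * ε L) := by
    rw [← Real.exp_nat_mul, div_eq_mul_inv, ← Real.exp_neg]
    push_cast
    ring_nf
  rw [e2]
  refine (mul_le_mul_of_nonneg_right hCA' (by positivity)).trans ?_
  have h1 := mul_le_mul_of_nonneg_left h.bound_nonsingular (Real.exp_pos (-m * (L : ℝ) ^ δ)).le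
  have h2 := mul_le_mul_of_nonneg_left h.bound_below (Real.exp_pos (-m * (L : ℝ) ^ δ)).le
  have h3 := mul_le_mul_of_nonneg_left h.bound_interaction (Real.exp_pos (-m * (L : ℝ) ^ δ)).le
  rw [← he] at h1 h2 h3
  have h2' : 2 * A * K * (3 * (L : ℝ)) ^ p * Real.exp (-(c * L)) ≤
      e * (2 * A * K * (3 * (L : ℝ)) ^ p * Real.exp (M * (L : ℝ) ^ δ - c * L)) := by
    rw [sub_eq_add_neg, Real.exp_add]
    calc _ ≤ (e * Real.exp (M * (L : ℝ) ^ δ)) *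
          (2 * A * K * (3 * (L : ℝ)) ^ p * Real.exp (-(c * L))) :=
          le_mul_of_one_le_left (by positivity) hee
      _ = _ := by ring
  have h3' : 2 * A * (3 * (L : ℝ)) ^ p * (Real.exp (2 * (L : ℝ) ^ β) * ε L) ≤
      e * (2 * A * (3 * (L : ℝ)) ^ p *
        (Real.exp (M * (L : ℝ) ^ δ + 2 * (L : ℝ) ^ β) * ε L)) := by
    rw [Real.exp_add]
    calc _ ≤ (e * Real.exp (M * (L : ℝ) ^ δ)) *
          (2 * A * (3 * (L : ℝ)) ^ p * (Real.exp (2 * (L : ℝ) ^ β) * ε L)) :=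
          le_mul_of_one_le_left (by positivity) hee
      _ = _ := by ring
  calc _ = e * (2 * A * B * (3 * (L : ℝ)) ^ p * Real.exp (-(4 * (L : ℝ) ^ β))) +
        2 * A * K * (3 * (L : ℝ)) ^ p * Real.exp (-(c * L)) +
        2 * A * (3 * (L : ℝ)) ^ p * (Real.exp (2 * (L : ℝ) ^ β) * ε L) := by ring
    _ ≤ e := by linarith

end

end MPAnderson

end

/-! ### The choice of constants and the conclusion. -/

open MPAnderson in
theorem lemmaB1
    (d Nstar Y : ℕ) (hd : 1 ≤ d) (hY : 2 ≤ Y)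
    (β δ ζ mstar : ℝ) (hβ : 0 < β) (hβδ : β < δ) (hδ : δ < min ζ 1) (hm : 1 ≤ mstar)
    (Estar E : ℝ) (hEstar : 0 < Estar) (hE : E < Estar)
    (CU : ℝ) (U₂ : ℝ → ℝ) (hU : MPAnderson.IsTwoBody ζ CU U₂)
    (r₁ Cφ : ℝ) (φ : (Fin d → ℤ) → (Fin d → ℝ) → ℝ) (hφ : MPAnderson.IsFlatTiling r₁ Cφ φ)
    (cV : ℝ) (hcV : 0 < cV)
    (CGRI : ℕ → ℝ) (hCGRI : ∀ n, 0 < CGRI n) :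
    ∃ Lmin : ℕ, ∀ L₀ : ℕ, Lmin ≤ L₀ →
      ∀ (k N : ℕ), N ≤ Nstar →
      ∀ (u : MPAnderson.LatConfig d (Fin N)),
      ∀ v : (Fin d → ℤ) → ℝ, (∀ a, v a ∈ Set.Icc 0 cV) →
      MPAnderson.IsWI u (L₀ * Y ^ k) →
      ∀ J : Finset (Fin N), MPAnderson.IsDecomp u (L₀ * Y ^ k) J →
      MPAnderson.IsNR (MPAnderson.potential U₂ φ v) u (L₀ * Y ^ k) E β →
      (∀ lam ∈ MPAnderson.hamSpectrum (MPAnderson.cube (MPAnderson.subConfig u J) (L₀ * Y ^ k))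
          (MPAnderson.potential U₂ φ v) ∩ Set.Icc 0 Estar,
        MPAnderson.IsNS (CGRI Jᶜ.card) (MPAnderson.potential U₂ φ v)
          (MPAnderson.subConfig u Jᶜ) (L₀ * Y ^ k) (E - lam) δ
          (MPAnderson.mass mstar β δ Nstar L₀ J.card)) →
      (∀ lam ∈ MPAnderson.hamSpectrum (MPAnderson.cube (MPAnderson.subConfig u Jᶜ) (L₀ * Y ^ k))
          (MPAnderson.potential U₂ φ v) ∩ Set.Icc 0 Estar,
        MPAnderson.IsNS (CGRI J.card) (MPAnderson.potential U₂ φ v)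
          (MPAnderson.subConfig u J) (L₀ * Y ^ k) (E - lam) δ
          (MPAnderson.mass mstar β δ Nstar L₀ Jᶜ.card)) →
      MPAnderson.IsNS (CGRI N) (MPAnderson.potential U₂ φ v) u (L₀ * Y ^ k) E δ
        (MPAnderson.mass mstar β δ Nstar L₀ N) := by
  obtain ⟨hδζ, hδ1⟩ := lt_min_iff.1 hδ
  -- The Combes–Thomas rate: `c ^ 2` is the least distance of `E - λ` below zero for `λ > E*`.
  set c := Real.sqrt (Estar - E) with hc
  have hc2 : c ^ 2 = Estar - E := Real.sq_sqrt (by linarith)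
  have hc0 : 0 < c := Real.sqrt_pos.2 (by linarith)
  -- Sums serve as common upper bounds for the finitely many constants `CGRI n` and, in `B`, for
  -- their inverses, for all `n ≤ Nstar`.
  set A := ∑ n ∈ Finset.range (Nstar + 1), CGRI n with hA
  set B := ∑ n ∈ Finset.range (Nstar + 1), (CGRI n)⁻¹ with hB
  set K := (Nstar * d : ℝ) * 2 * (2 / c ^ 2 * Real.exp c) with hK
  set Q := (Nstar : ℝ) ^ 2 * CU with hQ
  have hCU := hU.const_nonneg
  have hA0 : 0 ≤ A := Finset.sum_nonneg fun n _ => (hCGRI n).le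
  have hB0 : 0 ≤ B := Finset.sum_nonneg fun n _ => (inv_pos.2 (hCGRI n)).le
  have hCA : ∀ n ≤ Nstar, CGRI n ≤ A := fun n hn =>
    Finset.single_le_sum (f := CGRI) (fun n _ => (hCGRI n).le) (Finset.mem_range_succ_iff.2 hn)
  have hCB : ∀ n ≤ Nstar, (CGRI n)⁻¹ ≤ B := fun n hn =>
    Finset.single_le_sum (f := fun n => (CGRI n)⁻¹) (fun n _ => (inv_pos.2 (hCGRI n)).le)
      (Finset.mem_range_succ_iff.2 hn)
  obtain ⟨Lmin, hLmin⟩ := eventually_atTop.1 (eventually_isLargeScale (M := mstar * 5 ^ Nstar)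
    (B := B) (K := K) (p := Nstar * d) hβ hβδ hδ1 hδζ hc0 hA0 (show 0 ≤ Q by positivity))
  -- The mass estimates need `1 ≤ L₀`, not only a large scale `L`.
  refine ⟨max Lmin 1, fun L₀ hL₀ k N hN u v hv _ J hJ hNR hNS₂ hNS₁ => ?_⟩
  obtain ⟨hL₀m, hL₀1⟩ := max_le_iff.1 hL₀
  have hLL : L₀ ≤ L₀ * Y ^ k := Nat.le_mul_of_pos_right _ (pow_pos (by omega) k)
  have hlarge := hLmin _ (hL₀m.trans hLL)
  -- From here on, only `L₀ ≤ L` and the largeness of `L` matter.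
  generalize L₀ * Y ^ k = L at *
  have hL1 := hlarge.one_le
  have hL : (1 : ℝ) ≤ L := by exact_mod_cast hL1
  have hcard : J.card + Jᶜ.card = N := by rw [Finset.card_add_card_compl, Fintype.card_fin]
  have hJ1 := hJ.1.card_pos
  have hJ2 := hJ.2.1.card_pos
  have hbdd : ∀ {ι : Type} [Fintype ι] [LinearOrder ι] (Λ : Set (Config d ι)),
      IsBddPot Λ (potential U₂ φ v) := fun Λ => isBddPot_potential hU hφ hv Λ
  set e := Real.exp (-mass mstar β δ Nstar L₀ N * (L : ℝ) ^ δ) with he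
  set s := e * (B * Real.exp (-(4 * (L : ℝ) ^ β))) + K * Real.exp (-(c * L)) with hs
  -- One bound `s` for both groups: the mass gain gives `exp (-(4 * L ^ β))`, the factor `(3 * L) ^
  -- (n' * d) ≥ 1` is discarded, and `exp c` from `exp (c * (1 - L))` goes into `K`.
  have hdecay : ∀ n n' : ℕ, n < N → n' ≤ Nstar →
      Real.exp (-mass mstar β δ Nstar L₀ n * (L : ℝ) ^ δ) /
        (CGRI n' * (3 * (L : ℝ)) ^ (n' * d)) +
      ((n' : ℝ) * d) * 2 * (2 / c ^ 2 * Real.exp (c * (1 - L))) ≤ s := by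
    intro n n' hn hn'
    have h1 := mass_mul_rpow_add_le (β := β) (δ := δ) hm hβδ hL₀1 hLL hn hN
    have h2 : Real.exp (-mass mstar β δ Nstar L₀ n * (L : ℝ) ^ δ) ≤
        e * Real.exp (-(4 * (L : ℝ) ^ β)) := by
      rw [he, ← Real.exp_add, Real.exp_le_exp]
      linarith
    have h3 : (CGRI n' * (3 * (L : ℝ)) ^ (n' * d))⁻¹ ≤ B :=
      (inv_anti₀ (hCGRI n') (le_mul_of_one_le_right (hCGRI n').le
        (one_le_pow₀ (by linarith)))).trans (hCB n' hn')
    refine add_le_add ?_ ?_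
    · rw [div_eq_mul_inv]
      calc _ ≤ e * Real.exp (-(4 * (L : ℝ) ^ β)) * B := by
            have := hCGRI n'
            gcongr
        _ = _ := by ring
    · have h4 : Real.exp (c * (1 - L)) = Real.exp c * Real.exp (-(c * L)) := by
        rw [← Real.exp_add]; ring_nf
      have h5 : (n' : ℝ) ≤ Nstar := by exact_mod_cast hn'
      rw [h4, hK]
      calc _ = (n' : ℝ) * d * 2 * (2 / c ^ 2 * Real.exp c) * Real.exp (-(c * L)) := by ring
        _ ≤ _ := by gcongr
  have hmono : ∀ {ι : Type} [Fintype ι] [LinearOrder ι] {u : LatConfig d ι} {E s s' : ℝ},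
      s ≤ s' → HasDecay (potential U₂ φ v) u L E s → HasDecay (potential U₂ φ v) u L E s' :=
    fun hss h g η hg => (h g η hg).trans (mul_le_mul_of_nonneg_right hss (norm_nonneg _))
  have hs₁ : StrictMono fun i => sumCompl J (Sum.inl i) := fun _ _ h => h
  have hs₂ : StrictMono fun i => sumCompl J (Sum.inr i) := fun _ _ h => h
  set ε := Q * Real.exp (-(L : ℝ) ^ ζ) with hε
  have hε0 : 0 ≤ ε := by positivity
  have hcross : ∀ x ∈ cube u L, |crossInteraction U₂ (sumCompl J) x| ≤ ε := fun x hx => by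
    rw [abs_of_nonneg (crossInteraction_nonneg hU _ x)]
    refine (crossInteraction_le hU (by linarith) (sumCompl J) (Nat.cast_nonneg L)
      fun i j => (lt_norm_sub_of_isDecomp hJ hx i.2 j.2).le).trans ?_
    rw [hε, hQ, Fintype.card_fin, mul_assoc]
    have : (N : ℝ) ≤ Nstar := by exact_mod_cast hN
    gcongr
  -- Here `ρ = exp (-L ^ β)`, the distance to the spectrum given by non-resonance.
  obtain ⟨G, hG, hGn⟩ := norm_out_resolvent_cell_le (sumCompl J) u hL1 (hbdd _) (hbdd _) (hbdd _)
    (isBddPot_split hU hφ hv _ hs₁ hs₂ _)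
    (memLp_top_ofReal (measurable_crossInteraction hU _).aemeasurable
      ((MeasureTheory.ae_restrict_mem (isOpen_cube u L).measurableSet).mono hcross))
    (potential_split _ hs₁ hs₂) (E := E) (Real.exp_pos _) hε0 hlarge.interaction_le
    (show 0 ≤ s by positivity) hcross hNR
    (fun lam hlam h0 => hmono (by
      rw [Fintype.card_coe]
      exact hdecay _ _ (by omega) (by omega))
      (hasDecay_sub hL1 (hbdd _) (hCGRI Jᶜ.card) hc0 hc2.le h0
      fun h => hNS₂ lam ⟨hlam, h⟩))
    (fun lam hlam h0 => hmono (by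
      rw [Fintype.card_coe]
      exact hdecay _ _ (by omega) (by omega))
      (hasDecay_sub hL1 (hbdd _) (hCGRI J.card) hc0 hc2.le h0
      fun h => hNS₁ lam ⟨hlam, h⟩))
  refine ⟨G, hG, ?_⟩
  rw [Fintype.card_fin]
  refine (mul_le_mul_of_nonneg_left hGn (mul_nonneg (hCGRI N).le (by positivity))).trans ?_
  exact hlarge.mul_add_le (mass_le hm hβδ hL₀1 N) (Nat.mul_le_mul_right d hN) (hCGRI N).le
    (hCA N hN) hB0 (by positivity) hε0
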